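/- **Setting.** An instance of Election-Control-by-Seeding (ECS) consists of candidates $c_0,\dots,c_\ell$ ($\ell\ge1$), a finite nonempty set $V$ of voters, a directed graph $(V,E)$ with strengths $p:V\times V\to[0,1]$, injective scores $\pi_v:\{c_0,\dots,c_\ell\}\to\mathbb N$ ($v\in V$) and a budget $B\in\mathbb N$. A solution $(S,M)$ is a set $S\subseteq V$ of seeds with a message $m_s\in\mathbb Z^{\ell+1}$ for every $s\in S$; it is feasible if $|M|=\sum_{s\in S}\sum_i|m_s(i)|\le B$. The live graph $H\subseteq E$ contains each edge $e\in E$ independently with probability $p(e)$. The message of $s$ activates $s$ at time $0$, and at time $t\ge1$ every voter that it has not activated before and that has an incoming edge in $H$ from a voter activated by it at time $t-1$. After the diffusion the score of $c_i$ for $v$ is $(1-\epsilon)\pi_v(i)+\sum_s m_s(i)$, where the sum is over the seeds whose message activates $v$ at some time and $\epsilon=1/(1+\max_{v,i}\pi_v(i))$ (so ties are broken in favor of the candidate ranked lower initially). Let $V^*_c(S,M,H)$ be the set of voters whose highest final score is that of $c$, let $\mathrm{MoV}(S,M,H)=|V^*_{c_0}|-\max_{c\ne c_0}|V^*_c|$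 and $\Delta(S,M)=\mathbb E_H[\mathrm{MoV}(S,M,H)-\mathrm{MoV}(\emptyset,\emptyset,H)]$. A feasible $(S,M)$ is a $\rho$-approximation if $\Delta(S,M)\ge\rho\,\Delta(S',M')$ for all feasible $(S',M')$. Let $\delta=\max_{v\in V,\,i\ne0}(\pi_v(i)-\pi_v(0))$. **Theorem.** For the ECS instances with $1\le\delta\le B$ there is a greedy polynomial-time algorithm that returns a $\rho$-approximation, with $$\rho=\frac{B-\delta+1}{2\,\delta\,B}\Bigl(1-\frac1e\Bigr).$$ Precisely: 1. Let the greedy algorithm select $\min(\lfloor B/\delta\rfloor,|V|)$ distinct seeds one at a time, each sending $\delta$ positive articles on $c_0$ and nothing else, and each chosen so as to maximize $\mathbb E_H|V^*_{c_0}|$ after its addition. However ties are broken, the result is a $\rho$-approximation. 2. There is a randomized algorithm that receives an instance with rational $p$ (all numbers in binary) and a confidence parameter $k\in\mathbb N$ in unary, always runs in time polynomial in the length of this input, always returns a feasible $(S,M)$, and returns a $\rho$-approximation with probability at least $1-2^{-k}$. It builds $(S,M)$ greedily: it starts from $(\emptyset,\emptyset)$ and adds one pair $(s,m_s)$ with a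 new seed $s$ at a time, each addition strictly increasing $\mathbb E_H[\mathrm{MoV}]$ or $\mathbb E_H|V^*_{c_0}|$. -/

import Mathlib

/-! ### Election scenarios, diffusion and margin of victory -/

/-- An instance of Election-Control-by-Seeding: voters `Fin n`, candidates `c_0, …, c_ℓ` (with at
least one opponent of `c_0`), a directed graph with edge set `E` and influence strengths `p`,
injective scores, and a budget `B`. -/
structure ECSInstance where
  n : ℕ
  n_pos : 0 < n
  ℓ : ℕ
  ℓ_pos : 0 < ℓ
  E : Finset (Fin n × Fin n)
  p : Fin n × Fin n → ℝ
  p_nonneg : ∀ e, 0 ≤ p e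
  p_le_one : ∀ e, p e ≤ 1
  score : Fin n → Fin (ℓ + 1) → ℕ
  score_injective : ∀ v, Function.Injective (score v)
  B : ℕ

namespace ECSInstance

abbrev Voter (I : ECSInstance) : Type := Fin I.n

abbrev Candidate (I : ECSInstance) : Type := Fin (I.ℓ + 1)

/-- A message: the number of positive (or minus the number of negative) articles on each
candidate. -/
abbrev Message (I : ECSInstance) : Type := I.Candidate → ℤ

/-- A pair `(S, M)`, as the list of the seeds with their messages in the order of selection.
(That the seeds are distinct is part of `Feasible`.) -/
abbrev Plan (I : ECSInstance) : Type := List (I.Voter × I.Message)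

/-- The seed set of a plan. -/
def seeds {I : ECSInstance} (L : I.Plan) : List I.Voter := L.map Prod.fst

/-- The number of articles of a message. -/
def messageSize {I : ECSInstance} (m : I.Message) : ℕ := ∑ c, (m c).natAbs

/-- The number of articles of a plan, which is its cost. -/
def planSize {I : ECSInstance} (L : I.Plan) : ℕ := (L.map fun sm => messageSize sm.2).sum

/-- The probability that the live graph has exactly the edges `H ⊆ E`. -/
noncomputable def liveProb (I : ECSInstance) (H : Finset (I.Voter × I.Voter)) : ℝ :=
  (∏ e ∈ H, I.p e) * ∏ e ∈ I.E \ H, (1 - I.p e)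

/-- Expectation over the random live graph. -/
noncomputable def expect (I : ECSInstance) (f : Finset (I.Voter × I.Voter) → ℝ) : ℝ :=
  ∑ H ∈ I.E.powerset, I.liveProb H * f H

/-- `(A, U)` where `A` is the set of voters that the message of the seed `s` activates at time `t`
in the live graph `H`, and `U` the set of those that it activates at some time `≤ t`. -/
def cascade {I : ECSInstance} (H : Finset (I.Voter × I.Voter)) (s : I.Voter) :
    ℕ → Finset I.Voter × Finset I.Voter
  | 0 => ({s}, {s})
  | t + 1 =>
    let A := Finset.univ.filter fun v =>
      v ∉ (cascade H s t).2 ∧ ∃ u ∈ (cascade H s t).1, (u, v) ∈ H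
    (A, (cascade H s t).2 ∪ A)

/-- The message of `s` activates `v` at some time. -/
def Influenced {I : ECSInstance} (H : Finset (I.Voter × I.Voter)) (s v : I.Voter) : Prop :=
  ∃ t, v ∈ (cascade H s t).1

/-- The perturbation `ε = 1 / (1 + max π_v(i))`. It breaks ties in favor of the candidate that was
ranked lower before the diffusion. -/
def perturbation (I : ECSInstance) : ℚ :=
  1 / (1 + ((Finset.univ.sup fun v => Finset.univ.sup fun c => I.score v c : ℕ) : ℚ))

open Classical in
/-- The score of candidate `c` for voter `v` after the diffusion. -/
noncomputable def finalScore (I : ECSInstance) (L : I.Plan) (H : Finset (I.Voter × I.Voter))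
    (v : I.Voter) (c : I.Candidate) : ℚ :=
  (1 - I.perturbation) * (I.score v c : ℚ) +
    (L.map fun sm => if Influenced H sm.1 v then ((sm.2 c : ℤ) : ℚ) else 0).sum

open Classical in
/-- The set `V*_c` of voters that rank `c` first after the diffusion. -/
noncomputable def supporters (I : ECSInstance) (L : I.Plan) (H : Finset (I.Voter × I.Voter))
    (c : I.Candidate) : Finset I.Voter :=
  Finset.univ.filter fun v => ∀ d, d ≠ c → I.finalScore L H v d < I.finalScore L H v c

/-- The margin of victory of `c_0`. -/
noncomputable def MoV (I : ECSInstance) (L : I.Plan) (H : Finset (I.Voter × I.Voter)) : ℤ :=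
  ((I.supporters L H 0).card : ℤ) -
    (((Finset.univ.erase (0 : I.Candidate)).sup fun c => (I.supporters L H c).card : ℕ) : ℤ)

/-- Expected margin of victory. -/
noncomputable def expMoV (I : ECSInstance) (L : I.Plan) : ℝ :=
  I.expect fun H => (I.MoV L H : ℝ)

/-- Expected number of votes of `c_0`. -/
noncomputable def expVotes (I : ECSInstance) (L : I.Plan) : ℝ :=
  I.expect fun H => ((I.supporters L H 0).card : ℝ)

/-- The objective: the expected increase of the margin of victory. -/
noncomputable def expGain (I : ECSInstance) (L : I.Plan) : ℝ :=
  I.expect fun H => ((I.MoV L H - I.MoV [] H : ℤ) : ℝ)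

/-- Distinct seeds, and at most `B` articles. -/
def Feasible (I : ECSInstance) (L : I.Plan) : Prop :=
  (seeds L).Nodup ∧ planSize L ≤ I.B

/-- `L` is feasible and its value is at least `ρ` times that of every feasible plan. -/
def IsApprox (I : ECSInstance) (ρ : ℝ) (L : I.Plan) : Prop :=
  I.Feasible L ∧ ∀ L' : I.Plan, I.Feasible L' → ρ * I.expGain L' ≤ I.expGain L

theorem pairs_nonempty (I : ECSInstance) :
    ((Finset.univ : Finset I.Voter) ×ˢ (Finset.univ.erase (0 : I.Candidate))).Nonempty := by
  refine ⟨(⟨0, I.n_pos⟩, ⟨1, by have := I.ℓ_pos; omega⟩), ?_⟩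
  simp [Fin.ext_iff]

/-- `δ = max_{v, c_i ≠ c_0} (π_v(i) - π_v(0))`. -/
def delta (I : ECSInstance) : ℤ :=
  ((Finset.univ : Finset I.Voter) ×ˢ (Finset.univ.erase (0 : I.Candidate))).sup' I.pairs_nonempty
    fun x => (I.score x.1 x.2 : ℤ) - (I.score x.1 0 : ℤ)

/-- `ρ = (B - δ + 1) / (2 δ B) · (1 - 1/e)`. -/
noncomputable def ratio (I : ECSInstance) : ℝ :=
  ((I.B : ℝ) - (I.delta : ℝ) + 1) / (2 * (I.delta : ℝ) * (I.B : ℝ)) * (1 - 1 / Real.exp 1)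

/-! ### Greedy -/

/-- The set `F(S, M)`: the pairs `(s, m_s)`, with `s` not yet a seed, whose addition increases the
expected margin of victory or the expected number of votes of `c_0`. -/
def improvements (I : ECSInstance) (L : I.Plan) : Set (I.Voter × I.Message) :=
  {sm | sm.1 ∉ seeds L ∧
    (I.expMoV L < I.expMoV (L ++ [sm]) ∨ I.expVotes L < I.expVotes (L ++ [sm]))}

/-- The plans that arise from the empty one by adding members of `F(S, M)` one at a time. -/
inductive GreedyBuilt (I : ECSInstance) : I.Plan → Prop
  | nil : GreedyBuilt I []
  | snoc (L : I.Plan) (sm : I.Voter × I.Message) :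
      GreedyBuilt I L → sm ∈ I.improvements L → GreedyBuilt I (L ++ [sm])

/-- All the given seeds send `δ` positive articles on `c_0`. -/
def deltaPlan (I : ECSInstance) (S : List I.Voter) : I.Plan :=
  S.map fun s => (s, Pi.single 0 I.delta)

/-- The runs of the greedy algorithm that adds, at each time, a new seed (sending `δ` positive
articles on `c_0`) that most increases the expected number of votes of `c_0`. -/
inductive GreedySeeds (I : ECSInstance) : List I.Voter → Prop
  | nil : GreedySeeds I []
  | snoc (S : List I.Voter) (s : I.Voter) :
      GreedySeeds I S → s ∉ S →
      (∀ t, t ∉ S → I.expVotes (I.deltaPlan (S ++ [t])) ≤ I.expVotes (I.deltaPlan (S ++ [s]))) →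
      GreedySeeds I (S ++ [s])

end ECSInstance

/-! ### A programming language with a cost model

Values are binary trees with natural numbers at the leaves. Reading and writing a variable, pairing
and projecting cost one step each (they move pointers), arithmetic costs the bit lengths of its
operands. A Turing machine simulates a program with polynomial overhead. All loops run through a
list, so that every program terminates. -/

/-- Values. The list `[a, b, …]` is `pair a (pair b …)`, ending in `num 0`. -/
inductive Val : Type
  | num (k : ℕ) : Val
  | pair (a b : Val) : Val

namespace Val

/-- Length of a value as an input, with numbers in binary. -/
def size : Val → ℕ
  | num k => 1 + k.size
  | pair a b => 1 + a.size + b.size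

def ofList : List Val → Val
  | [] => num 0
  | a :: l => pair a (ofList l)

def toNum : Val → ℕ
  | num k => k
  | pair _ _ => 0

def fst : Val → Val
  | num _ => num 0
  | pair a _ => a

def snd : Val → Val
  | num _ => num 0
  | pair _ b => b

def isPair : Val → Val
  | num _ => num 0
  | pair _ _ => num 1

end Val

inductive ArithOp : Type
  | add | sub | mul | div | lt | eq

def ArithOp.apply : ArithOp → ℕ → ℕ → ℕ
  | add, a, b => a + b
  | sub, a, b => a - b
  | mul, a, b => a * b
  | div, a, b => a / b
  | lt, a, b => if a < b then 1 else 0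
  | eq, a, b => if a = b then 1 else 0

inductive PExpr : Type
  | var (x : ℕ) : PExpr
  | const (k : ℕ) : PExpr
  | pair (e f : PExpr) : PExpr
  | fst (e : PExpr) : PExpr
  | snd (e : PExpr) : PExpr
  | isPair (e : PExpr) : PExpr
  | arith (o : ArithOp) (e f : PExpr) : PExpr

/-- The contents of the variables. -/
abbrev Store : Type := ℕ → Val

namespace PExpr

def eval (σ : Store) : PExpr → Val
  | var x => σ x
  | const k => Val.num k
  | pair e f => Val.pair (e.eval σ) (f.eval σ)
  | fst e => (e.eval σ).fst
  | snd e => (e.eval σ).snd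
  | isPair e => (e.eval σ).isPair
  | arith o e f => Val.num (o.apply (e.eval σ).toNum (f.eval σ).toNum)

def cost (σ : Store) : PExpr → ℕ
  | var _ => 1
  | const k => 1 + k.size
  | pair e f => 1 + e.cost σ + f.cost σ
  | fst e => 1 + e.cost σ
  | snd e => 1 + e.cost σ
  | isPair e => 1 + e.cost σ
  | arith _ e f =>
      1 + e.cost σ + f.cost σ + (e.eval σ).toNum.size + (f.eval σ).toNum.size

end PExpr

inductive Prog : Type
  | skip : Prog
  | assign (x : ℕ) (e : PExpr) : Prog
  | seq (c d : Prog) : Prog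
  | ite (e : PExpr) (c d : Prog) : Prog
  | forEach (x : ℕ) (e : PExpr) (c : Prog) : Prog

namespace Prog

/-- Runs `body` once for every entry of a list, with the entry in the variable `x`. -/
def loop (body : Store → Store × ℕ) (x : ℕ) : Val → Store → Store × ℕ
  | Val.num _, σ => (σ, 1)
  | Val.pair a b, σ =>
      let r := body (Function.update σ x a)
      let r' := loop body x b r.1
      (r'.1, 1 + r.2 + r'.2)

/-- The final store and the number of steps. -/
def run : Prog → Store → Store × ℕ
  | skip, σ => (σ, 1)
  | assign x e, σ => (Function.update σ x (e.eval σ), 1 + e.cost σ)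
  | seq c d, σ =>
      let r := c.run σ
      let r' := d.run r.1
      (r'.1, r.2 + r'.2)
  | ite e c d, σ =>
      let r := if (e.eval σ).toNum ≠ 0 then c.run σ else d.run σ
      (r.1, 1 + e.cost σ + r.2)
  | forEach x e c, σ =>
      let r := loop c.run x (e.eval σ) σ
      (r.1, 1 + e.cost σ + r.2)

/-- The input is in variable 0, a list of random bits in variable 1, all else is `0`. -/
def initStore (input : Val) {k : ℕ} (bits : Fin k → Bool) : Store := fun x =>
  if x = 0 then input
  else if x = 1 then Val.ofList ((List.ofFn bits).map fun b => Val.num b.toNat)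
  else Val.num 0

/-- The output is read off variable 0. -/
def output (P : Prog) (input : Val) {k : ℕ} (bits : Fin k → Bool) : Val :=
  (P.run (initStore input bits)).1 0

/-- The running time. -/
def time (P : Prog) (input : Val) {k : ℕ} (bits : Fin k → Bool) : ℕ :=
  (P.run (initStore input bits)).2

end Prog

/-- The probability of an event for `k` fair coins. -/
noncomputable def coinProb {k : ℕ} (A : Set (Fin k → Bool)) : ℝ :=
  (A.ncard : ℝ) / 2 ^ k

namespace ECSInstance

/-- The encoding of an instance whose influence strengths are the rationals `q`: the list of the
score vectors, the list of the edges `(u, v)` with numerator and denominator of `q (u, v)`, and the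
budget. -/
def encode (I : ECSInstance) (q : I.Voter × I.Voter → ℚ) : Val :=
  Val.ofList
    [ Val.ofList ((List.finRange I.n).map fun v =>
        Val.ofList ((List.finRange (I.ℓ + 1)).map fun c => Val.num (I.score v c))),
      Val.ofList ((((List.finRange I.n).product (List.finRange I.n)).filter
        fun e => decide (e ∈ I.E)).map fun e =>
          Val.ofList [Val.num e.1, Val.num e.2, Val.num (q e).num.toNat, Val.num (q e).den]),
      Val.num I.B ]

/-- The input of a randomized algorithm: the encoded instance with a confidence parameter `k` in
unary. -/
def encodeInput (I : ECSInstance) (q : I.Voter × I.Voter → ℚ) (k : ℕ) : Val :=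
  Val.pair (I.encode q) (Val.ofList (List.replicate k (Val.num 0)))

/-- The encoding of a plan; an integer `z` is the pair of `max z 0` and `max (-z) 0`. -/
def encodePlan {I : ECSInstance} (L : I.Plan) : Val :=
  Val.ofList (L.map fun sm =>
    Val.pair (Val.num sm.1)
      (Val.ofList ((List.finRange (I.ℓ + 1)).map fun c =>
        Val.pair (Val.num (sm.2 c).toNat) (Val.num (-sm.2 c).toNat))))

end ECSInstance

/-! Everything reduces to a coverage function. Call a voter opposed if it does not rank `c_0` first
initially, and let `F(T)` (`expCover`) be the expected number of opposed voters reached from `T`. A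
count of covered voters is monotone and submodular in every live graph, hence so is its expectation
`F`. Upper bound (`expGain_le`): opposed voters that receive no article keep their vote. Each
covered opposed voter raises the margin by at most 2, one vote won by `c_0` and one lost by the
strongest opponent. A feasible plan has at most `D = min(B, n)` seeds that send anything, so its
gain is at most `2 F(T)` for some `T` with `|T| ≤ D`. Lower bound (`expCover_le_expGain`): `δ`
articles on `c_0` win every opposed voter they reach, because deficits are scaled by `1 - ε < 1`,
and no opponent gains votes. The gain is therefore at least `F(S)`. Greedy with `K = min(⌊B/δ⌋, n)`
seeds reaches `(1 - (1 - 1/D)^K) F(T)` for all such `T`. This factor exceeds `(K/D)(1 - 1/e)` by at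
least `1/(9D²)` (`greedy_ratio_ge`), and `K/D ≥ (B - δ + 1)/(δB)` (`ratio_le`). With the loss of 2
this gives part 1. For part 2, `F` is replaced by its sum over sampled live graphs. By a Chernoff
bound and a union bound over the `2^n` seed sets, with probability at least `1 - 2^{-k}` the sample
means of all sets are within `1/(18n²)` of `F` (`avg_not_accurate_le`). The slack `1/(9D²)` absorbs
this error, because some single seed already has `F ≥ 1`; so the ratio is reached without loss
(`isApprox_of_accurate`). Every sampled graph has positive probability, so a strict increase on the
samples is a strict increase of the true expected votes, which makes the plan greedily built.
Polynomial time is proved compositionally: `PolyTime` is closed under composition, pairing,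
branching and size-controlled folds. The sampling algorithm, written on lists and numbers, is
assembled from these and then identified with its counterpart on instances. -/

namespace ECSInstance

/-! ### Coverage of the voters that do not support `c_0` initially -/

/-- The voters that do not rank `c_0` first before the diffusion. -/
def opposed (I : ECSInstance) : Finset I.Voter :=
  Finset.univ.filter fun v => ∃ d, I.score v 0 < I.score v d

open Classical in
/-- The opposed voters that the message of some member of `T` activates. -/
noncomputable def covered (I : ECSInstance) (H : Finset (I.Voter × I.Voter))
    (T : Finset I.Voter) : Finset I.Voter :=
  I.opposed.filter fun v => ∃ s ∈ T, Influenced H s v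

/-- Expected number of opposed voters that are activated from `T`. -/
noncomputable def expCover (I : ECSInstance) (T : Finset I.Voter) : ℝ :=
  I.expect fun H => ((I.covered H T).card : ℝ)

variable {I : ECSInstance}

theorem influenced_self (H : Finset (I.Voter × I.Voter)) (s : I.Voter) : Influenced H s s :=
  ⟨0, by simp [cascade]⟩

theorem mem_covered {H : Finset (I.Voter × I.Voter)} {T : Finset I.Voter} {v : I.Voter} :
    v ∈ I.covered H T ↔ v ∈ I.opposed ∧ ∃ s ∈ T, Influenced H s v := by
  simp [covered]

theorem covered_mono (H : Finset (I.Voter × I.Voter)) : Monotone (I.covered H) := by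
  intro S T h v
  simp only [covered, Finset.mem_filter]
  rintro ⟨hv, s, hs, hi⟩
  exact ⟨hv, s, h hs, hi⟩

theorem card_covered_le (H : Finset (I.Voter × I.Voter)) (T : Finset I.Voter) :
    (I.covered H T).card ≤ I.n := by
  simpa using Finset.card_le_univ (I.covered H T)

theorem covered_empty (H : Finset (I.Voter × I.Voter)) : I.covered H ∅ = ∅ := by
  simp [covered]

end ECSInstance

/-! ### Monotone submodular set functions and greedy steps -/

/-- A monotone submodular set function that vanishes at `∅`. -/
structure IsCoverage {α : Type*} [DecidableEq α] (F : Finset α → ℝ) : Prop where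
  empty : F ∅ = 0
  mono : Monotone F
  -- Given monotonicity, this is equivalent to submodularity; it is the form that the greedy
  -- argument uses.
  le_add_sum : ∀ S T, F T ≤ F S + ∑ t ∈ T, (F (insert t S) - F S)

namespace IsCoverage

variable {α : Type*} [DecidableEq α] {F : Finset α → ℝ}

theorem nonneg (h : IsCoverage F) (S : Finset α) : 0 ≤ F S :=
  h.empty ▸ h.mono (Finset.empty_subset S)

/-- Serves both the expectation (weights `liveProb`) and the sum over samples (weights 1). -/
theorem sum {ι : Type*} (s : Finset ι) (w : ι → ℝ) (hw : ∀ i ∈ s, 0 ≤ w i)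
    (G : ι → Finset α → ℝ) (hG : ∀ i ∈ s, IsCoverage (G i)) :
    IsCoverage fun S => ∑ i ∈ s, w i * G i S where
  empty := Finset.sum_eq_zero fun i hi => by simp [(hG i hi).empty]
  mono S T h := Finset.sum_le_sum fun i hi => mul_le_mul_of_nonneg_left ((hG i hi).mono h) (hw i hi)
  le_add_sum S T := by
    have : ∑ t ∈ T, (∑ i ∈ s, w i * G i (insert t S) - ∑ i ∈ s, w i * G i S) =
        ∑ i ∈ s, w i * ∑ t ∈ T, (G i (insert t S) - G i S) := by
      simp_rw [← Finset.sum_sub_distrib, ← mul_sub, Finset.mul_sum]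
      rw [Finset.sum_comm]
    rw [this, ← Finset.sum_add_distrib]
    refine Finset.sum_le_sum fun i hi => ?_
    rw [← mul_add]
    exact mul_le_mul_of_nonneg_left ((hG i hi).le_add_sum S T) (hw i hi)

/-- One greedy step closes a `1 / D` fraction of the gap to every set of at most `D` elements. -/
theorem gap_step (h : IsCoverage F) {S T : Finset α} {D : ℕ} (hD : 0 < D) (hT : T.card ≤ D)
    {x : ℝ} (hS : F S ≤ x) (hx : ∀ t, F (insert t S) ≤ x) :
    F T - x ≤ (1 - 1 / (D : ℝ)) * (F T - F S) := by
  -- `x` is the value after the step. It only has to dominate `F S` and all one-element extensions,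
  -- so a step that adds nothing because nothing helps is covered too.
  have h1 : ∑ t ∈ T, (F (insert t S) - F S) ≤ D * (x - F S) := by
    calc _ ≤ ∑ _t ∈ T, (x - F S) := Finset.sum_le_sum fun t _ => by linarith [hx t]
      _ = T.card * (x - F S) := by rw [Finset.sum_const, nsmul_eq_mul]
      _ ≤ _ := by
        refine mul_le_mul_of_nonneg_right ?_ (by linarith)
        exact_mod_cast hT
  have h2 := h.le_add_sum S T
  have hD' : (0 : ℝ) < D := by exact_mod_cast hD
  have h3 : (F T - F S) / D ≤ x - F S := by
    rw [div_le_iff₀ hD']; linarith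
  have : (1 - 1 / (D : ℝ)) * (F T - F S) = (F T - F S) - (F T - F S) / D := by ring
  linarith

end IsCoverage

/-! ### Numerical estimates for the greedy ratio -/

/-- `(1 - q^K) / K` is, up to the factor `1 - q`, the average of `1, q, …, q^(K-1)`, and averages of
a decreasing sequence decrease. -/
theorem one_sub_pow_ge {q : ℝ} (hq0 : 0 ≤ q) (hq1 : q ≤ 1) {K D : ℕ} (h : K ≤ D) :
    (K : ℝ) * (1 - q ^ D) ≤ D * (1 - q ^ K) := by
  induction D, h using Nat.le_induction with
  | base => exact le_rfl
  | succ D hKD ih =>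
    have h1 : q ^ D * (1 - q) * K ≤ 1 - q ^ K := by
      have h2 : 1 - q ^ K = (1 - q) * ∑ i ∈ Finset.range K, q ^ i := by
        rw [mul_comm, geom_sum_mul_neg]
      have h3 : (K : ℝ) * q ^ D ≤ ∑ i ∈ Finset.range K, q ^ i := by
        calc (K : ℝ) * q ^ D = ∑ _i ∈ Finset.range K, q ^ D := by simp
          _ ≤ _ := Finset.sum_le_sum fun i hi =>
            pow_le_pow_of_le_one hq0 hq1 ((Finset.mem_range.1 hi).le.trans hKD)
      rw [h2]
      nlinarith
    push_cast
    rw [pow_succ]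
    nlinarith

/-- In `a^D - b^D = (a - b) ∑ a^i b^(D-1-i)` each of the `D` summands is at least `b^(D-1)`. -/
theorem pow_sub_pow_ge {a b : ℝ} (hb : 0 ≤ b) (hab : b ≤ a) (D : ℕ) :
    D * b ^ (D - 1) * (a - b) ≤ a ^ D - b ^ D := by
  rw [← Commute.geom_sum₂_mul (Commute.all a b)]
  refine mul_le_mul_of_nonneg_right ?_ (by linarith)
  calc (D : ℝ) * b ^ (D - 1) = ∑ _i ∈ Finset.range D, b ^ (D - 1) := by simp
    _ ≤ _ := Finset.sum_le_sum fun i hi => by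
      have := Finset.mem_range.1 hi
      calc b ^ (D - 1) = b ^ i * b ^ (D - 1 - i) := by rw [← pow_add]; congr 1; omega
        _ ≤ _ := by gcongr

/-- The quadratic term is what makes the gap between `(1 - 1/D)^D` and `1/e` explicit. -/
theorem exp_neg_ge_quadratic {x : ℝ} (h0 : 0 ≤ x) (h1 : x ≤ 1) :
    1 - x + x ^ 2 / 3 ≤ Real.exp (-x) := by
  have h := Real.exp_bound (x := -x) (by rw [abs_neg, abs_of_nonneg h0]; exact h1)
    (n := 6) (by norm_num)
  rw [abs_neg, abs_of_nonneg h0] at h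
  have h2 := (abs_le.1 h).1
  simp only [Finset.sum_range_succ, Finset.sum_range_zero, Nat.factorial] at h2
  norm_num at h2
  -- The degree-5 Taylor polynomial less the remainder bound `7/4320 x^6` less the claimed bound,
  -- grouped into two nonnegative parts.
  have h3 : 0 ≤ x ^ 2 * ((1 - x) / 6 + x ^ 2 * (1 / 24 - x / 120 - x ^ 2 * (7 / 4320))) := by
    have : x ^ 2 ≤ 1 := pow_le_one₀ h0 h1
    have h4 : 0 ≤ 1 / 24 - x / 120 - x ^ 2 * (7 / 4320) := by linarith
    have h5 : 0 ≤ (1 - x) / 6 := by linarith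
    positivity
  nlinarith

/-- Compare the `D`-th powers of `a = e^(-1/D)` and `b = 1 - 1/D`. They differ by at least `D
b^(D-1) (a - b)`, where `b^(D-1) ≥ 1/3` and `a - b ≥ 1/(3D²)`. -/
theorem one_sub_inv_pow_le {D : ℕ} (hD : 0 < D) :
    (1 - 1 / (D : ℝ)) ^ D + 1 / (9 * D) ≤ 1 / Real.exp 1 := by
  have hD' : (1 : ℝ) ≤ D := by exact_mod_cast hD
  have hD0 : (0 : ℝ) < D := by linarith
  set b : ℝ := 1 - 1 / (D : ℝ) with hb
  have hx1 : 1 / (D : ℝ) ≤ 1 := by rw [div_le_one hD0]; exact hD'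
  have hb0 : 0 ≤ b := by rw [hb]; linarith
  have hq := exp_neg_ge_quadratic (x := 1 / (D : ℝ)) (by positivity) hx1
  have hxx : (0 : ℝ) ≤ (1 / (D : ℝ)) ^ 2 / 3 := by positivity
  have h1 := pow_sub_pow_ge hb0 (a := Real.exp (-(1 / (D : ℝ)))) (by rw [hb]; linarith) D
  have h2 : Real.exp (-(1 / (D : ℝ))) ^ D = 1 / Real.exp 1 := by
    rw [← Real.exp_nat_mul, one_div (Real.exp 1), ← Real.exp_neg]
    congr 1; field_simp
  -- With `m = D - 1 > 0`, the base `b` is the inverse of `1 + 1/m`, and `(1 + 1/m)^m ≤ e < 3`.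
  have h3 : 1 / 3 ≤ b ^ (D - 1) := by
    obtain ⟨m, rfl⟩ : ∃ m, D = m + 1 := ⟨D - 1, by omega⟩
    rcases Nat.eq_zero_or_pos m with rfl | hm
    · norm_num
    have hm' : (0 : ℝ) < m := by exact_mod_cast hm
    have hbm : b * (1 + 1 / (m : ℝ)) = 1 := by
      rw [hb]; push_cast; field_simp; ring
    have he : (1 + 1 / (m : ℝ)) ^ m ≤ 3 := by
      calc (1 + 1 / (m : ℝ)) ^ m ≤ Real.exp (1 / m) ^ m := by
            gcongr; rw [add_comm]; exact Real.add_one_le_exp _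
        _ = Real.exp 1 := by rw [← Real.exp_nat_mul]; congr 1; field_simp
        _ ≤ 3 := by linarith [Real.exp_one_lt_d9]
    have hprod : b ^ m * (1 + 1 / (m : ℝ)) ^ m = 1 := by rw [← mul_pow, hbm, one_pow]
    have hbp : 0 ≤ b ^ m := by positivity
    simp only [Nat.add_sub_cancel]
    nlinarith
  have h4 : 1 / (9 * (D : ℝ)) ≤ D * b ^ (D - 1) * (Real.exp (-(1 / (D : ℝ))) - b) := by
    calc 1 / (9 * (D : ℝ)) = D * (1 / 3) * ((1 / (D : ℝ)) ^ 2 / 3) := by field_simp; norm_num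
      _ ≤ _ := by
        gcongr
        rw [hb]; linarith
  rw [h2] at h1
  linarith

/-- The greedy guarantee beats the linear one by a margin polynomial in `1 / D`. -/
theorem greedy_ratio_ge {K D : ℕ} (hK : 0 < K) (hKD : K ≤ D) :
    (K : ℝ) / D * (1 - 1 / Real.exp 1) + 1 / (9 * (D : ℝ) ^ 2) ≤ 1 - (1 - 1 / (D : ℝ)) ^ K := by
  have hD : 0 < D := by omega
  have hD' : (1 : ℝ) ≤ D := by exact_mod_cast hD
  have hD0 : (0 : ℝ) < D := by linarith
  have hK' : (1 : ℝ) ≤ K := by exact_mod_cast hK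
  have hx1 : 1 / (D : ℝ) ≤ 1 := by rw [div_le_one hD0]; exact hD'
  have hx0 : 0 ≤ 1 / (D : ℝ) := by positivity
  have h1 := one_sub_pow_ge (q := 1 - 1 / (D : ℝ)) (by linarith) (by linarith) hKD
  have h2 := one_sub_inv_pow_le hD
  have h3 : (K : ℝ) / D * (1 - (1 - 1 / (D : ℝ)) ^ D) ≤ 1 - (1 - 1 / (D : ℝ)) ^ K := by
    rw [div_mul_eq_mul_div, div_le_iff₀ hD0]; linarith
  refine le_trans ?_ h3
  -- `K ≥ 1` turns the slack `(K/D) · 1/(9D)` into one that does not depend on `K`.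
  have h4 : 1 / (9 * (D : ℝ) ^ 2) ≤ K / D * (1 / (9 * D)) := by
    calc 1 / (9 * (D : ℝ) ^ 2) = 1 / D * (1 / (9 * D)) := by field_simp
      _ ≤ _ := by gcongr
  have h5 : (0 : ℝ) ≤ K / D := by positivity
  nlinarith

namespace ECSInstance

variable {I : ECSInstance}

/-! ### Expectations -/

theorem liveProb_nonneg (H : Finset (I.Voter × I.Voter)) : 0 ≤ I.liveProb H :=
  mul_nonneg (Finset.prod_nonneg fun e _ => I.p_nonneg e)
    (Finset.prod_nonneg fun e _ => sub_nonneg.2 (I.p_le_one e))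

theorem sum_liveProb (I : ECSInstance) : ∑ H ∈ I.E.powerset, I.liveProb H = 1 := by
  have h := Finset.prod_add I.p (fun e => 1 - I.p e) I.E
  simp only [add_sub_cancel, Finset.prod_const_one] at h
  exact h.symm

theorem expect_const (I : ECSInstance) (c : ℝ) : I.expect (fun _ => c) = c := by
  rw [expect, ← Finset.sum_mul, sum_liveProb, one_mul]

theorem expect_add (f g : Finset (I.Voter × I.Voter) → ℝ) :
    I.expect (fun H => f H + g H) = I.expect f + I.expect g := by
  simp [expect, mul_add, Finset.sum_add_distrib]

theorem expect_mul_left (c : ℝ) (f : Finset (I.Voter × I.Voter) → ℝ) :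
    I.expect (fun H => c * f H) = c * I.expect f := by
  simp only [expect, Finset.mul_sum]
  exact Finset.sum_congr rfl fun _ _ => by ring

theorem expect_mono {f g : Finset (I.Voter × I.Voter) → ℝ} (h : ∀ H, f H ≤ g H) :
    I.expect f ≤ I.expect g :=
  Finset.sum_le_sum fun H _ => mul_le_mul_of_nonneg_left (h H) (liveProb_nonneg H)

/-- A voter covered by `T` but not by `S` is reached from a single `t ∈ T`, hence is a new voter of
`insert t S`; the union bound over `t` gives submodularity. -/
theorem isCoverage_card_covered (H : Finset (I.Voter × I.Voter)) :
    IsCoverage fun T => ((I.covered H T).card : ℝ) where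
  empty := by simp [covered_empty]
  mono S T h := Nat.cast_le.2 <| Finset.card_le_card (covered_mono H h)
  le_add_sum S T := by
    have hsub : I.covered H T ⊆
        I.covered H S ∪ T.biUnion fun t => I.covered H (insert t S) \ I.covered H S := by
      intro v hv
      simp only [Finset.mem_union, Finset.mem_biUnion, Finset.mem_sdiff]
      by_cases hS : v ∈ I.covered H S
      · exact Or.inl hS
      · obtain ⟨hv1, t, ht, hi⟩ := by simpa only [covered, Finset.mem_filter] using hv
        refine Or.inr ⟨t, ht, ?_, hS⟩
        simp only [covered, Finset.mem_filter]
        exact ⟨hv1, t, Finset.mem_insert_self _ _, hi⟩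
    have h1 := (Finset.card_le_card hsub).trans (Finset.card_union_le _ _)
    have h2 := Finset.card_biUnion_le (s := T)
      (t := fun t => I.covered H (insert t S) \ I.covered H S)
    have h3 : ((I.covered H T).card : ℝ) ≤ (I.covered H S).card +
        ∑ t ∈ T, ((I.covered H (insert t S) \ I.covered H S).card : ℝ) := by
      exact_mod_cast h1.trans (Nat.add_le_add_left h2 _)
    refine h3.trans (le_of_eq ?_)
    congr 1
    refine Finset.sum_congr rfl fun t _ => ?_
    exact Finset.cast_card_sdiff (covered_mono H (Finset.subset_insert t S))

theorem isCoverage_expCover (I : ECSInstance) : IsCoverage I.expCover :=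
  IsCoverage.sum I.E.powerset I.liveProb (fun H _ => liveProb_nonneg H)
    (fun H T => ((I.covered H T).card : ℝ)) fun H _ => isCoverage_card_covered H

/-! ### The effect of a plan on the votes -/

theorem perturbation_pos (I : ECSInstance) : 0 < I.perturbation := by
  unfold perturbation; positivity

/-- There are at least two candidates and scores are injective, so the maximal score is positive.
Hence `1 - ε > 0`, and scaling by it preserves the initial ranking. -/
theorem perturbation_lt_one (I : ECSInstance) : I.perturbation < 1 := by
  have h : 0 < Finset.univ.sup fun v => Finset.univ.sup fun c => I.score v c := by
    let v : I.Voter := ⟨0, I.n_pos⟩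
    let c : I.Candidate := ⟨1, by have := I.ℓ_pos; omega⟩
    have hne : I.score v 0 ≠ I.score v c := fun h => by
      have := congrArg Fin.val (I.score_injective v h)
      simp [c] at this
    have hle : ∀ d, I.score v d ≤ Finset.univ.sup fun v => Finset.univ.sup fun c => I.score v c :=
      fun d => (Finset.le_sup (f := fun c => I.score v c) (Finset.mem_univ d)).trans
        (Finset.le_sup (f := fun v => Finset.univ.sup fun c => I.score v c) (Finset.mem_univ v))
    have := hle 0
    have := hle c
    omega
  unfold perturbation
  rw [div_lt_one (by positivity)]
  have : (0 : ℚ) < ((Finset.univ.sup fun v => Finset.univ.sup fun c => I.score v c : ℕ) : ℚ) := by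
    exact_mod_cast h
  linarith

theorem finalScore_nil (H : Finset (I.Voter × I.Voter)) (v : I.Voter) (c : I.Candidate) :
    I.finalScore [] H v c = (1 - I.perturbation) * I.score v c := by
  simp [finalScore]

theorem mem_supporters {L : I.Plan} {H : Finset (I.Voter × I.Voter)} {c : I.Candidate}
    {v : I.Voter} :
    v ∈ I.supporters L H c ↔ ∀ d, d ≠ c → I.finalScore L H v d < I.finalScore L H v c := by
  simp [supporters]

theorem mem_supporters_nil {H : Finset (I.Voter × I.Voter)} {c : I.Candidate} {v : I.Voter} :
    v ∈ I.supporters [] H c ↔ ∀ d, d ≠ c → I.score v d < I.score v c := by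
  have h : 0 < 1 - I.perturbation := sub_pos.2 I.perturbation_lt_one
  simp only [mem_supporters, finalScore_nil, mul_lt_mul_iff_right₀ h, Nat.cast_lt]

theorem mem_opposed {v : I.Voter} : v ∈ I.opposed ↔ ∃ d, I.score v 0 < I.score v d := by
  simp [opposed]

/-- Injective scores exclude ties, so a voter that is not opposed ranks `c_0` strictly first. -/
theorem supporters_nil_zero (H : Finset (I.Voter × I.Voter)) :
    I.supporters [] H 0 = Finset.univ \ I.opposed := by
  ext v
  simp only [mem_supporters_nil, Finset.mem_sdiff, Finset.mem_univ, true_and, mem_opposed,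
    not_exists, not_lt]
  refine ⟨fun h d => ?_, fun h d hd => ?_⟩
  · rcases eq_or_ne d 0 with rfl | hd
    · exact le_rfl
    · exact (h d hd).le
  · exact lt_of_le_of_ne (h d) fun e => hd (I.score_injective v e)

theorem supporters_nil_subset (H : Finset (I.Voter × I.Voter)) {c : I.Candidate} (hc : c ≠ 0) :
    I.supporters [] H c ⊆ I.opposed := fun _ hv =>
  mem_opposed.2 ⟨c, mem_supporters_nil.1 hv 0 hc.symm⟩

theorem score_le_delta (v : I.Voter) {c : I.Candidate} (hc : c ≠ 0) :
    (I.score v c : ℤ) - I.score v 0 ≤ I.delta :=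
  Finset.le_sup' (fun x : I.Voter × I.Candidate => (I.score x.1 x.2 : ℤ) - (I.score x.1 0 : ℤ))
    (b := (v, c)) (by simp [hc])

theorem finalScore_deltaPlan_of_ne (S : List I.Voter) (H : Finset (I.Voter × I.Voter))
    (v : I.Voter) {c : I.Candidate} (hc : c ≠ 0) :
    I.finalScore (I.deltaPlan S) H v c = (1 - I.perturbation) * I.score v c := by
  simp [finalScore, deltaPlan, Function.comp_def, hc]

/-- `j` counts the seeds whose message arrives. Only its sign matters later: one message already
suffices. -/
theorem finalScore_deltaPlan_zero (S : List I.Voter) (H : Finset (I.Voter × I.Voter))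
    (v : I.Voter) : ∃ j : ℕ, (0 < j ↔ ∃ s ∈ S, Influenced H s v) ∧
    I.finalScore (I.deltaPlan S) H v 0 = (1 - I.perturbation) * I.score v 0 + j * I.delta := by
  classical
  simp only [finalScore, add_right_inj]
  induction S with
  | nil => exact ⟨0, by simp, by simp [deltaPlan]⟩
  | cons s S ih =>
    obtain ⟨j, hj, he⟩ := ih
    have he' : ((I.deltaPlan (s :: S)).map fun sm =>
        if Influenced H sm.1 v then ((sm.2 0 : ℤ) : ℚ) else 0).sum =
        (if Influenced H s v then (I.delta : ℚ) else 0) + j * I.delta := by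
      rw [← he]; simp [deltaPlan]
    by_cases h : Influenced H s v
    · refine ⟨j + 1, ?_, ?_⟩
      · simp [h]
      · rw [he', if_pos h]; push_cast; ring
    · refine ⟨j, ?_, ?_⟩
      · simp [h, hj]
      · rw [he', if_neg h, zero_add]

/-- One message closes every deficit: `(1 - ε)(π_v(d) - π_v(0)) ≤ (1 - ε) δ < δ`. The positive `ε`
makes the win strict even where the deficit is exactly `δ`. -/
theorem supporters_deltaPlan_zero (hδ : 0 < I.delta) (S : List I.Voter)
    (H : Finset (I.Voter × I.Voter)) :
    I.supporters (I.deltaPlan S) H 0 = (Finset.univ \ I.opposed) ∪ I.covered H S.toFinset := by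
  ext v
  obtain ⟨j, hj, he⟩ := finalScore_deltaPlan_zero S H v
  have hε := sub_pos.2 I.perturbation_lt_one
  have hε' := I.perturbation_pos
  have hδ' : (0 : ℚ) < I.delta := by exact_mod_cast hδ
  rw [← supporters_nil_zero H, Finset.mem_union, mem_supporters, mem_supporters_nil, he]
  simp only [covered, Finset.mem_filter, List.mem_toFinset, ← hj]
  constructor
  · intro h
    by_cases hv : v ∈ I.opposed
    · refine Or.inr ⟨hv, ?_⟩
      obtain ⟨d, hd⟩ := mem_opposed.1 hv
      have hd0 : d ≠ 0 := by rintro rfl; exact lt_irrefl _ hd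
      have h1 := h d hd0
      rw [finalScore_deltaPlan_of_ne S H v hd0] at h1
      have h2 : (1 - I.perturbation) * (I.score v 0 : ℚ) < (1 - I.perturbation) * I.score v d := by
        have : (I.score v 0 : ℚ) < I.score v d := by exact_mod_cast hd
        gcongr
      -- Without any message the opponent `d` would stay ahead.
      by_contra hj0
      rw [Nat.eq_zero_of_not_pos hj0] at h1
      simp at h1
      linarith
    · left
      have : v ∈ I.supporters [] H 0 := by
        rw [supporters_nil_zero]; simp [hv]
      exact mem_supporters_nil.1 this
  · intro h d hd
    rw [finalScore_deltaPlan_of_ne S H v hd]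
    rcases h with h | ⟨-, h⟩
    · have h1 : (I.score v d : ℚ) < I.score v 0 := by exact_mod_cast h d hd
      have h2 : (0 : ℚ) ≤ j * I.delta := by positivity
      nlinarith
    · have h1 : (I.score v d : ℚ) - I.score v 0 ≤ I.delta := by
        exact_mod_cast score_le_delta v hd
      have h2 : (1 : ℚ) ≤ j := by exact_mod_cast h
      have h3 : (1 - I.perturbation) * ((I.score v d : ℚ) - I.score v 0) ≤
          (1 - I.perturbation) * I.delta := by gcongr
      nlinarith

theorem card_supporters_deltaPlan (hδ : 0 < I.delta) (S : List I.Voter)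
    (H : Finset (I.Voter × I.Voter)) :
    (I.supporters (I.deltaPlan S) H 0).card =
      (Finset.univ \ I.opposed).card + (I.covered H S.toFinset).card := by
  rw [supporters_deltaPlan_zero hδ, Finset.card_union_of_disjoint]
  exact Finset.disjoint_left.2 fun v hv hv' =>
    (Finset.mem_sdiff.1 hv).2 (mem_covered.1 hv').1

theorem expVotes_deltaPlan (hδ : 0 < I.delta) (S : List I.Voter) :
    I.expVotes (I.deltaPlan S) = (Finset.univ \ I.opposed).card + I.expCover S.toFinset := by
  simp only [expVotes, card_supporters_deltaPlan hδ, Nat.cast_add, expect_add, expect_const]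
  rfl

/-- The scores of the opponents are unchanged and that of `c_0` does not drop, so no opponent wins a
new voter. -/
theorem supporters_deltaPlan_subset (hδ : 0 < I.delta) (S : List I.Voter)
    (H : Finset (I.Voter × I.Voter)) {c : I.Candidate} (hc : c ≠ 0) :
    I.supporters (I.deltaPlan S) H c ⊆ I.supporters [] H c := by
  intro v hv
  rw [mem_supporters] at hv ⊢
  intro d hd
  have h := hv d hd
  rw [finalScore_deltaPlan_of_ne S H v hc] at h
  rw [finalScore_nil, finalScore_nil]
  rcases eq_or_ne d 0 with rfl | hd0
  · obtain ⟨j, -, he⟩ := finalScore_deltaPlan_zero S H v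
    have hδ' : (0 : ℚ) < I.delta := by exact_mod_cast hδ
    have h2 : (0 : ℚ) ≤ j * I.delta := by positivity
    rw [he] at h
    linarith
  · rwa [finalScore_deltaPlan_of_ne S H v hd0] at h

/-- In every live graph `c_0` gains exactly the covered voters, and the maximum over the opponents
does not grow. -/
theorem expCover_le_expGain (hδ : 0 < I.delta) (S : List I.Voter) :
    I.expCover S.toFinset ≤ I.expGain (I.deltaPlan S) := by
  refine expect_mono fun H => ?_
  have h1 := card_supporters_deltaPlan hδ S H
  have h2 : ((Finset.univ.erase (0 : I.Candidate)).sup fun c =>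
      (I.supporters (I.deltaPlan S) H c).card) ≤
      (Finset.univ.erase (0 : I.Candidate)).sup fun c => (I.supporters [] H c).card :=
    Finset.sup_mono_fun fun c hc =>
      Finset.card_le_card (supporters_deltaPlan_subset hδ S H (Finset.ne_of_mem_erase hc))
  have h3 : ((I.covered H S.toFinset).card : ℤ) ≤ I.MoV (I.deltaPlan S) H - I.MoV [] H := by
    rw [MoV, MoV, h1, supporters_nil_zero]
    push_cast
    have h4 := (Nat.cast_le (α := ℤ)).2 h2
    linarith
  exact_mod_cast h3

/-- The seeds that send at least one article. -/
def activeSeeds (L : I.Plan) : Finset I.Voter :=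
  ((L.filter fun sm => decide (sm.2 ≠ 0)).map Prod.fst).toFinset

/-- A nonzero integer message costs at least one article. Seeds with the zero message are free and
unlimited, hence the restriction to active ones. -/
theorem card_activeSeeds_le (L : I.Plan) : (activeSeeds L).card ≤ planSize L := by
  refine (List.toFinset_card_le _).trans ?_
  rw [List.length_map]
  induction L with
  | nil => simp
  | cons a L ih =>
    have h : planSize (a :: L) = messageSize a.2 + planSize L := by simp [planSize]
    rw [h]
    by_cases ha : a.2 = 0
    · simp only [ha, ne_eq, not_true_eq_false, decide_false, Bool.false_eq_true,
        not_false_eq_true, List.filter_cons_of_neg]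
      simp only [ne_eq] at ih
      omega
    · have hpos : 0 < messageSize a.2 := by
        obtain ⟨c, hc⟩ := Function.ne_iff.1 ha
        exact Finset.sum_pos' (fun _ _ => Nat.zero_le _)
          ⟨c, Finset.mem_univ c, Int.natAbs_pos.2 hc⟩
      rw [List.filter_cons_of_pos (by simpa using ha), List.length_cons]
      omega

theorem finalScore_of_not_influenced {L : I.Plan} {H : Finset (I.Voter × I.Voter)} {v : I.Voter}
    (h : ¬ ∃ s ∈ activeSeeds L, Influenced H s v) (c : I.Candidate) :
    I.finalScore L H v c = I.finalScore [] H v c := by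
  classical
  rw [finalScore_nil, finalScore, add_eq_left]
  refine List.sum_eq_zero fun x hx => ?_
  obtain ⟨sm, hsm, rfl⟩ := List.mem_map.1 hx
  split_ifs with hi
  · by_cases h0 : sm.2 = 0
    · simp [h0]
    · exact absurd ⟨sm.1, by
        simp only [activeSeeds, List.mem_toFinset, List.mem_map, List.mem_filter]
        exact ⟨sm, ⟨hsm, by simpa using h0⟩, rfl⟩, hi⟩ h
  · rfl

/-- Only the covered opposed voters `R` can help: `c_0` wins at most `|R|` votes and the best
opponent loses at most `|R|`. Other reached voters supported `c_0` already and can only be lost. -/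
theorem expGain_le (L : I.Plan) : I.expGain L ≤ 2 * I.expCover (activeSeeds L) := by
  rw [expCover, ← expect_mul_left]
  refine expect_mono fun H => ?_
  set R := I.covered H (activeSeeds L) with hR
  have hmem : ∀ v ∈ I.opposed, v ∉ R → ¬ ∃ s ∈ activeSeeds L, Influenced H s v := by
    intro v hv hvR hex
    exact hvR (mem_covered.2 ⟨hv, hex⟩)
  have h0 : (I.supporters L H 0).card ≤ (I.supporters [] H 0).card + R.card := by
    refine (Finset.card_le_card ?_).trans (Finset.card_union_le _ _)
    intro v hv
    rw [Finset.mem_union, supporters_nil_zero]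
    by_cases hvo : v ∈ I.opposed
    · by_cases hvR : v ∈ R
      · exact Or.inr hvR
      · have := finalScore_of_not_influenced (hmem v hvo hvR)
        rw [mem_supporters] at hv
        simp only [this] at hv
        left
        rw [← supporters_nil_zero H]
        exact mem_supporters.2 hv
    · simp [hvo]
  -- Initial supporters of an opponent are opposed, so those outside `R` receive nothing and keep
  -- their vote.
  have h1 : ((Finset.univ.erase (0 : I.Candidate)).sup fun c => (I.supporters [] H c).card) ≤
      ((Finset.univ.erase (0 : I.Candidate)).sup fun c => (I.supporters L H c).card) + R.card := by
    refine Finset.sup_le fun c hc => ?_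
    refine le_trans ?_ (Nat.add_le_add_right
      (Finset.le_sup (f := fun c => (I.supporters L H c).card) hc) _)
    refine (Finset.card_le_card ?_).trans (Finset.card_union_le _ _)
    intro v hv
    rw [Finset.mem_union]
    by_cases hvR : v ∈ R
    · exact Or.inr hvR
    · left
      have := finalScore_of_not_influenced
        (hmem v (supporters_nil_subset H (Finset.ne_of_mem_erase hc) hv) hvR)
      rw [mem_supporters] at hv ⊢
      simpa only [this] using hv
  have h2 : I.MoV L H - I.MoV [] H ≤ 2 * (R.card : ℤ) := by
    rw [MoV, MoV]
    omega
  exact_mod_cast h2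

/-! ### Feasibility and the approximation ratio -/

theorem seeds_deltaPlan (S : List I.Voter) : seeds (I.deltaPlan S) = S := by
  simp [seeds, deltaPlan, Function.comp_def]

theorem planSize_deltaPlan (S : List I.Voter) :
    planSize (I.deltaPlan S) = S.length * I.delta.toNat ∨ I.delta < 0 := by
  rcases lt_or_ge I.delta 0 with h | h
  · exact Or.inr h
  left
  have hm : messageSize (I := I) (Pi.single 0 I.delta) = I.delta.toNat := by
    rw [messageSize, Finset.sum_eq_single 0]
    · simp only [Pi.single_eq_same]; omega
    · intro c _ hc; simp [hc]
    · simp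
  simp [planSize, deltaPlan, Function.comp_def, hm]

theorem feasible_deltaPlan (hδ : 0 < I.delta) {S : List I.Voter} (hS : S.Nodup)
    (hlen : S.length * I.delta.toNat ≤ I.B) : I.Feasible (I.deltaPlan S) := by
  refine ⟨by rwa [seeds_deltaPlan], ?_⟩
  rcases planSize_deltaPlan S with h | h
  · rwa [h]
  · omega

/-- The number of seeds of the greedy algorithm. -/
def seedCount (I : ECSInstance) : ℕ := min (I.B / I.delta.toNat) I.n

/-- The largest useful number of seeds of a feasible plan. -/
def maxSeeds (I : ECSInstance) : ℕ := min I.B I.n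

theorem seedCount_pos (hδ : 0 < I.delta) (hB : I.delta ≤ I.B) : 0 < I.seedCount := by
  have : 0 < I.B / I.delta.toNat := Nat.div_pos (by omega) (by omega)
  have := I.n_pos
  unfold seedCount; omega

theorem seedCount_le_maxSeeds (I : ECSInstance) : I.seedCount ≤ I.maxSeeds :=
  min_le_min_right _ (Nat.div_le_self _ _)

theorem seedCount_mul_le (I : ECSInstance) : I.seedCount * I.delta.toNat ≤ I.B :=
  (Nat.mul_le_mul_right _ (min_le_left _ _)).trans (Nat.div_mul_le_self _ _)

/-- The 2 compensates the loss in `expGain_le`. What remains is `(B - δ + 1)/(δB) ≤ K/D`. -/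
theorem ratio_le (hδ : 0 < I.delta) (hB : I.delta ≤ I.B) :
    2 * I.ratio ≤ (I.seedCount : ℝ) / I.maxSeeds * (1 - 1 / Real.exp 1) := by
  obtain ⟨d, hd⟩ : ∃ d : ℕ, I.delta = d := ⟨I.delta.toNat, by omega⟩
  have hd0 : 0 < d := by omega
  have hdB : d ≤ I.B := by omega
  have hdR : (1 : ℝ) ≤ d := by exact_mod_cast hd0
  have hBR : (d : ℝ) ≤ I.B := by exact_mod_cast hdB
  have hn : 0 < I.n := I.n_pos
  have hM : 0 < I.maxSeeds := by unfold maxSeeds; omega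
  have hMR : (0 : ℝ) < I.maxSeeds := by exact_mod_cast hM
  have he : 0 ≤ 1 - 1 / Real.exp 1 := by
    rw [sub_nonneg, div_le_one (Real.exp_pos 1)]
    exact Real.one_le_exp zero_le_one
  have key : ((I.B : ℝ) - d + 1) / (d * I.B) ≤ I.seedCount / I.maxSeeds := by
    have hB0 : (0 : ℝ) < I.B := by linarith
    rw [div_le_div_iff₀ (by positivity) hMR]
    have hMB : (I.maxSeeds : ℝ) ≤ I.B := by exact_mod_cast min_le_left _ _
    have hK : I.seedCount = min (I.B / d) I.n := by simp [seedCount, hd]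
    rcases le_total (I.B / d) I.n with h | h
    -- Here `K = ⌊B/δ⌋`, so `δK ≥ B - δ + 1`, and `D ≤ B`.
    · have h1 : I.B < d * (I.B / d) + d := Nat.lt_mul_div_succ I.B hd0
      have h2 : (I.B : ℝ) + 1 ≤ d * (I.B / d : ℕ) + d := by exact_mod_cast h1
      rw [hK, min_eq_left h]
      calc ((I.B : ℝ) - d + 1) * I.maxSeeds ≤ (d * (I.B / d : ℕ)) * I.B := by
            gcongr
            linarith
        _ = _ := by ring
    -- Here `K = D = n`, and `B - δ + 1 ≤ δB` is `(δ - 1)(B + 1) ≥ 0`.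
    · have h1 : I.maxSeeds = I.n := min_eq_right (h.trans (Nat.div_le_self _ _))
      rw [hK, min_eq_right h, h1]
      have hn' : (0 : ℝ) < I.n := by exact_mod_cast hn
      have : (I.B : ℝ) - d + 1 ≤ d * I.B := by nlinarith
      nlinarith
  have : 2 * I.ratio = ((I.B : ℝ) - d + 1) / (d * I.B) * (1 - 1 / Real.exp 1) := by
    rw [ratio, hd]
    push_cast
    field_simp
  rw [this]
  gcongr

theorem ratio_nonneg (hδ : 0 < I.delta) (hB : I.delta ≤ I.B) : 0 ≤ I.ratio := by
  have hBR : (I.delta : ℝ) ≤ I.B := by exact_mod_cast hB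
  have hdR : (0 : ℝ) < I.delta := by exact_mod_cast hδ
  have he : 0 ≤ 1 - 1 / Real.exp 1 := by
    rw [sub_nonneg, div_le_one (Real.exp_pos 1)]
    exact Real.one_le_exp zero_le_one
  refine mul_nonneg (div_nonneg (by linarith) (by positivity)) he

/-- A coverage bound against all seed sets of size at most `maxSeeds` gives an approximation. -/
theorem isApprox_deltaPlan (hδ : 0 < I.delta) (hB : I.delta ≤ I.B) {S : List I.Voter}
    (hS : S.Nodup) (hlen : S.length ≤ I.seedCount)
    (h : ∀ T : Finset I.Voter, T.card ≤ I.maxSeeds →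
      2 * I.ratio * I.expCover T ≤ I.expCover S.toFinset) :
    I.IsApprox I.ratio (I.deltaPlan S) := by
  refine ⟨feasible_deltaPlan hδ hS
    ((Nat.mul_le_mul_right _ hlen).trans I.seedCount_mul_le), fun L hL => ?_⟩
  have hT : (activeSeeds L).card ≤ I.maxSeeds :=
    le_min ((card_activeSeeds_le L).trans hL.2) (by simpa using Finset.card_le_univ (activeSeeds L))
  calc I.ratio * I.expGain L ≤ I.ratio * (2 * I.expCover (activeSeeds L)) :=
        mul_le_mul_of_nonneg_left (expGain_le L) (ratio_nonneg hδ hB)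
    _ = 2 * I.ratio * I.expCover (activeSeeds L) := by ring
    _ ≤ _ := h _ hT
    _ ≤ _ := expCover_le_expGain hδ S

theorem GreedySeeds.nodup {S : List I.Voter} (h : I.GreedySeeds S) : S.Nodup := by
  induction h with
  | nil => exact List.nodup_nil
  | snoc S s _ hs _ ih =>
    rw [← List.concat_eq_append]
    exact ih.concat hs

theorem toFinset_append_singleton (S : List I.Voter) (s : I.Voter) :
    (S ++ [s]).toFinset = insert s S.toFinset := by
  ext x; simp

/-- The expected votes and `expCover` differ by a constant, so greedy maximizes coverage, and each
step multiplies the gap by at most `1 - 1/D`. -/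
theorem GreedySeeds.gap (hδ : 0 < I.delta) {S : List I.Voter} (h : I.GreedySeeds S)
    {T : Finset I.Voter} {D : ℕ} (hD : 0 < D) (hT : T.card ≤ D) :
    (1 - (1 - 1 / (D : ℝ)) ^ S.length) * I.expCover T ≤ I.expCover S.toFinset := by
  have hc := I.isCoverage_expCover
  suffices hs : I.expCover T - I.expCover S.toFinset ≤
      (1 - 1 / (D : ℝ)) ^ S.length * I.expCover T by linarith
  induction h with
  | nil => simp [hc.empty]
  | snoc S s hS hs hmax ih =>
    have hle : I.expCover S.toFinset ≤ I.expCover (S ++ [s]).toFinset :=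
      hc.mono (by simp)
    have hq : (0 : ℝ) ≤ 1 - 1 / D := by
      have : (1 : ℝ) ≤ D := by exact_mod_cast hD
      rw [sub_nonneg, div_le_one (by linarith)]; exact this
    refine (hc.gap_step hD hT hle fun t => ?_).trans ?_
    -- Greedy compares only new seeds; an old one adds no coverage.
    · by_cases ht : t ∈ S
      · rwa [Finset.insert_eq_of_mem (List.mem_toFinset.2 ht)]
      · have := hmax t ht
        rw [expVotes_deltaPlan hδ, expVotes_deltaPlan hδ] at this
        rw [← toFinset_append_singleton]
        linarith
    · rw [List.length_append, List.length_singleton, pow_succ']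
      rw [mul_assoc]
      gcongr

/-- The greedy algorithm with exact expectations is a `ratio`-approximation. -/
theorem GreedySeeds.isApprox (hδ : 0 < I.delta) (hB : I.delta ≤ I.B) {S : List I.Voter}
    (h : I.GreedySeeds S) (hlen : S.length = I.seedCount) :
    I.IsApprox I.ratio (I.deltaPlan S) := by
  have hK := seedCount_pos hδ hB
  have hKD := I.seedCount_le_maxSeeds
  refine isApprox_deltaPlan hδ hB h.nodup hlen.le fun T hT => ?_
  refine le_trans ?_ (h.gap hδ (hK.trans_le hKD) hT)
  refine mul_le_mul_of_nonneg_right ?_ (I.isCoverage_expCover.nonneg T)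
  rw [hlen]
  have h1 := greedy_ratio_ge hK hKD
  have h2 := ratio_le hδ hB
  have h3 : (0 : ℝ) ≤ 1 / (9 * (I.maxSeeds : ℝ) ^ 2) := by positivity
  linarith

end ECSInstance

/-! ### Functions computable in polynomial time -/

/-- Types whose elements are encoded as values. -/
class Enc (α : Type) where
  enc : α → Val

open Enc (enc)

instance : Enc ℕ := ⟨Val.num⟩
instance : Enc Bool := ⟨fun b => Val.num b.toNat⟩
instance {α β : Type} [Enc α] [Enc β] : Enc (α × β) := ⟨fun x => Val.pair (enc x.1) (enc x.2)⟩
instance {α : Type} [Enc α] : Enc (List α) := ⟨fun l => Val.ofList (l.map enc)⟩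

/-- The size of the encoding. -/
def sz {α : Type} [Enc α] (a : α) : ℕ := (enc a).size

section PolyTimeFunctions

variable {α β γ : Type} [Enc α] [Enc β] [Enc γ]

theorem sz_nat (k : ℕ) : sz k = 1 + k.size := rfl

theorem sz_pair (a : α) (b : β) : sz (a, b) = 1 + sz a + sz b := rfl

theorem sz_nil : sz ([] : List α) = 1 := rfl

theorem sz_cons (a : α) (l : List α) : sz (a :: l) = 1 + sz a + sz l := rfl

theorem sz_bool_le (b : Bool) : sz b ≤ 2 := by cases b <;> decide

/-- The `+ 1` is the terminal leaf, which the concatenation has only once. -/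
theorem sz_append (l l' : List α) : sz (l ++ l') + 1 = sz l + sz l' := by
  induction l with
  | nil => simp [sz_nil, add_comm]
  | cons a l ih => simp only [List.cons_append, sz_cons]; omega

theorem sz_le_of_mem {a : α} {l : List α} (h : a ∈ l) : sz a ≤ sz l := by
  induction l with
  | nil => simp at h
  | cons b l ih =>
    rw [sz_cons]
    rcases List.mem_cons.1 h with rfl | h
    · omega
    · have := ih h; omega

theorem sz_le_of_sublist {l l' : List α} (h : l.Sublist l') : sz l ≤ sz l' := by
  induction h with
  | slnil => exact le_rfl
  | cons a _ ih => rw [sz_cons]; omega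
  | cons_cons a _ ih => rw [sz_cons, sz_cons]; omega

theorem length_lt_sz (l : List α) : l.length < sz l := by
  induction l with
  | nil => simp [sz_nil]
  | cons a l ih => rw [sz_cons, List.length_cons]; omega

theorem sz_le_of_length_of_mem {l : List α} {w : ℕ} (h : ∀ a ∈ l, sz a ≤ w) :
    sz l ≤ 1 + l.length * (1 + w) := by
  induction l with
  | nil => simp [sz_nil]
  | cons a l ih =>
    have h1 := ih fun x hx => h x (List.mem_cons_of_mem _ hx)
    have h2 := h a List.mem_cons_self
    rw [sz_cons, List.length_cons]
    nlinarith

theorem sz_nat_mono {a b : ℕ} (h : a ≤ b) : sz a ≤ sz b :=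
  Nat.add_le_add_left (Nat.size_le_size h) 1

theorem sz_nat_le_succ (a : ℕ) : sz a ≤ 1 + a := by
  rw [sz_nat]
  exact Nat.add_le_add_left (Nat.size_le.2 Nat.lt_two_pow_self) 1

theorem size_add_le (a b : ℕ) : (a + b).size ≤ a.size + b.size + 1 := by
  rw [Nat.size_le]
  have ha : a < 2 ^ a.size := Nat.lt_size_self a
  have hb : b < 2 ^ b.size := Nat.lt_size_self b
  have h1 : 2 ^ a.size ≤ 2 ^ (a.size + b.size) := Nat.pow_le_pow_right (by norm_num) (by omega)
  have h2 : 2 ^ b.size ≤ 2 ^ (a.size + b.size) := Nat.pow_le_pow_right (by norm_num) (by omega)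
  rw [pow_succ]
  omega

theorem sz_add_le (a b : ℕ) : sz (a + b) ≤ sz a + sz b := by
  have := size_add_le a b
  simp only [sz_nat]; omega

theorem sz_mul_le (a b : ℕ) : sz (a * b) ≤ sz a + sz b := by
  have : (a * b).size ≤ a.size + b.size := by
    rw [Nat.size_le, pow_add]
    exact Nat.mul_lt_mul'' (Nat.lt_size_self a) (Nat.lt_size_self b)
  simp only [sz_nat]; omega

theorem natPoly_mono (p : Polynomial ℕ) : Monotone fun n => p.eval n := by
  intro a b h
  simp only [Polynomial.eval_eq_sum_range]
  exact Finset.sum_le_sum fun i _ => Nat.mul_le_mul_left _ (Nat.pow_le_pow_left h i)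

/-- `f` is computed in polynomial time by programs that read their argument from the variable `b`,
write the result there, and do not change the variables below `b`. -/
def PolyTime (f : α → β) : Prop :=
  ∃ (P : ℕ → Prog) (p : Polynomial ℕ), ∀ a : α, sz (f a) ≤ p.eval (sz a) ∧
    ∀ (b : ℕ) (σ : Store), σ b = enc a →
      ((P b).run σ).1 b = enc (f a) ∧ (∀ x < b, ((P b).run σ).1 x = σ x) ∧
      ((P b).run σ).2 ≤ p.eval (sz a)

namespace PolyTime

theorem exists_sz_le {f : α → β} (hf : PolyTime f) :
    ∃ p : Polynomial ℕ, ∀ a, sz (f a) ≤ p.eval (sz a) :=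
  let ⟨_, p, h⟩ := hf
  ⟨p, fun a => (h a).1⟩

theorem of_expr {f : α → β} (e : ℕ → PExpr) (p : Polynomial ℕ)
    (h : ∀ b σ a, σ b = enc a → (e b).eval σ = enc (f a) ∧ (e b).cost σ ≤ p.eval (sz a))
    (hs : ∀ a, sz (f a) ≤ p.eval (sz a)) : PolyTime f := by
  refine ⟨fun b => .assign b (e b), p + 1, fun a => ⟨?_, fun b σ hσ => ⟨?_, fun x hx => ?_, ?_⟩⟩⟩
  · simpa using (hs a).trans (Nat.le_succ _)
  · simpa [Prog.run] using (h b σ a hσ).1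
  · simp [Prog.run, hx.ne]
  · have := (h b σ a hσ).2
    simp [Prog.run]; omega

theorem id : PolyTime (fun a : α => a) :=
  of_expr (fun b => .var b) (Polynomial.X + 1)
    (fun b σ a h => ⟨h, by simp [PExpr.cost]⟩) fun a => by simp

/-- A pair `(a, l)` and the list `a :: l` have the same encoding. -/
theorem cons_pair : PolyTime (fun x : α × List α => x.1 :: x.2) :=
  of_expr (fun b => .var b) (Polynomial.X + 1)
    (fun b σ a h => ⟨h, by simp [PExpr.cost]⟩) fun a => by
      have h : sz (a.1 :: a.2) = sz a := rfl
      simp [h]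

theorem fst : PolyTime (fun x : α × β => x.1) :=
  of_expr (fun b => .fst (.var b)) (Polynomial.X + 2)
    (fun b σ a h => ⟨by simp [PExpr.eval, h]; rfl, by simp [PExpr.cost]⟩) fun a => by
      have := sz_pair a.1 a.2
      simp only [Prod.mk.eta] at this
      simp; omega

theorem snd : PolyTime (fun x : α × β => x.2) :=
  of_expr (fun b => .snd (.var b)) (Polynomial.X + 2)
    (fun b σ a h => ⟨by simp [PExpr.eval, h]; rfl, by simp [PExpr.cost]⟩) fun a => by
      have := sz_pair a.1 a.2
      simp only [Prod.mk.eta] at this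
      simp; omega

/-- The size bound inside `PolyTime` is essential here. Running time alone does not bound the size
of a result, since pairing a variable with itself doubles its size in constantly many steps. -/
theorem comp {g : β → γ} {f : α → β} (hg : PolyTime g) (hf : PolyTime f) :
    PolyTime (fun a => g (f a)) := by
  obtain ⟨P, p, hP⟩ := hf
  obtain ⟨Q, q, hQ⟩ := hg
  refine ⟨fun b => .seq (P b) (Q b), p + q.comp p, fun a => ⟨?_, fun b σ hσ => ?_⟩⟩
  · have h1 := (hQ (f a)).1
    have h2 := natPoly_mono q (hP a).1
    simp only [Polynomial.eval_add, Polynomial.eval_comp] at h2 ⊢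
    omega
  · obtain ⟨h1, h2, h3⟩ := (hP a).2 b σ hσ
    obtain ⟨h4, h5, h6⟩ := (hQ (f a)).2 b _ h1
    have h7 := natPoly_mono q (hP a).1
    refine ⟨h4, fun x hx => (h5 x hx).trans (h2 x hx), ?_⟩
    simp only [Prog.run, Polynomial.eval_add, Polynomial.eval_comp] at h7 ⊢
    omega

theorem pair {f : α → β} {g : α → γ} (hf : PolyTime f) (hg : PolyTime g) :
    PolyTime (fun a => (f a, g a)) := by
  obtain ⟨P, p, hP⟩ := hf
  obtain ⟨Q, q, hQ⟩ := hg
  -- `f` works from `b + 1` and `g` from `b + 2`. Neither changes lower variables, so the argument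
  -- in `b` and the result of `f` survive.
  refine ⟨fun b => .seq (.assign (b + 1) (.var b)) (.seq (P (b + 1))
    (.seq (.assign (b + 2) (.var b)) (.seq (Q (b + 2))
      (.assign b (.pair (.var (b + 1)) (.var (b + 2))))))), p + q + 8,
    fun a => ⟨?_, fun b σ hσ => ?_⟩⟩
  · have h1 := (hP a).1
    have h2 := (hQ a).1
    simp only [sz_pair, Polynomial.eval_add, Polynomial.eval_ofNat]
    omega
  · obtain ⟨h1, h2, h3⟩ := (hP a).2 (b + 1) (Function.update σ (b + 1) (σ b)) (by simp [hσ])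
    set σ₁ := ((P (b + 1)).run (Function.update σ (b + 1) (σ b))).1 with hσ₁
    have hb : σ₁ b = enc a := by rw [h2 b (by omega)]; simp [hσ]
    obtain ⟨h4, h5, h6⟩ := (hQ a).2 (b + 2) (Function.update σ₁ (b + 2) (σ₁ b)) (by simp [hb])
    refine ⟨?_, fun x hx => ?_, ?_⟩
    · simp only [Prog.run, PExpr.eval, ← hσ₁, Function.update_self]
      rw [h4, h5 (b + 1) (by omega), Function.update_of_ne (by omega), h1]
      rfl
    · simp only [Prog.run, PExpr.eval, ← hσ₁]
      rw [Function.update_of_ne (by omega), h5 x (by omega), Function.update_of_ne (by omega),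
        h2 x (by omega), Function.update_of_ne (by omega)]
    · simp only [Prog.run, PExpr.eval, PExpr.cost, ← hσ₁, Polynomial.eval_add,
        Polynomial.eval_ofNat]
      omega

end PolyTime

/-- The expression for a fixed value. -/
def PExpr.ofVal : Val → PExpr
  | .num k => .const k
  | .pair a b => .pair (ofVal a) (ofVal b)

theorem PExpr.ofVal_eval (v : Val) (σ : Store) : (PExpr.ofVal v).eval σ = v := by
  induction v with
  | num k => rfl
  | pair a b ha hb => simp [ofVal, eval, ha, hb]

theorem PExpr.ofVal_cost (v : Val) (σ : Store) : (PExpr.ofVal v).cost σ = v.size := by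
  induction v with
  | num k => rfl
  | pair a b ha hb => simp [ofVal, cost, ha, hb, Val.size]

namespace PolyTime

theorem const (c : β) : PolyTime (fun _ : α => c) :=
  of_expr (fun _ => .ofVal (enc c)) (Polynomial.C (sz c))
    (fun b σ a _ => ⟨PExpr.ofVal_eval _ σ, by rw [PExpr.ofVal_cost]; simp [sz]⟩)
    fun a => by simp

theorem ite {c : α → Bool} {f g : α → β} (hc : PolyTime c) (hf : PolyTime f) (hg : PolyTime g) :
    PolyTime (fun a => if c a = true then f a else g a) := by
  obtain ⟨R, r, hR⟩ := hc
  obtain ⟨P, p, hP⟩ := hf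
  obtain ⟨Q, q, hQ⟩ := hg
  refine ⟨fun b => .seq (.assign (b + 1) (.var b)) (.seq (R (b + 1))
    (.ite (.var (b + 1)) (P b) (Q b))), p + q + r + 4, fun a => ⟨?_, fun b σ hσ => ?_⟩⟩
  · have h1 := (hP a).1
    have h2 := (hQ a).1
    simp only [Polynomial.eval_add, Polynomial.eval_ofNat]
    split_ifs <;> omega
  · obtain ⟨h1, h2, h3⟩ := (hR a).2 (b + 1) (Function.update σ (b + 1) (σ b)) (by simp [hσ])
    set σ₁ := ((R (b + 1)).run (Function.update σ (b + 1) (σ b))).1 with hσ₁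
    have hb : σ₁ b = enc a := by rw [h2 b (by omega)]; simp [hσ]
    have hlow : ∀ x < b, σ₁ x = σ x := fun x hx => by
      rw [h2 x (by omega), Function.update_of_ne (by omega)]
    have hcond : ((σ₁ (b + 1)).toNum ≠ 0) ↔ c a = true := by
      rw [h1]; cases c a <;> simp [enc, Val.toNum]
    obtain ⟨p1, p2, p3⟩ := (hP a).2 b σ₁ hb
    obtain ⟨q1, q2, q3⟩ := (hQ a).2 b σ₁ hb
    simp only [Prog.run, PExpr.eval, PExpr.cost, ← hσ₁, hcond, Polynomial.eval_add,
      Polynomial.eval_ofNat]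
    split_ifs with h
    · exact ⟨p1, fun x hx => (p2 x hx).trans (hlow x hx), by omega⟩
    · exact ⟨q1, fun x hx => (q2 x hx).trans (hlow x hx), by omega⟩

theorem arith {o : ArithOp} {f : ℕ → ℕ → β} {g h : α → ℕ}
    (ho : ∀ a b, enc (f a b) = Val.num (o.apply a b)) (hsz : ∀ a b, sz (f a b) ≤ sz a + sz b + 2)
    (hg : PolyTime g) (hh : PolyTime h) : PolyTime (fun a => f (g a) (h a)) := by
  suffices h1 : PolyTime (fun x : ℕ × ℕ => f x.1 x.2) from h1.comp (hg.pair hh)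
  refine of_expr (fun b => .arith o (.fst (.var b)) (.snd (.var b))) (Polynomial.X + 7)
    (fun b σ a hσ => ⟨?_, ?_⟩) fun a => ?_
  · rw [ho]
    simp only [PExpr.eval, hσ]
    rfl
  · have := sz_pair a.1 a.2
    simp only [Prod.mk.eta, sz_nat] at this
    simp only [PExpr.cost, PExpr.eval, hσ, Polynomial.eval_add, Polynomial.eval_X,
      Polynomial.eval_ofNat, this]
    simp only [enc, Val.fst, Val.snd, Val.toNum]
    omega
  · have := sz_pair a.1 a.2
    have := hsz a.1 a.2
    simp only [Prod.mk.eta, Polynomial.eval_add, Polynomial.eval_X, Polynomial.eval_ofNat] at *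
    omega

theorem add {g h : α → ℕ} (hg : PolyTime g) (hh : PolyTime h) : PolyTime (fun a => g a + h a) :=
  arith (o := .add) (f := fun a b => a + b) (fun _ _ => rfl)
    (fun a b => (sz_add_le a b).trans (by omega)) hg hh

theorem mul {g h : α → ℕ} (hg : PolyTime g) (hh : PolyTime h) : PolyTime (fun a => g a * h a) :=
  arith (o := .mul) (f := fun a b => a * b) (fun _ _ => rfl)
    (fun a b => (sz_mul_le a b).trans (by omega)) hg hh

theorem sub {g h : α → ℕ} (hg : PolyTime g) (hh : PolyTime h) : PolyTime (fun a => g a - h a) :=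
  arith (o := .sub) (f := fun a b => a - b) (fun _ _ => rfl)
    (fun a b => (sz_nat_mono (Nat.sub_le a b)).trans (by omega)) hg hh

theorem lt {g h : α → ℕ} (hg : PolyTime g) (hh : PolyTime h) :
    PolyTime (fun a => decide (g a < h a)) :=
  arith (o := .lt) (f := fun a b => decide (a < b))
    (fun a b => by by_cases hab : a < b <;> simp [enc, ArithOp.apply, hab])
    (fun a b => (sz_bool_le _).trans (by omega)) hg hh

theorem eq {g h : α → ℕ} (hg : PolyTime g) (hh : PolyTime h) :
    PolyTime (fun a => decide (g a = h a)) :=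
  arith (o := .eq) (f := fun a b => decide (a = b))
    (fun a b => by by_cases hab : a = b <;> simp [enc, ArithOp.apply, hab])
    (fun a b => (sz_bool_le _).trans (by omega)) hg hh

theorem and {g h : α → Bool} (hg : PolyTime g) (hh : PolyTime h) :
    PolyTime (fun a => g a && h a) := by
  have : (fun a => g a && h a) = fun a => if g a = true then h a else false := by
    funext a; cases g a <;> simp
  rw [this]
  exact hg.ite hh (const false)

theorem or {g h : α → Bool} (hg : PolyTime g) (hh : PolyTime h) :
    PolyTime (fun a => g a || h a) := by
  have : (fun a => g a || h a) = fun a => if g a = true then true else h a := by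
    funext a; cases g a <;> simp
  rw [this]
  exact hg.ite (const true) hh

theorem cons {f : α → β} {l : α → List β} (hf : PolyTime f) (hl : PolyTime l) :
    PolyTime (fun a => f a :: l a) :=
  cons_pair.comp (hf.pair hl)

end PolyTime

/-- The body of the loop that computes a fold. -/
def foldBody (S : ℕ → Prog) (b : ℕ) : Prog :=
  .seq (.assign (b + 3) (.pair (.var b) (.pair (.var (b + 1)) (.var (b + 2)))))
    (.seq (S (b + 3)) (.assign (b + 1) (.var (b + 3))))

/-- Variable `b` holds the parameter, `b + 1` the state, `b + 2` the entry, and `b + 3` onwards is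
work space. `Q` bounds all entries and intermediate states; each round has overhead 8 for the body
and 1 for the loop. -/
theorem loop_foldBody {s : α → γ → β → γ} {S : ℕ → Prog} {p : Polynomial ℕ}
    (hS : ∀ x : α × γ × β, sz (s x.1 x.2.1 x.2.2) ≤ p.eval (sz x) ∧
      ∀ (b : ℕ) (σ : Store), σ b = enc x →
        ((S b).run σ).1 b = enc (s x.1 x.2.1 x.2.2) ∧ (∀ y < b, ((S b).run σ).1 y = σ y) ∧
        ((S b).run σ).2 ≤ p.eval (sz x))
    (a : α) (b Q : ℕ) (l : List β) (c : γ) (σ : Store) (hσ : σ b = enc a)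
    (hc : σ (b + 1) = enc c) (hl : ∀ d ∈ l, sz d ≤ Q)
    (hpre : ∀ l₁, l₁ <+: l → sz (l₁.foldl (s a) c) ≤ Q) :
    let r := Prog.loop (foldBody S b).run (b + 2) (enc l) σ
    r.1 (b + 1) = enc (l.foldl (s a) c) ∧ (∀ x ≤ b, r.1 x = σ x) ∧
      r.2 ≤ 1 + l.length * (9 + p.eval (2 + sz a + 2 * Q)) := by
  induction l generalizing c σ with
  | nil => exact ⟨hc, fun _ _ => rfl, by simp [enc, Prog.loop, Val.ofList]⟩
  | cons d l ih =>
    set σ₀ := Function.update σ (b + 2) (enc d) with hσ₀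
    set σ₁ := Function.update σ₀ (b + 3) (enc (a, c, d)) with hσ₁
    obtain ⟨h1, h2, h3⟩ := (hS (a, c, d)).2 (b + 3) σ₁ (by simp [hσ₁])
    set σ₂ := ((S (b + 3)).run σ₁).1 with hσ₂
    set σ₃ := Function.update σ₂ (b + 1) (enc (s a c d)) with hσ₃
    have e0 : σ₀ b = enc a := by rw [hσ₀, Function.update_of_ne (by omega), hσ]
    have e1 : σ₀ (b + 1) = enc c := by rw [hσ₀, Function.update_of_ne (by omega), hc]
    have e2 : σ₀ (b + 2) = enc d := by rw [hσ₀, Function.update_self]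
    have hin : Val.pair (enc a) (Val.pair (enc c) (enc d)) = enc (a, c, d) := rfl
    have hrun : (foldBody S b).run σ₀ = (σ₃, 8 + ((S (b + 3)).run σ₁).2) := by
      simp only [foldBody, Prog.run, PExpr.eval, PExpr.cost, e0, e1, e2, hin, ← hσ₁, ← hσ₂, h1,
        ← hσ₃]
      congr 1
      omega
    have hlow : ∀ x ≤ b, σ₃ x = σ x := by
      intro x hx
      rw [hσ₃, Function.update_of_ne (by omega), h2 x (by omega), hσ₁,
        Function.update_of_ne (by omega), hσ₀, Function.update_of_ne (by omega)]
    have hloop : Prog.loop (foldBody S b).run (b + 2) (enc (d :: l)) σ =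
        ((Prog.loop (foldBody S b).run (b + 2) (enc l) σ₃).1,
          1 + (8 + ((S (b + 3)).run σ₁).2) +
            (Prog.loop (foldBody S b).run (b + 2) (enc l) σ₃).2) := by
      change Prog.loop (foldBody S b).run (b + 2) (Val.pair (enc d) (enc l)) σ = _
      simp only [Prog.loop, ← hσ₀, hrun]
    obtain ⟨i1, i2, i3⟩ := ih (s a c d) σ₃ ((hlow b le_rfl).trans hσ)
      (by rw [hσ₃, Function.update_self]) (fun x hx => hl x (List.mem_cons_of_mem _ hx))
      (fun l₁ h => by simpa using hpre (d :: l₁) ((List.prefix_cons_inj d).2 h))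
    rw [hloop]
    refine ⟨i1, fun x hx => (i2 x hx).trans (hlow x hx), ?_⟩
    have hcQ : sz c ≤ Q := by simpa using hpre [] (List.nil_prefix)
    have hdQ : sz d ≤ Q := hl d List.mem_cons_self
    have h4 : p.eval (sz (a, c, d)) ≤ p.eval (2 + sz a + 2 * Q) :=
      natPoly_mono p (by rw [sz_pair, sz_pair]; omega)
    simp only [List.length_cons]
    rw [Nat.succ_mul]
    omega

namespace PolyTime

/-- All intermediate states must be bounded, since iterating even a polynomial-time step can make
them grow exponentially. -/
theorem foldl_of_prefix {l : α → List β} {i : α → γ} {s : α → γ → β → γ} (hl : PolyTime l)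
    (hi : PolyTime i) (hs : PolyTime fun x : α × γ × β => s x.1 x.2.1 x.2.2)
    (hsz : ∃ w : Polynomial ℕ, ∀ a l₁, l₁ <+: l a → sz (l₁.foldl (s a) (i a)) ≤ w.eval (sz a)) :
    PolyTime (fun a => (l a).foldl (s a) (i a)) := by
  obtain ⟨L, pl, hL⟩ := hl
  obtain ⟨J, pi, hJ⟩ := hi
  obtain ⟨S, ps, hS⟩ := hs
  obtain ⟨w, hw⟩ := hsz
  refine ⟨fun b => .seq (.assign (b + 1) (.var b)) (.seq (J (b + 1))
    (.seq (.assign (b + 2) (.var b)) (.seq (L (b + 2))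
      (.seq (.forEach (b + 2) (.var (b + 2)) (foldBody S b)) (.assign b (.var (b + 1))))))),
    w + (pi + pl + 9 + pl * (9 + ps.comp (2 + Polynomial.X + 2 * (pl + w)))),
    fun a => ⟨?_, fun b σ hσ => ?_⟩⟩
  · rw [Polynomial.eval_add]
    exact (hw a (l a) (List.prefix_refl _)).trans (Nat.le_add_right _ _)
  · obtain ⟨h1, h2, h3⟩ := (hJ a).2 (b + 1) (Function.update σ (b + 1) (σ b)) (by simp [hσ])
    set σ₁ := ((J (b + 1)).run (Function.update σ (b + 1) (σ b))).1 with hσ₁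
    have hb : σ₁ b = enc a := by rw [h2 b (by omega)]; simp [hσ]
    obtain ⟨h4, h5, h6⟩ := (hL a).2 (b + 2) (Function.update σ₁ (b + 2) (σ₁ b)) (by simp [hb])
    set σ₂ := ((L (b + 2)).run (Function.update σ₁ (b + 2) (σ₁ b))).1 with hσ₂
    have hb2 : σ₂ b = enc a := by
      rw [h5 b (by omega), Function.update_of_ne (by omega), hb]
    have hc2 : σ₂ (b + 1) = enc (i a) := by
      rw [h5 (b + 1) (by omega), Function.update_of_ne (by omega), h1]
    have hlow : ∀ x < b, σ₂ x = σ x := fun x hx => by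
      rw [h5 x (by omega), Function.update_of_ne (by omega), h2 x (by omega),
        Function.update_of_ne (by omega)]
    have hlsz := (hL a).1
    obtain ⟨r1, r2, r3⟩ := loop_foldBody hS a b (pl.eval (sz a) + w.eval (sz a)) (l a) (i a) σ₂
      hb2 hc2 (fun d hd => (sz_le_of_mem hd).trans (by omega))
      (fun l₁ h => (hw a l₁ h).trans (by omega))
    refine ⟨?_, fun x hx => ?_, ?_⟩
    · simp only [Prog.run, PExpr.eval, ← hσ₁, ← hσ₂, h4, Function.update_self]
      exact r1
    · simp only [Prog.run, PExpr.eval, ← hσ₁, ← hσ₂, h4]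
      rw [Function.update_of_ne (by omega)]
      exact (r2 x hx.le).trans (hlow x hx)
    · simp only [Prog.run, PExpr.eval, PExpr.cost, ← hσ₁, ← hσ₂, h4, Polynomial.eval_add,
        Polynomial.eval_ofNat, Polynomial.eval_mul, Polynomial.eval_comp, Polynomial.eval_X]
      have h7 : (l a).length ≤ pl.eval (sz a) := (length_lt_sz (l a)).le.trans hlsz
      have h8 := Nat.mul_le_mul_right
        (9 + ps.eval (2 + sz a + 2 * (pl.eval (sz a) + w.eval (sz a)))) h7
      omega

/-- Folds whose state grows additively by a polynomial amount. -/
theorem foldl {l : α → List β} {i : α → γ} {s : α → γ → β → γ} (hl : PolyTime l)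
    (hi : PolyTime i) (hs : PolyTime fun x : α × γ × β => s x.1 x.2.1 x.2.2)
    (hsz : ∃ w : Polynomial ℕ, ∀ a c, ∀ d ∈ l a, sz (s a c d) ≤ sz c + w.eval (sz a)) :
    PolyTime (fun a => (l a).foldl (s a) (i a)) := by
  obtain ⟨w, hw⟩ := hsz
  obtain ⟨pl, hpl⟩ := hl.exists_sz_le
  obtain ⟨pi, hpi⟩ := hi.exists_sz_le
  refine foldl_of_prefix hl hi hs ⟨pi + pl * w, fun a l₁ h => ?_⟩
  have key : ∀ (l₂ : List β) c, (∀ d ∈ l₂, d ∈ l a) →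
      sz (l₂.foldl (s a) c) ≤ sz c + l₂.length * w.eval (sz a) := by
    intro l₂
    induction l₂ with
    | nil => intro c _; simp
    | cons d l₂ ih =>
      intro c hd
      have h1 := ih (s a c d) fun x hx => hd x (List.mem_cons_of_mem _ hx)
      have h2 := hw a c d (hd d List.mem_cons_self)
      rw [List.foldl_cons, List.length_cons, Nat.succ_mul]
      omega
  have h1 := key l₁ (i a) fun d hd => h.subset hd
  have h2 : l₁.length ≤ pl.eval (sz a) :=
    h.length_le.trans ((length_lt_sz _).le.trans (hpl a))
  have h3 := Nat.mul_le_mul_right (w.eval (sz a)) h2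
  have h4 := hpi a
  rw [Polynomial.eval_add, Polynomial.eval_mul]
  omega

end PolyTime

end PolyTimeFunctions

/-! ### List operations, written as folds -/

section PolyTimeLists

variable {α β γ : Type} [Enc α] [Enc β] [Enc γ]

namespace PolyTime

theorem reverse {l : α → List β} (hl : PolyTime l) : PolyTime (fun a => (l a).reverse) := by
  have h : (fun a => (l a).reverse) = fun a => (l a).foldl (fun c d => d :: c) [] := by
    funext a; simp [List.foldl_flip_cons_eq_append]
  rw [h]
  obtain ⟨pl, hpl⟩ := hl.exists_sz_le
  refine foldl (s := fun _ c d => d :: c) hl (const []) ((snd.comp snd).cons (fst.comp snd))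
    ⟨1 + pl, fun a c d hd => ?_⟩
  have := (sz_le_of_mem hd).trans (hpl a)
  simp only [sz_cons, Polynomial.eval_add, Polynomial.eval_one]
  omega

theorem exists_sz_le_of_mem {l : α → List β} {f : α → β → γ} (hl : PolyTime l)
    (hf : PolyTime fun x : α × β => f x.1 x.2) :
    ∃ w : Polynomial ℕ, ∀ a, ∀ d ∈ l a, sz (f a d) ≤ w.eval (sz a) := by
  obtain ⟨pl, hpl⟩ := hl.exists_sz_le
  obtain ⟨pf, hpf⟩ := hf.exists_sz_le
  refine ⟨pf.comp (1 + Polynomial.X + pl), fun a d hd => (hpf (a, d)).trans ?_⟩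
  simp only [Polynomial.eval_comp, Polynomial.eval_add, Polynomial.eval_one, Polynomial.eval_X]
  refine natPoly_mono pf ?_
  have := (sz_le_of_mem hd).trans (hpl a)
  rw [sz_pair]; omega

theorem map {l : α → List β} {f : α → β → γ} (hl : PolyTime l)
    (hf : PolyTime fun x : α × β => f x.1 x.2) : PolyTime (fun a => (l a).map (f a)) := by
  have h : (fun a => (l a).map (f a)) =
      fun a => ((l a).foldl (fun c d => f a d :: c) []).reverse := by
    funext a
    have : ∀ (l : List β) (c : List γ),
        l.foldl (fun c d => f a d :: c) c = (l.map (f a)).reverse ++ c := by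
      intro l
      induction l with
      | nil => simp
      | cons d l ih => intro c; simp [ih]
    simp [this]
  rw [h]
  obtain ⟨w, hw⟩ := exists_sz_le_of_mem hl hf
  refine reverse (foldl (s := fun a c d => f a d :: c) hl (const [])
    ((hf.comp (fst.pair (snd.comp snd))).cons (fst.comp snd)) ⟨1 + w, fun a c d hd => ?_⟩)
  have := hw a d hd
  simp only [sz_cons, Polynomial.eval_add, Polynomial.eval_one]
  omega

theorem filter {l : α → List β} {f : α → β → Bool} (hl : PolyTime l)
    (hf : PolyTime fun x : α × β => f x.1 x.2) : PolyTime (fun a => (l a).filter (f a)) := by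
  have h : (fun a => (l a).filter (f a)) =
      fun a => ((l a).foldl (fun c d => if f a d = true then d :: c else c) []).reverse := by
    funext a
    have : ∀ (l : List β) (c : List β),
        l.foldl (fun c d => if f a d = true then d :: c else c) c =
          (l.filter (f a)).reverse ++ c := by
      intro l
      induction l with
      | nil => simp
      | cons d l ih =>
        intro c
        rw [List.foldl_cons, ih]
        by_cases hd : f a d = true <;> simp [hd]
    simp [this]
  rw [h]
  obtain ⟨pl, hpl⟩ := hl.exists_sz_le
  refine reverse (foldl (s := fun a c d => if f a d = true then d :: c else c) hl (const [])
    ((hf.comp (fst.pair (snd.comp snd))).ite ((snd.comp snd).cons (fst.comp snd)) (fst.comp snd))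
    ⟨1 + pl, fun a c d hd => ?_⟩)
  have := (sz_le_of_mem hd).trans (hpl a)
  simp only [Polynomial.eval_add, Polynomial.eval_one]
  split_ifs
  · rw [sz_cons]; omega
  · omega

theorem append {l l' : α → List β} (hl : PolyTime l) (hl' : PolyTime l') :
    PolyTime (fun a => l a ++ l' a) := by
  have h : (fun a => l a ++ l' a) =
      fun a => (l a).reverse.foldl (fun c d => d :: c) (l' a) := by
    funext a; simp
  rw [h]
  obtain ⟨pl, hpl⟩ := hl.reverse.exists_sz_le
  refine foldl (s := fun _ c d => d :: c) hl.reverse hl' ((snd.comp snd).cons (fst.comp snd))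
    ⟨1 + pl, fun a c d hd => ?_⟩
  have := (sz_le_of_mem hd).trans (hpl a)
  simp only [sz_cons, Polynomial.eval_add, Polynomial.eval_one]
  omega

theorem flatMap {l : α → List β} {f : α → β → List γ} (hl : PolyTime l)
    (hf : PolyTime fun x : α × β => f x.1 x.2) : PolyTime (fun a => (l a).flatMap (f a)) := by
  have h : (fun a => (l a).flatMap (f a)) =
      fun a => (l a).foldl (fun c d => c ++ f a d) [] := by
    funext a
    have : ∀ (l : List β) (c : List γ),
        l.foldl (fun c d => c ++ f a d) c = c ++ l.flatMap (f a) := by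
      intro l
      induction l with
      | nil => simp
      | cons d l ih => intro c; simp [ih]
    simp [this]
  rw [h]
  obtain ⟨w, hw⟩ := exists_sz_le_of_mem hl hf
  refine foldl (s := fun a c d => c ++ f a d) hl (const [])
    ((fst.comp snd).append (hf.comp (fst.pair (snd.comp snd)))) ⟨w, fun a c d hd => ?_⟩
  have := hw a d hd
  have := sz_append c (f a d)
  omega

theorem sum {l : α → List ℕ} (hl : PolyTime l) : PolyTime (fun a => (l a).sum) := by
  have h : (fun a => (l a).sum) = fun a => (l a).foldl (fun c d => c + d) 0 := by
    funext a; rw [List.sum_eq_foldl]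
  rw [h]
  obtain ⟨pl, hpl⟩ := hl.exists_sz_le
  refine foldl (s := fun _ c d => c + d) hl (const 0) ((fst.comp snd).add (snd.comp snd))
    ⟨pl, fun a c d hd => ?_⟩
  have := (sz_le_of_mem hd).trans (hpl a)
  have := sz_add_le c d
  omega

theorem length {l : α → List β} (hl : PolyTime l) : PolyTime (fun a => (l a).length) := by
  have h : (fun a => (l a).length) = fun a => ((l a).map fun _ => 1).sum := by
    funext a; simp
  rw [h]
  exact (hl.map (f := fun _ _ => 1) (const 1)).sum

theorem any {l : α → List β} {f : α → β → Bool} (hl : PolyTime l)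
    (hf : PolyTime fun x : α × β => f x.1 x.2) : PolyTime (fun a => (l a).any (f a)) := by
  have h : (fun a => (l a).any (f a)) = fun a => (l a).foldl (fun c d => c || f a d) false := by
    funext a
    have : ∀ (l : List β) (c : Bool), l.foldl (fun c d => c || f a d) c = (c || l.any (f a)) := by
      intro l
      induction l with
      | nil => simp
      | cons d l ih => intro c; simp [ih, Bool.or_assoc]
    simp [this]
  rw [h]
  refine foldl (s := fun a c d => c || f a d) hl (const false)
    ((fst.comp snd).or (hf.comp (fst.pair (snd.comp snd)))) ⟨2, fun a c d _ => ?_⟩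
  have := sz_bool_le (c || f a d)
  simp only [Polynomial.eval_ofNat]
  omega

theorem contains {l : α → List ℕ} {f : α → ℕ} (hl : PolyTime l) (hf : PolyTime f) :
    PolyTime (fun a => (l a).contains (f a)) := by
  have h : (fun a => (l a).contains (f a)) = fun a => (l a).any fun d => decide (f a = d) := by
    funext a
    rw [List.contains_eq_any_beq]
    rfl
  rw [h]
  exact hl.any (f := fun a d => decide (f a = d)) ((hf.comp fst).eq snd)

/-- Indexing is a scan with a position counter. The start `j` is general for the induction; once the
counter has passed `i`, the stored value no longer changes. -/
theorem foldl_getD {ι : Type*} (l : List ι) (i j : ℕ) (r : ι) :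
    (l.foldl (fun (c : ℕ × ι) d => (c.1 + 1, if decide (c.1 = i) = true then d else c.2))
      (j, r)).2 = if j ≤ i then l.getD (i - j) r else r := by
  induction l generalizing j r with
  | nil => simp
  | cons d l ih =>
    rw [List.foldl_cons, ih]
    rcases lt_trichotomy j i with h | rfl | h
    · obtain ⟨k, hk⟩ : ∃ k, i - j = k + 1 := ⟨i - j - 1, by omega⟩
      rw [if_pos (by omega), if_pos h.le, hk, List.getD_cons_succ]
      simp only [h.ne, decide_false, Bool.false_eq_true, if_false]
      congr 1
      omega
    · simp
    · have h1 : ¬ j + 1 ≤ i := by omega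
      have h2 : ¬ j ≤ i := by omega
      simp [h.ne', h1, h2]

theorem getD {l : α → List β} {i : α → ℕ} {d : α → β} (hl : PolyTime l) (hi : PolyTime i)
    (hd : PolyTime d) : PolyTime (fun a => (l a).getD (i a) (d a)) := by
  have h : (fun a => (l a).getD (i a) (d a)) = fun a => ((l a).foldl
      (fun (c : ℕ × β) d => (c.1 + 1, if decide (c.1 = i a) = true then d else c.2))
      (0, d a)).2 := by
    funext a
    rw [foldl_getD]
    simp
  rw [h]
  obtain ⟨pl, hpl⟩ := hl.exists_sz_le
  refine snd.comp (foldl (γ := ℕ × β)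
    (s := fun a c d => (c.1 + 1, if decide (c.1 = i a) = true then d else c.2))
    hl ((const 0).pair hd) (pair ((fst.comp (fst.comp snd)).add (const 1))
      (ite ((fst.comp (fst.comp snd)).eq (hi.comp fst)) (snd.comp snd)
        (snd.comp (fst.comp snd)))) ⟨pl + 2, fun a c d hd => ?_⟩)
  have h1 := (sz_le_of_mem hd).trans (hpl a)
  have h2 := sz_add_le c.1 1
  have h3 : sz (1 : ℕ) = 2 := by decide
  have h4 := sz_pair c.1 c.2
  rw [Prod.mk.eta] at h4
  simp only [sz_pair, Polynomial.eval_add, Polynomial.eval_ofNat]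
  split_ifs <;> omega

/-- Computability of `List.range (m a)` serves below as "`m` is available in unary", which is what
loop bounds need. -/
theorem range_length {l : α → List β} (hl : PolyTime l) :
    PolyTime (fun a => List.range (l a).length) := by
  have key : ∀ (l : List β) (j : ℕ), l.foldl (fun (c : ℕ × List ℕ) _ => (c.1 + 1, c.1 :: c.2))
      (j, (List.range j).reverse) = (j + l.length, (List.range (j + l.length)).reverse) := by
    intro l
    induction l with
    | nil => simp
    | cons d l ih =>
      intro j
      have : (j + 1, j :: (List.range j).reverse) = (j + 1, (List.range (j + 1)).reverse) := by
        simp [List.range_succ]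
      rw [List.foldl_cons, this, ih, List.length_cons, Nat.add_right_comm j 1, Nat.add_assoc]
  have key0 : ∀ l : List β, l.foldl (fun (c : ℕ × List ℕ) _ => (c.1 + 1, c.1 :: c.2))
      (0, []) = (l.length, (List.range l.length).reverse) := fun l => by
    simpa using key l 0
  have h : (fun a => List.range (l a).length) = fun a => ((l a).foldl
      (fun (c : ℕ × List ℕ) _ => (c.1 + 1, c.1 :: c.2)) (0, [])).2.reverse := by
    funext a
    rw [key0, List.reverse_reverse]
  rw [h]
  obtain ⟨pl, hpl⟩ := hl.exists_sz_le
  -- The amount added per round is the size of the counter, which the argument alone does not bound.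
  -- Hence the states are bounded directly.
  refine reverse (snd.comp (foldl_of_prefix (γ := ℕ × List ℕ)
    (s := fun _ c _ => (c.1 + 1, c.1 :: c.2)) hl (const (0, []))
    (pair ((fst.comp (fst.comp snd)).add (const 1))
      ((fst.comp (fst.comp snd)).cons (snd.comp (fst.comp snd))))
    ⟨3 + pl + pl * (2 + pl), fun a l₁ hl₁ => ?_⟩))
  rw [key0, sz_pair]
  have h1 : l₁.length ≤ pl.eval (sz a) := hl₁.length_le.trans ((length_lt_sz _).le.trans (hpl a))
  have h2 := sz_nat_le_succ l₁.length
  have h3 : sz (List.range l₁.length).reverse ≤ 1 + l₁.length * (1 + (1 + l₁.length)) := by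
    refine (sz_le_of_length_of_mem (w := 1 + l₁.length) fun x hx => ?_).trans (by simp)
    have : x < l₁.length := by simpa using hx
    have := sz_nat_le_succ x
    omega
  have h4 : l₁.length * (1 + (1 + l₁.length)) ≤ pl.eval (sz a) * (2 + pl.eval (sz a)) :=
    Nat.mul_le_mul h1 (by omega)
  simp only [Polynomial.eval_add, Polynomial.eval_mul, Polynomial.eval_ofNat]
  omega

/-- Multiplication of numbers in unary. -/
theorem range_mul {m k : α → ℕ} (hm : PolyTime fun a => List.range (m a))
    (hk : PolyTime fun a => List.range (k a)) : PolyTime (fun a => List.range (m a * k a)) := by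
  have h := range_length (hm.flatMap (f := fun a _ => List.range (k a)) (hk.comp fst))
  simpa using h

theorem range_add {m k : α → ℕ} (hm : PolyTime fun a => List.range (m a))
    (hk : PolyTime fun a => List.range (k a)) : PolyTime (fun a => List.range (m a + k a)) := by
  have h := range_length (hm.append hk)
  simpa using h

theorem range_pow {m : α → ℕ} (hm : PolyTime fun a => List.range (m a)) (j : ℕ) :
    PolyTime (fun a => List.range (m a ^ j)) := by
  induction j with
  | zero => simpa using const (α := α) (List.range 1)
  | succ j ih => simpa only [pow_succ] using ih.range_mul hm

end PolyTime

end PolyTimeLists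

/-! ### The greedy algorithm on sampled live graphs, on lists and numbers -/

namespace GreedySampling

/-- An edge `(u, v)` with numerator and denominator of its strength; the last entry is `0`. -/
abbrev Edge : Type := ℕ × ℕ × ℕ × ℕ × ℕ

/-- The scores, the edges, the budget (and `0`), and the confidence parameter in unary. -/
abbrev RawInput : Type := (List (List ℕ) × List Edge × ℕ × ℕ) × List ℕ

/-- The number with binary digits `bits[i * m], …, bits[i * m + m - 1]`. -/
def draw (bits : List ℕ) (m i : ℕ) : ℕ :=
  (List.range m).foldl (fun c b => 2 * c + bits.getD (i * m + b) 0) 0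

/-- The edge is in the `i`-th sampled live graph. -/
def isLive (bits : List ℕ) (m n i : ℕ) (e : Edge) : Bool :=
  decide (draw bits m ((i * n + e.1) * n + e.2.1) * e.2.2.2.1 < e.2.2.1 * 2 ^ m)

/-- `N` sampled live graphs. -/
def sampleGraphs (bits : List ℕ) (m n N : ℕ) (edges : List Edge) : List (List Edge) :=
  (List.range N).map fun i => edges.filter (isLive bits m n i)

/-- One round of the breadth first search from `R`. -/
def reachStep (vs : List ℕ) (H : List Edge) (R : List ℕ) : List ℕ :=
  vs.filter fun v => R.contains v || H.any fun e => R.contains e.1 && decide (e.2.1 = v)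

/-- The voters that are reachable from `S`. -/
def reach (vs : List ℕ) (H : List Edge) (S : List ℕ) : List ℕ :=
  vs.foldl (fun R _ => reachStep vs H R) S

/-- The total number of voters in `U` that are reached from `S` in the given graphs. -/
def value (vs U : List ℕ) (Gs : List (List Edge)) (S : List ℕ) : ℕ :=
  (Gs.map fun H => (U.filter fun v => (reach vs H S).contains v).length).sum

/-- A seed whose addition to `S` maximizes `f`. -/
def bestSeed (vs : List ℕ) (f : List ℕ → ℕ) (S : List ℕ) : ℕ :=
  vs.foldl (fun b s => if decide (f (S ++ [b]) < f (S ++ [s])) = true then s else b) 0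

/-- Adds the best seed if the budget allows it and `f` increases. -/
def greedyStep (vs : List ℕ) (f : List ℕ → ℕ) (δ B : ℕ) (S : List ℕ) : List ℕ :=
  if decide (B < (S.length + 1) * δ) = true then S
  else if decide (f S < f (S ++ [bestSeed vs f S])) = true then S ++ [bestSeed vs f S] else S

/-- The seeds that the greedy algorithm selects. -/
def greedySeeds (vs : List ℕ) (f : List ℕ → ℕ) (δ B : ℕ) : List ℕ :=
  vs.foldl (fun S _ => greedyStep vs f δ B S) []

def listMax (l : List ℕ) : ℕ := l.foldl (fun c d => if decide (c < d) = true then d else c) 0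

/-- The largest excess of a score over that of `c_0`. -/
def maxExcess (rows : List (List ℕ)) : ℕ :=
  listMax (rows.flatMap fun r => r.map fun s => s - r.getD 0 0)

/-- The voters that do not rank `c_0` first. -/
def opposedVoters (rows : List (List ℕ)) : List ℕ :=
  (List.range rows.length).filter fun v =>
    (rows.getD v []).any fun s => decide ((rows.getD v []).getD 0 0 < s)

/-- `δ` positive articles on `c_0`, for `c` candidates. -/
def message (δ c : ℕ) : List (ℕ × ℕ) :=
  (List.range c).map fun i => (if decide (i = 0) = true then δ else 0, 0)

/-- The number of random bits per edge and sample. -/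
def bitCount (n : ℕ) : ℕ := 11 * n

/-- The number of sampled live graphs. -/
def sampleCount (n k : ℕ) : ℕ := 5184 * n ^ 6 * (n + 1 + k)

/-- The number of covered voters, summed over the sampled live graphs. -/
def sampleValue (x : RawInput × List ℕ) (S : List ℕ) : ℕ :=
  value (List.range x.1.1.1.length) (opposedVoters x.1.1.1)
    (sampleGraphs x.2 (bitCount x.1.1.1.length) x.1.1.1.length
      (sampleCount x.1.1.1.length x.1.2.length) x.1.1.2.1) S

/-- The seeds selected on the input `x.1` with the random bits `x.2`. -/
def selectedSeeds (x : RawInput × List ℕ) : List ℕ :=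
  greedySeeds (List.range x.1.1.1.length) (sampleValue x) (maxExcess x.1.1.1) x.1.1.2.2.1

/-- The output of the algorithm. -/
def algorithm (x : RawInput × List ℕ) : List (ℕ × List (ℕ × ℕ)) :=
  (selectedSeeds x).map fun s => (s, message (maxExcess x.1.1.1) (x.1.1.1.getD 0 []).length)

end GreedySampling

/-! ### The algorithm runs in polynomial time -/

namespace PolyTime

open GreedySampling

variable {α : Type} [Enc α]

theorem of_range {m : α → ℕ} (hm : PolyTime fun a => List.range (m a)) : PolyTime m := by
  simpa using hm.length

/-- The exponent must be unary for the power to have polynomial length. -/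
theorem two_pow {m : α → ℕ} (hm : PolyTime fun a => List.range (m a)) :
    PolyTime (fun a => 2 ^ m a) := by
  have h : (fun a => 2 ^ m a) = fun a => (List.range (m a)).foldl (fun c _ => c * 2) 1 := by
    funext a
    induction m a with
    | zero => rfl
    | succ k ih => rw [List.range_succ, List.foldl_append, ← ih, pow_succ]; rfl
  rw [h]
  refine foldl (s := fun _ c _ => c * 2) hm (const 1) ((fst.comp snd).mul (const 2))
    ⟨3, fun a c d _ => ?_⟩
  have h1 := sz_mul_le c 2
  have h2 : sz (2 : ℕ) = 3 := by decide
  simp only [Polynomial.eval_ofNat]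
  omega

theorem draw {bits : α → List ℕ} {m i : α → ℕ} (hb : PolyTime bits)
    (hm : PolyTime fun a => List.range (m a)) (hi : PolyTime i) :
    PolyTime (fun a => draw (bits a) (m a) (i a)) := by
  have hget : PolyTime fun x : α × ℕ => (bits x.1).getD (i x.1 * m x.1 + x.2) 0 :=
    (hb.comp fst).getD (((hi.comp fst).mul (hm.of_range.comp fst)).add snd) (const 0)
  obtain ⟨w, hw⟩ := exists_sz_le_of_mem
    (f := fun a b => (bits a).getD (i a * m a + b) 0) hm hget
  refine foldl (s := fun a c b => 2 * c + (bits a).getD (i a * m a + b) 0) hm (const 0)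
    (((const 2).mul (fst.comp snd)).add (hget.comp (fst.pair (snd.comp snd))))
    ⟨3 + w, fun a c b hb => ?_⟩
  have h1 := sz_mul_le 2 c
  have h2 : sz (2 : ℕ) = 3 := by decide
  have h3 := sz_add_le (2 * c) ((bits a).getD (i a * m a + b) 0)
  have h4 := hw a b hb
  simp only [Polynomial.eval_add, Polynomial.eval_ofNat]
  omega

theorem isLive {bits : α → List ℕ} {m n i : α → ℕ} {e : α → Edge} (hb : PolyTime bits)
    (hm : PolyTime fun a => List.range (m a)) (hn : PolyTime n) (hi : PolyTime i)
    (he : PolyTime e) : PolyTime (fun a => isLive (bits a) (m a) (n a) (i a) (e a)) := by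
  have he1 := fst.comp he
  have he2 := fst.comp (snd.comp he)
  have he3 := fst.comp (snd.comp (snd.comp he))
  have he4 := fst.comp (snd.comp (snd.comp (snd.comp he)))
  exact ((hb.draw hm ((((hi.mul hn).add he1).mul hn).add he2)).mul he4).lt (he3.mul hm.two_pow)

theorem sampleGraphs {bits : α → List ℕ} {m n N : α → ℕ} {edges : α → List Edge}
    (hb : PolyTime bits) (hm : PolyTime fun a => List.range (m a)) (hn : PolyTime n)
    (hN : PolyTime fun a => List.range (N a)) (he : PolyTime edges) :
    PolyTime (fun a => sampleGraphs (bits a) (m a) (n a) (N a) (edges a)) := by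
  refine hN.map (f := fun a i => (edges a).filter (GreedySampling.isLive (bits a) (m a) (n a) i)) ?_
  refine filter (f := fun x : α × ℕ => GreedySampling.isLive (bits x.1) (m x.1) (n x.1) x.2)
    (he.comp fst) ?_
  exact isLive (hb.comp (fst.comp fst)) (hm.comp (fst.comp fst)) (hn.comp (fst.comp fst))
    (snd.comp fst) snd

theorem reachStep {vs R : α → List ℕ} {H : α → List Edge} (hv : PolyTime vs) (hH : PolyTime H)
    (hR : PolyTime R) : PolyTime (fun a => reachStep (vs a) (H a) (R a)) := by
  refine hv.filter (f := fun a v => (R a).contains v ||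
    (H a).any fun e => (R a).contains e.1 && decide (e.2.1 = v)) (or ?_ ?_)
  · exact (hR.comp fst).contains snd
  · refine any (f := fun (x : α × ℕ) e => (R x.1).contains e.1 && decide (e.2.1 = x.2))
      (hH.comp fst) (and ?_ ?_)
    · exact (hR.comp (fst.comp fst)).contains (fst.comp snd)
    · exact (fst.comp (snd.comp snd)).eq (snd.comp fst)

/-- After any round the state is a sublist of `vs`, so it cannot grow beyond it. -/
theorem reach {vs S : α → List ℕ} {H : α → List Edge} (hv : PolyTime vs) (hH : PolyTime H)
    (hS : PolyTime S) : PolyTime (fun a => reach (vs a) (H a) (S a)) := by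
  obtain ⟨p, hp⟩ := hv.exists_sz_le
  refine foldl (s := fun a R _ => GreedySampling.reachStep (vs a) (H a) R) hv hS
    (reachStep (hv.comp fst) (hH.comp fst) (fst.comp snd)) ⟨p, fun a R d _ => ?_⟩
  exact ((sz_le_of_sublist List.filter_sublist).trans (hp a)).trans (Nat.le_add_left _ _)

theorem value {vs U S : α → List ℕ} {Gs : α → List (List Edge)} (hv : PolyTime vs)
    (hU : PolyTime U) (hG : PolyTime Gs) (hS : PolyTime S) :
    PolyTime (fun a => value (vs a) (U a) (Gs a) (S a)) := by
  refine sum (hG.map (f := fun a H =>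
    ((U a).filter fun v => (GreedySampling.reach (vs a) H (S a)).contains v).length) (length ?_))
  refine filter (f := fun (x : α × List Edge) v =>
    (GreedySampling.reach (vs x.1) x.2 (S x.1)).contains v) (hU.comp fst) ?_
  exact (reach (hv.comp (fst.comp fst)) (snd.comp fst) (hS.comp (fst.comp fst))).contains snd

/-- The result is an entry of `vs` or the initial `0`. The bound is independent of `f` and `S`, so
the greedy state grows additively. -/
theorem sz_bestSeed_le (vs : List ℕ) (f : List ℕ → ℕ) (S : List ℕ) :
    sz (bestSeed vs f S) ≤ sz vs := by
  have key : ∀ (l : List ℕ) (b : ℕ), sz b ≤ sz vs → (∀ s ∈ l, sz s ≤ sz vs) →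
      sz (l.foldl (fun b s => if decide (f (S ++ [b]) < f (S ++ [s])) = true then s else b) b) ≤
        sz vs := by
    intro l
    induction l with
    | nil => intro b hb _; exact hb
    | cons s l ih =>
      intro b hb hl
      refine ih _ ?_ fun x hx => hl x (List.mem_cons_of_mem _ hx)
      dsimp only
      split_ifs
      exacts [hl s List.mem_cons_self, hb]
  refine key vs 0 ?_ fun s hs => sz_le_of_mem hs
  have := length_lt_sz vs
  have h0 : sz (0 : ℕ) = 1 := by decide
  omega

theorem bestSeed {vs S : α → List ℕ} {f : α → List ℕ → ℕ} (hv : PolyTime vs)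
    (hf : PolyTime fun x : α × List ℕ => f x.1 x.2) (hS : PolyTime S) :
    PolyTime (fun a => bestSeed (vs a) (f a) (S a)) := by
  obtain ⟨p, hp⟩ := hv.exists_sz_le
  refine foldl (s := fun a b s =>
    if decide (f a (S a ++ [b]) < f a (S a ++ [s])) = true then s else b) hv (const 0)
    (ite (lt ?_ ?_) (snd.comp snd) (fst.comp snd)) ⟨p, fun a b s hs => ?_⟩
  · exact hf.comp (fst.pair ((hS.comp fst).append ((fst.comp snd).cons (const []))))
  · exact hf.comp (fst.pair ((hS.comp fst).append ((snd.comp snd).cons (const []))))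
  · have := (sz_le_of_mem hs).trans (hp a)
    split_ifs <;> omega

theorem greedyStep {vs S : α → List ℕ} {f : α → List ℕ → ℕ} {d B : α → ℕ} (hv : PolyTime vs)
    (hf : PolyTime fun x : α × List ℕ => f x.1 x.2) (hd : PolyTime d) (hB : PolyTime B)
    (hS : PolyTime S) : PolyTime (fun a => greedyStep (vs a) (f a) (d a) (B a) (S a)) := by
  have hadd : PolyTime fun a => S a ++ [GreedySampling.bestSeed (vs a) (f a) (S a)] :=
    hS.append ((hv.bestSeed hf hS).cons (const []))
  exact ite (hB.lt ((hS.length.add (const 1)).mul hd)) hS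
    (ite ((hf.comp (id.pair hS)).lt (hf.comp (id.pair hadd))) hadd hS)

theorem greedySeeds {vs : α → List ℕ} {f : α → List ℕ → ℕ} {d B : α → ℕ} (hv : PolyTime vs)
    (hf : PolyTime fun x : α × List ℕ => f x.1 x.2) (hd : PolyTime d) (hB : PolyTime B) :
    PolyTime (fun a => greedySeeds (vs a) (f a) (d a) (B a)) := by
  obtain ⟨p, hp⟩ := hv.exists_sz_le
  refine foldl (s := fun a S _ => GreedySampling.greedyStep (vs a) (f a) (d a) (B a) S) hv
    (const []) (greedyStep (hv.comp fst) (hf.comp ((fst.comp fst).pair snd)) (hd.comp fst)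
      (hB.comp fst) (fst.comp snd)) ⟨1 + p, fun a S _ _ => ?_⟩
  have h1 := (sz_bestSeed_le (vs a) (f a) S).trans (hp a)
  have h2 := sz_append S [GreedySampling.bestSeed (vs a) (f a) S]
  rw [sz_cons, sz_nil] at h2
  simp only [GreedySampling.greedyStep, Polynomial.eval_add, Polynomial.eval_one]
  split_ifs <;> omega

theorem listMax {l : α → List ℕ} (hl : PolyTime l) : PolyTime (fun a => listMax (l a)) := by
  obtain ⟨p, hp⟩ := hl.exists_sz_le
  refine foldl (s := fun _ c d => if decide (c < d) = true then d else c) hl (const 0)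
    (ite ((fst.comp snd).lt (snd.comp snd)) (snd.comp snd) (fst.comp snd))
    ⟨p, fun a b s hs => ?_⟩
  have := (sz_le_of_mem hs).trans (hp a)
  split_ifs <;> omega

theorem maxExcess {rows : α → List (List ℕ)} (hr : PolyTime rows) :
    PolyTime (fun a => maxExcess (rows a)) := by
  refine listMax (hr.flatMap (f := fun _ r => r.map fun s => s - r.getD 0 0) ?_)
  refine map (f := fun (x : α × List ℕ) s => s - x.2.getD 0 0) snd ?_
  exact snd.sub ((snd.comp fst).getD (const 0) (const 0))

theorem opposedVoters {rows : α → List (List ℕ)} (hr : PolyTime rows) :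
    PolyTime (fun a => opposedVoters (rows a)) := by
  refine hr.range_length.filter (f := fun a v =>
    ((rows a).getD v []).any fun s => decide (((rows a).getD v []).getD 0 0 < s)) ?_
  have hrow : PolyTime fun x : α × ℕ => (rows x.1).getD x.2 [] :=
    (hr.comp fst).getD snd (const [])
  refine any (f := fun (x : α × ℕ) s => decide (((rows x.1).getD x.2 []).getD 0 0 < s)) hrow ?_
  exact ((hrow.comp fst).getD (const 0) (const 0)).lt snd

theorem message {d : α → ℕ} {l : α → List ℕ} (hd : PolyTime d) (hl : PolyTime l) :
    PolyTime (fun a => message (d a) (l a).length) :=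
  hl.range_length.map (f := fun a i => (if decide (i = 0) = true then d a else 0, 0))
    (pair (ite (snd.eq (const 0)) (hd.comp fst) (const 0)) (const 0))

/-- The numbers of bits and samples are polynomials in `n` and `k`, both of which the input gives in
unary as list lengths. Budget and scores, given in binary, never serve as loop bounds. -/
theorem sampleValue : PolyTime fun x : (RawInput × List ℕ) × List ℕ => sampleValue x.1 x.2 := by
  have hr : PolyTime fun x : (RawInput × List ℕ) × List ℕ => x.1.1.1.1 :=
    fst.comp (fst.comp (fst.comp fst))
  have hm : PolyTime fun x : (RawInput × List ℕ) × List ℕ =>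
      List.range (bitCount x.1.1.1.1.length) :=
    range_mul (const (List.range 11)) hr.range_length
  have hN : PolyTime fun x : (RawInput × List ℕ) × List ℕ =>
      List.range (sampleCount x.1.1.1.1.length x.1.1.2.length) :=
    range_mul (range_mul (const (List.range 5184)) (hr.range_length.range_pow 6))
      (range_add (range_add hr.range_length (const (List.range 1)))
        (snd.comp (fst.comp fst)).range_length)
  exact hr.range_length.value hr.opposedVoters
    (sampleGraphs (snd.comp fst) hm hr.length hN (fst.comp (snd.comp (fst.comp (fst.comp fst))))) snd

theorem algorithm : PolyTime algorithm := by
  have hr : PolyTime fun x : RawInput × List ℕ => x.1.1.1 := fst.comp (fst.comp fst)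
  refine map (f := fun (x : RawInput × List ℕ) s =>
    (s, GreedySampling.message (GreedySampling.maxExcess x.1.1.1) (x.1.1.1.getD 0 []).length)) ?_ ?_
  · exact hr.range_length.greedySeeds sampleValue hr.maxExcess
      (fst.comp (snd.comp (snd.comp (fst.comp fst))))
  · exact snd.pair ((hr.maxExcess.message (hr.getD (const 0) (const []))).comp fst)

end PolyTime

/-! ### Random subsets -/

section RandomSubset

variable {κ : Type*} [DecidableEq κ]

/-- The expectation of `g` at a random subset of `s` that contains each `e` with probability
`p e`. -/
noncomputable def subsetExpect (p : κ → ℝ) (s : Finset κ) (g : Finset κ → ℝ) : ℝ :=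
  ∑ H ∈ s.powerset, ((∏ e ∈ H, p e) * ∏ e ∈ s \ H, (1 - p e)) * g H

/-- Conditioning on whether `a` is chosen; all later facts on `subsetExpect` follow by induction
from this. -/
theorem subsetExpect_insert (p : κ → ℝ) {a : κ} {s : Finset κ} (ha : a ∉ s)
    (g : Finset κ → ℝ) : subsetExpect p (insert a s) g =
      (1 - p a) * subsetExpect p s g + p a * subsetExpect p s fun H => g (insert a H) := by
  rw [subsetExpect, Finset.sum_powerset_insert ha, subsetExpect, subsetExpect, Finset.mul_sum,
    Finset.mul_sum]
  congr 1
  · refine Finset.sum_congr rfl fun H hH => ?_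
    have haH : a ∉ H := fun h => ha (Finset.mem_powerset.1 hH h)
    rw [Finset.insert_sdiff_of_notMem _ haH, Finset.prod_insert (by simp [ha])]
    ring
  · refine Finset.sum_congr rfl fun H hH => ?_
    have haH : a ∉ H := fun h => ha (Finset.mem_powerset.1 hH h)
    have : insert a s \ insert a H = s \ H := by
      rw [Finset.insert_sdiff_insert, Finset.sdiff_insert_of_notMem ha]
    rw [this, Finset.prod_insert haH]
    ring

theorem subsetExpect_mem_Icc {p : κ → ℝ} (hp : ∀ e, p e ∈ Set.Icc (0 : ℝ) 1)
    {M : ℝ} (s : Finset κ) {g : Finset κ → ℝ} (hg : ∀ H, g H ∈ Set.Icc 0 M) :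
    subsetExpect p s g ∈ Set.Icc 0 M := by
  induction s using Finset.induction_on generalizing g with
  | empty => simpa [subsetExpect] using hg ∅
  | insert a s ha ih =>
    rw [subsetExpect_insert p ha]
    obtain ⟨h1, h2⟩ := ih hg
    obtain ⟨h3, h4⟩ := ih (g := fun H => g (insert a H)) fun H => hg _
    obtain ⟨h5, h6⟩ := hp a
    constructor <;> nlinarith

/-- The probabilities are exchanged one element at a time. Each exchange changes the expectation by
at most `M r`, since the two conditional expectations both lie in `[0, M]`. -/
theorem abs_subsetExpect_sub_le {p q : κ → ℝ}
    (hp : ∀ e, p e ∈ Set.Icc (0 : ℝ) 1) (hq : ∀ e, q e ∈ Set.Icc (0 : ℝ) 1) {M r : ℝ}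
    (hr : ∀ e, |p e - q e| ≤ r) (s : Finset κ) {g : Finset κ → ℝ} (hg : ∀ H, g H ∈ Set.Icc 0 M) :
    |subsetExpect p s g - subsetExpect q s g| ≤ s.card * (M * r) := by
  induction s using Finset.induction_on generalizing g with
  | empty => simp [subsetExpect]
  | insert a s ha ih =>
    rw [subsetExpect_insert p ha, subsetExpect_insert q ha, Finset.card_insert_of_notMem ha]
    have h1 := abs_le.1 (ih hg)
    have h2 := abs_le.1 (ih (g := fun H => g (insert a H)) fun H => hg _)
    obtain ⟨u1, u2⟩ := subsetExpect_mem_Icc hq s hg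
    obtain ⟨v1, v2⟩ := subsetExpect_mem_Icc hq s (g := fun H => g (insert a H)) fun H => hg _
    obtain ⟨h5, h6⟩ := hp a
    set x := subsetExpect p s g
    set y := subsetExpect q s g
    set x' := subsetExpect p s fun H => g (insert a H)
    set y' := subsetExpect q s fun H => g (insert a H)
    have h7 : |(p a - q a) * (y' - y)| ≤ M * r := by
      rw [abs_mul, mul_comm]
      refine mul_le_mul (abs_le.2 ⟨by linarith, by linarith⟩) (hr a) (abs_nonneg _) (by linarith)
    have h8 := abs_le.1 h7
    have h9 : (1 - p a) * x + p a * x' - ((1 - q a) * y + q a * y') =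
        (1 - p a) * (x - y) + p a * (x' - y') + (p a - q a) * (y' - y) := by ring
    rw [h9, abs_le]
    push_cast
    constructor <;> nlinarith

end RandomSubset

/-! ### Averages over finite types -/

section Average

/-- The average of a function on a finite type. -/
noncomputable def avg {Ω : Type*} [Fintype Ω] (f : Ω → ℝ) : ℝ := (∑ ω, f ω) / Fintype.card Ω

variable {Ω Ω' κ : Type*} [Fintype Ω] [Fintype Ω'] [Fintype κ]

theorem avg_mono {f g : Ω → ℝ} (h : ∀ ω, f ω ≤ g ω) : avg f ≤ avg g := by
  unfold avg
  gcongr with ω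
  exact h ω

theorem avg_nonneg {f : Ω → ℝ} (h : ∀ ω, 0 ≤ f ω) : 0 ≤ avg f :=
  div_nonneg (Finset.sum_nonneg fun ω _ => h ω) (Nat.cast_nonneg _)

theorem avg_add (f g : Ω → ℝ) : avg (fun ω => f ω + g ω) = avg f + avg g := by
  simp [avg, Finset.sum_add_distrib, add_div]

theorem avg_sub (f g : Ω → ℝ) : avg (fun ω => f ω - g ω) = avg f - avg g := by
  simp [avg, Finset.sum_sub_distrib, sub_div]

theorem avg_mul_left (c : ℝ) (f : Ω → ℝ) : avg (fun ω => c * f ω) = c * avg f := by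
  simp [avg, ← Finset.mul_sum, mul_div_assoc]

theorem avg_sum {ι : Type*} (s : Finset ι) (f : ι → Ω → ℝ) :
    avg (fun ω => ∑ i ∈ s, f i ω) = ∑ i ∈ s, avg (f i) := by
  simp only [avg]
  rw [Finset.sum_comm, Finset.sum_div]

theorem avg_const [Nonempty Ω] (c : ℝ) : avg (fun _ : Ω => c) = c := by
  have : (Fintype.card Ω : ℝ) ≠ 0 := by exact_mod_cast Fintype.card_ne_zero
  simp [avg, this]

theorem avg_equiv (e : Ω ≃ Ω') (f : Ω' → ℝ) : avg (fun ω => f (e ω)) = avg f := by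
  simp only [avg, Fintype.card_congr e]
  rw [Equiv.sum_comp e]

theorem avg_prod_fst [Nonempty Ω'] (f : Ω → ℝ) : avg (fun x : Ω × Ω' => f x.1) = avg f := by
  have : (Fintype.card Ω' : ℝ) ≠ 0 := by exact_mod_cast Fintype.card_ne_zero
  simp only [avg, Fintype.sum_prod_type, Finset.sum_const, Finset.card_univ, nsmul_eq_mul,
    Fintype.card_prod, Nat.cast_mul]
  rw [← Finset.mul_sum]
  field_simp

/-- Independence of the coordinates under the uniform distribution on functions. -/
theorem avg_prod [DecidableEq κ] (f : κ → Ω → ℝ) :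
    avg (fun y : κ → Ω => ∏ i, f i (y i)) = ∏ i, avg (f i) := by
  simp only [avg, Finset.prod_div_distrib, Finset.prod_univ_sum, Fintype.piFinset_univ,
    Fintype.card_pi, Nat.cast_prod]

/-- The coordinates outside the range of `ι` average out, so `ω ∘ ι` is again uniform. -/
theorem avg_comp_injective [DecidableEq κ] {κ' : Type*} [Fintype κ'] [DecidableEq κ']
    [Nonempty Ω] {ι : κ' → κ} (hι : Function.Injective ι) (f : (κ' → Ω) → ℝ) :
    avg (fun ω : κ → Ω => f (ω ∘ ι)) = avg f := by
  classical
  let e₁ := Equiv.piEquivPiSubtypeProd (fun x => x ∈ Set.range ι) fun _ : κ => Ω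
  let e₂ : ({x // x ∈ Set.range ι} → Ω) ≃ (κ' → Ω) :=
    Equiv.arrowCongr (Equiv.ofInjective ι hι).symm (Equiv.refl Ω)
  have h : (fun ω : κ → Ω => f (ω ∘ ι)) = fun ω => f (e₂ (e₁ ω).1) := by
    funext ω
    congr 1
  rw [h, avg_equiv e₁ (fun x => f (e₂ x.1)), avg_prod_fst (fun x => f (e₂ x)), avg_equiv e₂ f]

/-- Independent tests, one per element, select a random subset with independent memberships. -/
theorem avg_filter [DecidableEq κ] (s : Finset κ) (P : κ → Ω → Bool) [Nonempty Ω]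
    (g : Finset κ → ℝ) :
    avg (fun y : κ → Ω => g (s.filter fun e => P e (y e) = true)) =
      subsetExpect (fun e => avg fun ω => if P e ω = true then 1 else 0) s g := by
  -- The product over `e` is the indicator that the selected subset equals `H`; as a product over
  -- coordinates it can be averaged factor by factor.
  have h1 : ∀ y : κ → Ω, g (s.filter fun e => P e (y e) = true) =
      ∑ H ∈ s.powerset, (∏ e, (if e ∈ H then (if P e (y e) = true then (1 : ℝ) else 0) else 1) *
        (if e ∈ s \ H then 1 - (if P e (y e) = true then (1 : ℝ) else 0) else 1)) * g H := by
    intro y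
    rw [Finset.sum_eq_single (s.filter fun e => P e (y e) = true)]
    · rw [Finset.prod_eq_one, one_mul]
      intro e _
      by_cases he : e ∈ s <;> by_cases hP : P e (y e) = true <;> simp [he, hP]
    · intro H hH hne
      rw [mul_eq_zero]
      left
      obtain ⟨e, he⟩ : ∃ e, ¬ (e ∈ H ↔ e ∈ s.filter fun e => P e (y e) = true) := by
        by_contra! hcon
        exact hne (Finset.ext hcon)
      refine Finset.prod_eq_zero (Finset.mem_univ e) ?_
      have hHs := Finset.mem_powerset.1 hH
      by_cases heH : e ∈ H
      · have hes := hHs heH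
        have hP : ¬ P e (y e) = true := fun hP => he (by simp [heH, hes, hP])
        simp [heH, hP]
      · have h2 : e ∈ s ∧ P e (y e) = true := by
          by_contra hcon
          exact he (by simpa [heH] using hcon)
        simp [heH, h2.1, h2.2]
    · intro h
      exact absurd (Finset.mem_powerset.2 (Finset.filter_subset _ _)) h
  simp only [h1, avg_sum, subsetExpect]
  refine Finset.sum_congr rfl fun H _ => ?_
  have h2 : ∀ c : ℝ, ∀ F : (κ → Ω) → ℝ, avg (fun y => F y * c) = avg F * c := fun c F => by
    simp only [mul_comm _ c, avg_mul_left]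
  rw [h2]
  congr 1
  rw [avg_prod (fun e ω => (if e ∈ H then (if P e ω = true then (1 : ℝ) else 0) else 1) *
        (if e ∈ s \ H then 1 - (if P e ω = true then (1 : ℝ) else 0) else 1))]
  rw [← Finset.prod_ite_mem_eq H, ← Finset.prod_ite_mem_eq (s \ H), ← Finset.prod_mul_distrib]
  refine Finset.prod_congr rfl fun e _ => ?_
  by_cases heH : e ∈ H
  · simp [heH]
  · by_cases hes : e ∈ s
    · simp [heH, hes, avg_sub, avg_const]
    · simp [heH, hes, avg_const]

/-! ### Concentration -/

/-- `e^x ≤ 1 + x + x²` for `|x| ≤ 1`; the linear term has mean zero, and `1 + t² ≤ e^(t²)`. -/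
theorem avg_exp_le [Nonempty Ω] {f : Ω → ℝ} (hf : ∀ ω, f ω ∈ Set.Icc (0 : ℝ) 1) {t : ℝ}
    (ht : |t| ≤ 1) : avg (fun ω => Real.exp (t * (f ω - avg f))) ≤ Real.exp (t ^ 2) := by
  have hm0 : 0 ≤ avg f := avg_nonneg fun ω => (hf ω).1
  have hm1 : avg f ≤ 1 := (avg_mono fun ω => (hf ω).2).trans (avg_const (Ω := Ω) 1).le
  have h1 : ∀ ω, Real.exp (t * (f ω - avg f)) ≤ (1 + t ^ 2) + t * (f ω - avg f) := by
    intro ω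
    have hd : |f ω - avg f| ≤ 1 := abs_le.2 ⟨by linarith [(hf ω).1], by linarith [(hf ω).2]⟩
    have hx : |t * (f ω - avg f)| ≤ 1 := by
      rw [abs_mul]; exact mul_le_one₀ ht (abs_nonneg _) hd
    have h2 := (abs_le.1 (Real.abs_exp_sub_one_sub_id_le hx)).2
    have h3 : (t * (f ω - avg f)) ^ 2 ≤ t ^ 2 := by
      rw [mul_pow]
      have : (f ω - avg f) ^ 2 ≤ 1 := by rw [← sq_abs]; exact pow_le_one₀ (abs_nonneg _) hd
      nlinarith [sq_nonneg t]
    linarith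
  refine (avg_mono h1).trans ?_
  rw [avg_add, avg_const, avg_mul_left, avg_sub, avg_const, sub_self, mul_zero, add_zero, add_comm]
  exact Real.add_one_le_exp _

/-- Chernoff's method for both tails at `t = ± r/2`, where `N t² - N r |t|` takes its minimum `-N
r²/4`. -/
theorem avg_sum_deviation_le [DecidableEq κ] [Nonempty Ω] {f : Ω → ℝ}
    (hf : ∀ ω, f ω ∈ Set.Icc (0 : ℝ) 1) {r : ℝ} (hr0 : 0 ≤ r) (hr1 : r ≤ 1) :
    avg (fun y : κ → Ω =>
      if Fintype.card κ * r < |∑ i, f (y i) - Fintype.card κ * avg f| then (1 : ℝ) else 0) ≤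
      2 * Real.exp (-(Fintype.card κ * r ^ 2 / 4)) := by
  have key : ∀ t : ℝ, |t| ≤ 1 →
      avg (fun y : κ → Ω => Real.exp (t * (∑ i, f (y i) - Fintype.card κ * avg f))) ≤
        Real.exp (Fintype.card κ * t ^ 2) := by
    intro t ht
    have h : (fun y : κ → Ω => Real.exp (t * (∑ i, f (y i) - Fintype.card κ * avg f))) =
        fun y => ∏ i, Real.exp (t * (f (y i) - avg f)) := by
      funext y
      rw [← Real.exp_sum, ← Finset.mul_sum, Finset.sum_sub_distrib]
      simp
    rw [h, avg_prod (fun _ ω => Real.exp (t * (f ω - avg f)))]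
    simp only [Finset.prod_const, Finset.card_univ]
    calc _ ≤ Real.exp (t ^ 2) ^ Fintype.card κ :=
          pow_le_pow_left₀ (avg_nonneg fun _ => (Real.exp_pos _).le) (avg_exp_le hf ht) _
      _ = _ := by rw [← Real.exp_nat_mul]
  set N : ℝ := (Fintype.card κ : ℝ) with hN
  set c : ℝ := Real.exp (-(N * r ^ 2 / 2)) with hc
  -- If `|z| > N r`, one of the exponents `± r z / 2 - N r² / 2` is nonnegative.
  have hpt : ∀ y : κ → Ω, (if N * r < |∑ i, f (y i) - N * avg f| then (1 : ℝ) else 0) ≤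
      c * Real.exp (r / 2 * (∑ i, f (y i) - N * avg f)) +
      c * Real.exp (-(r / 2) * (∑ i, f (y i) - N * avg f)) := by
    intro y
    set z := ∑ i, f (y i) - N * avg f
    split_ifs with h
    · rw [hc, ← Real.exp_add, ← Real.exp_add]
      rcases abs_cases z with ⟨hz, -⟩ | ⟨hz, -⟩
      · refine le_add_of_le_of_nonneg (Real.one_le_exp ?_) (Real.exp_pos _).le
        rw [hz] at h
        nlinarith
      · refine le_add_of_nonneg_of_le (Real.exp_pos _).le (Real.one_le_exp ?_)
        rw [hz] at h
        nlinarith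
    · positivity
  have h1 := key (r / 2) (by rw [abs_of_nonneg (by linarith)]; linarith)
  have h2 := key (-(r / 2)) (by rw [abs_neg, abs_of_nonneg (by linarith)]; linarith)
  have hcpos : 0 ≤ c := (Real.exp_pos _).le
  refine (avg_mono hpt).trans ?_
  rw [avg_add, avg_mul_left, avg_mul_left]
  have h3 : c * Real.exp (N * (r / 2) ^ 2) = Real.exp (-(N * r ^ 2 / 4)) := by
    rw [hc, ← Real.exp_add]; congr 1; ring
  have h4 : (-(r / 2)) ^ 2 = (r / 2) ^ 2 := by ring
  rw [h4] at h2
  nlinarith [mul_le_mul_of_nonneg_left h1 hcpos, mul_le_mul_of_nonneg_left h2 hcpos]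

end Average

open Classical in
theorem coinProb_eq_avg {k : ℕ} (A : Set (Fin k → Bool)) :
    coinProb A = avg fun ω => if ω ∈ A then (1 : ℝ) else 0 := by
  rw [coinProb, avg, Finset.sum_boole, Set.ncard_eq_toFinset_card']
  simp

/-! ### Programs for functions of the input and of the random bits -/

theorem PolyTime.exists_prog {α β : Type} [Enc α] [Enc β] {f : α × List ℕ → β} (hf : PolyTime f)
    (coins : Polynomial ℕ) : ∃ (P : Prog) (steps : Polynomial ℕ),
      ∀ (a : α) (r : Fin (coins.eval (sz a)) → Bool), P.time (enc a) r ≤ steps.eval (sz a) ∧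
        P.output (enc a) r = enc (f (a, (List.ofFn r).map Bool.toNat)) := by
  obtain ⟨Q, p, hQ⟩ := hf
  -- The work starts at variable 2, above the input and the bits. Each bit contributes at most 3 to
  -- the size of the argument.
  refine ⟨.seq (.assign 2 (.pair (.var 0) (.var 1))) (.seq (Q 2) (.assign 0 (.var 2))),
    p.comp (2 + Polynomial.X + coins * 3) + 6, fun a r => ?_⟩
  set bits := (List.ofFn r).map Bool.toNat with hbits
  set σ := Prog.initStore (enc a) r with hσ
  have h1 : Val.ofList ((List.ofFn r).map fun b => Val.num b.toNat) = enc bits := by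
    simp only [enc, hbits, List.map_map]
    rfl
  have h2 : Val.pair (σ 0) (σ 1) = enc (a, bits) := by
    simp only [hσ, Prog.initStore, h1]
    rfl
  obtain ⟨h3, -, h4⟩ := (hQ (a, bits)).2 2 (Function.update σ 2 (enc (a, bits))) (by simp)
  have h5 : sz (a, bits) ≤ 2 + sz a + coins.eval (sz a) * 3 := by
    have : sz bits ≤ 1 + bits.length * (1 + 2) := sz_le_of_length_of_mem fun x hx => by
      obtain ⟨b, -, rfl⟩ := List.mem_map.1 hx
      exact sz_bool_le b
    rw [sz_pair]
    simp only [hbits, List.length_map, List.length_ofFn] at this ⊢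
    omega
  have h6 := natPoly_mono p h5
  constructor
  · simp only [Prog.time, Prog.run, PExpr.eval, PExpr.cost, ← hσ, h2, Polynomial.eval_add,
      Polynomial.eval_comp, Polynomial.eval_mul, Polynomial.eval_X, Polynomial.eval_ofNat] at h6 ⊢
    omega
  · simp only [Prog.output, Prog.run, PExpr.eval, ← hσ, h2, Function.update_self, h3]

/-! ### Properties of the greedy algorithm -/

namespace GreedySampling

theorem bestSeed_spec {n : ℕ} (hn : 0 < n) (f : List ℕ → ℕ) (S : List ℕ) :
    bestSeed (List.range n) f S < n ∧
      ∀ t < n, f (S ++ [t]) ≤ f (S ++ [bestSeed (List.range n) f S]) := by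
  have key : ∀ (l : List ℕ) (b : ℕ), b < n → (∀ t ∈ l, t < n) →
      let r := l.foldl (fun b s =>
        if decide (f (S ++ [b]) < f (S ++ [s])) = true then s else b) b
      r < n ∧ f (S ++ [b]) ≤ f (S ++ [r]) ∧ ∀ t ∈ l, f (S ++ [t]) ≤ f (S ++ [r]) := by
    intro l
    induction l with
    | nil => intro b hb _; exact ⟨hb, le_rfl, by simp⟩
    | cons s l ih =>
      intro b hb hl
      have hs := hl s List.mem_cons_self
      have hl' : ∀ t ∈ l, t < n := fun t ht => hl t (List.mem_cons_of_mem _ ht)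
      by_cases h : f (S ++ [b]) < f (S ++ [s])
      · obtain ⟨h1, h2, h3⟩ := ih s hs hl'
        simp only [List.foldl_cons, h, decide_true, if_true, List.mem_cons, forall_eq_or_imp]
        exact ⟨h1, h.le.trans h2, h2, h3⟩
      · obtain ⟨h1, h2, h3⟩ := ih b hb hl'
        simp only [List.foldl_cons, h, decide_false, Bool.false_eq_true, if_false, List.mem_cons,
          forall_eq_or_imp]
        exact ⟨h1, h2, (not_lt.1 h).trans h2, h3⟩
  -- The default `0` of the search is a voter because `0 < n`.
  obtain ⟨h1, -, h3⟩ := key (List.range n) 0 hn fun t ht => List.mem_range.1 ht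
  exact ⟨h1, fun t ht => h3 t (List.mem_range.2 ht)⟩

/-- Each entry of the list strictly increases `G`. -/
inductive StrictChain {V : Type*} [DecidableEq V] (G : Finset V → ℕ) : List V → Prop
  | nil : StrictChain G []
  | snoc (S : List V) (s : V) : StrictChain G S → G S.toFinset < G (insert s S.toFinset) →
      StrictChain G (S ++ [s])

/-- A repeated entry would leave the set, and hence `G`, unchanged. -/
theorem StrictChain.nodup {V : Type*} [DecidableEq V] {G : Finset V → ℕ} {S : List V}
    (h : StrictChain G S) : S.Nodup := by
  induction h with
  | nil => exact List.nodup_nil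
  | snoc S s _ hs ih =>
    rw [← List.concat_eq_append]
    refine ih.concat fun hmem => ?_
    rw [Finset.insert_eq_of_mem (List.mem_toFinset.2 hmem)] at hs
    exact lt_irrefl _ hs

/-- The list may end up shorter than `min (B / d) n`, since a seed without strict gain is not added.
The guarantee keeps the full exponent: if no seed gains, standing still also contracts the gap. -/
theorem greedySeeds_spec {n : ℕ} (hn : 0 < n) {f : List ℕ → ℕ} {G : Finset (Fin n) → ℕ}
    (hf : ∀ S : List (Fin n), f (S.map Fin.val) = G S.toFinset)
    (hG : IsCoverage fun T => (G T : ℝ)) {d : ℕ} (hd : 0 < d) (B : ℕ) :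
    ∃ S : List (Fin n), greedySeeds (List.range n) f d B = S.map Fin.val ∧ StrictChain G S ∧
      S.length ≤ min (B / d) n ∧ ∀ (D : ℕ) (T : Finset (Fin n)), 0 < D → T.card ≤ D →
        (1 - (1 - 1 / (D : ℝ)) ^ min (B / d) n) * G T ≤ G S.toFinset := by
  have hfold : greedySeeds (List.range n) f d B = (greedyStep (List.range n) f d B)^[n] [] := by
    rw [greedySeeds, List.foldl_const, List.length_range]
  rw [hfold]
  suffices h : ∀ j, ∃ S : List (Fin n),
      (greedyStep (List.range n) f d B)^[j] [] = S.map Fin.val ∧ StrictChain G S ∧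
      S.length ≤ min (B / d) j ∧ ∀ (D : ℕ) (T : Finset (Fin n)), 0 < D → T.card ≤ D →
        (G T : ℝ) - G S.toFinset ≤ (1 - 1 / (D : ℝ)) ^ min (B / d) j * G T by
    obtain ⟨S, h1, h2, h3, h4⟩ := h n
    exact ⟨S, h1, h2, h3, fun D T hD hT => by linarith [h4 D T hD hT]⟩
  intro j
  induction j with
  | zero => exact ⟨[], rfl, .nil, by simp, fun D T _ _ => by simp⟩
  | succ j ih =>
    obtain ⟨S, h1, h2, h3, h4⟩ := ih
    rw [Function.iterate_succ_apply', h1]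
    have hlen : B < ((S.map Fin.val).length + 1) * d ↔ B / d ≤ S.length := by
      rw [List.length_map, ← Nat.div_lt_iff_lt_mul hd, Nat.lt_succ_iff]
    -- Budget exhausted: `S.length ≤ min (B / d) j` gives `B / d ≤ j`, so the exponent no longer
    -- grows.
    by_cases hB : B / d ≤ S.length
    · refine ⟨S, ?_, h2, by omega, ?_⟩
      · rw [greedyStep, if_pos (by simpa using hlen.2 hB)]
      · rwa [show min (B / d) (j + 1) = min (B / d) j by omega]
    · obtain ⟨hb, hmax⟩ := bestSeed_spec hn f (S.map Fin.val)
      set b := bestSeed (List.range n) f (S.map Fin.val) with hbdef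
      have happ : ∀ t : Fin n, S.map Fin.val ++ [(t : ℕ)] = (S ++ [t]).map Fin.val := by simp
      have hins : ∀ t : Fin n, f (S.map Fin.val ++ [(t : ℕ)]) = G (insert t S.toFinset) := by
        intro t
        rw [happ, hf]
        congr 1
        ext x; simp
      have hstep : ∀ S' : List (Fin n), G S.toFinset ≤ G S'.toFinset →
          (∀ t, G (insert t S.toFinset) ≤ G S'.toFinset) →
          ∀ (D : ℕ) (T : Finset (Fin n)), 0 < D → T.card ≤ D →
            (G T : ℝ) - G S'.toFinset ≤ (1 - 1 / (D : ℝ)) ^ min (B / d) (j + 1) * G T := by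
        intro S' hS' hT' D T hD hT
        have hSR : (G S.toFinset : ℝ) ≤ G S'.toFinset := by exact_mod_cast hS'
        -- If `B / d ≤ j`, skipped rounds have already used up the exponent and monotonicity
        -- suffices; otherwise one contraction is applied.
        rcases le_or_gt (B / d) j with hj | hj
        · rw [show min (B / d) (j + 1) = min (B / d) j by omega]
          linarith [h4 D T hD hT]
        · have hq : (0 : ℝ) ≤ 1 - 1 / D := by
            have : (1 : ℝ) ≤ D := by exact_mod_cast hD
            rw [sub_nonneg, div_le_one (by linarith)]; exact this
          refine (hG.gap_step hD hT hSR fun t => by exact_mod_cast hT' t).trans ?_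
          have h5 := h4 D T hD hT
          rw [show min (B / d) j = j by omega] at h5
          rw [show min (B / d) (j + 1) = j + 1 by omega, pow_succ', mul_assoc]
          exact mul_le_mul_of_nonneg_left h5 hq
      have hmax' : ∀ t : Fin n, G (insert t S.toFinset) ≤ G (insert ⟨b, hb⟩ S.toFinset) := by
        intro t
        rw [← hins t, ← hins ⟨b, hb⟩]
        exact hmax t t.2
      have hneg : ¬ (decide (B < ((S.map Fin.val).length + 1) * d) = true) := by
        simpa using fun h => hB (hlen.1 h)
      by_cases hinc : f (S.map Fin.val) < f (S.map Fin.val ++ [b])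
      · have hlt : G S.toFinset < G (insert ⟨b, hb⟩ S.toFinset) := by
          rw [← hins ⟨b, hb⟩, ← hf]; exact hinc
        have hset : (S ++ [(⟨b, hb⟩ : Fin n)]).toFinset = insert (⟨b, hb⟩ : Fin n) S.toFinset := by
          ext x; simp
        refine ⟨S ++ [⟨b, hb⟩], ?_, .snoc S _ h2 hlt, ?_, hstep _ ?_ ?_⟩
        · rw [greedyStep, if_neg hneg, ← hbdef, if_pos (by simpa using hinc), ← happ]
        · rw [List.length_append, List.length_singleton]; omega
        · rw [hset]; exact hlt.le
        · rw [hset]; exact hmax'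
      · refine ⟨S, ?_, h2, by omega, hstep S le_rfl fun t => (hmax' t).trans ?_⟩
        · rw [greedyStep, if_neg hneg, ← hbdef, if_neg (by simpa using hinc)]
        · rw [← hins ⟨b, hb⟩, ← hf]; exact not_lt.1 hinc

end GreedySampling

/-! ### Breadth first search -/

/-- Until it is stable, the set gains an element in each round, which can happen at most `|V|`
times. -/
theorem iterate_card_fixed {V : Type*} [Fintype V] [DecidableEq V] {g : Finset V → Finset V}
    (hg : ∀ X, X ⊆ g X) (X : Finset V) :
    g (g^[Fintype.card V] X) = g^[Fintype.card V] X := by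
  have key : ∀ t, g (g^[t] X) = g^[t] X ∨ t ≤ (g^[t] X).card := by
    intro t
    induction t with
    | zero => exact Or.inr (Nat.zero_le _)
    | succ t ih =>
      rw [Function.iterate_succ_apply']
      by_cases h : g (g^[t] X) = g^[t] X
      · left; rw [h, h]
      · right
        have h1 : (g^[t] X).card < (g (g^[t] X)).card :=
          Finset.card_lt_card (Finset.ssubset_iff_subset_ne.2 ⟨hg _, Ne.symm h⟩)
        rcases ih with ih | ih
        · exact absurd ih h
        · omega
  rcases key (Fintype.card V) with h | h
  · exact h
  · have h1 : g^[Fintype.card V] X = Finset.univ :=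
      Finset.eq_univ_of_card _ (le_antisymm (Finset.card_le_univ _) h)
    rw [h1]
    exact Finset.univ_subset_iff.1 (hg _)

namespace ECSInstance

variable {I : ECSInstance}

theorem exists_mem_cascade_fst {H : Finset (I.Voter × I.Voter)} {s v : I.Voter} {t : ℕ}
    (h : v ∈ (cascade H s t).2) : Influenced H s v := by
  induction t with
  | zero => exact ⟨0, h⟩
  | succ t ih =>
    rcases Finset.mem_union.1 h with h | h
    · exact ih h
    · exact ⟨t + 1, h⟩

/-- The times of activation are irrelevant to the final scores; only reachability in the live graph
matters. -/
theorem influenced_iff {H : Finset (I.Voter × I.Voter)} {s v : I.Voter} :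
    Influenced H s v ↔ Relation.ReflTransGen (fun u w => (u, w) ∈ H) s v := by
  constructor
  · rintro ⟨t, ht⟩
    induction t generalizing v with
    | zero =>
      rw [cascade, Finset.mem_singleton] at ht
      rw [ht]
    | succ t ih =>
      obtain ⟨-, u, hu, huv⟩ := (Finset.mem_filter.1 ht).2
      exact (ih hu).tail huv
  · intro h
    induction h with
    | refl => exact influenced_self H s
    | tail _ huv ih =>
      obtain ⟨t, ht⟩ := ih
      rename_i u w _
      -- The successor of a voter activated at time `t` is activated at time `t + 1` unless that
      -- happened before.
      by_cases hw : w ∈ (cascade H s t).2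
      · exact exists_mem_cascade_fst hw
      · exact ⟨t + 1, Finset.mem_filter.2 ⟨Finset.mem_univ _, hw, u, ht, huv⟩⟩

/-- One round of the breadth first search. -/
def spread (H : Finset (I.Voter × I.Voter)) (X : Finset I.Voter) : Finset I.Voter :=
  Finset.univ.filter fun v => v ∈ X ∨ ∃ u ∈ X, (u, v) ∈ H

theorem mem_spread {H : Finset (I.Voter × I.Voter)} {X : Finset I.Voter} {v : I.Voter} :
    v ∈ spread H X ↔ v ∈ X ∨ ∃ u ∈ X, (u, v) ∈ H := by
  simp [spread]

/-- After `n` rounds the set is stable, hence closed under the edges of `H`. -/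
theorem mem_iterate_spread {H : Finset (I.Voter × I.Voter)} {X : Finset I.Voter} {v : I.Voter} :
    v ∈ (spread H)^[I.n] X ↔ ∃ s ∈ X, Influenced H s v := by
  constructor
  · have : ∀ t v, v ∈ (spread H)^[t] X → ∃ s ∈ X, Influenced H s v := by
      intro t
      induction t with
      | zero => exact fun v hv => ⟨v, hv, influenced_self H v⟩
      | succ t ih =>
        intro v hv
        rw [Function.iterate_succ_apply', mem_spread] at hv
        rcases hv with hv | ⟨u, hu, huv⟩
        · exact ih v hv
        · obtain ⟨s, hs, hi⟩ := ih u hu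
          exact ⟨s, hs, influenced_iff.2 ((influenced_iff.1 hi).tail huv)⟩
    exact this I.n v
  · rintro ⟨s, hs, hi⟩
    have hsub : ∀ Y : Finset I.Voter, Y ⊆ spread H Y := fun Y v hv => mem_spread.2 (Or.inl hv)
    have hfix := iterate_card_fixed hsub X
    rw [Fintype.card_fin] at hfix
    have hs' : s ∈ (spread H)^[I.n] X := by
      have : ∀ t, s ∈ (spread H)^[t] X := by
        intro t
        induction t with
        | zero => exact hs
        | succ t ih => rw [Function.iterate_succ_apply']; exact hsub _ ih
      exact this I.n
    have hr := influenced_iff.1 hi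
    induction hr with
    | refl => exact hs'
    | tail h huv ih =>
      rw [← hfix, mem_spread]
      exact Or.inr ⟨_, ih (influenced_iff.2 h), huv⟩

/-! ### The algorithm on encoded instances -/

open GreedySampling

/-- The list form of an edge. -/
def rawEdge (q : I.Voter × I.Voter → ℚ) (e : I.Voter × I.Voter) : Edge :=
  (e.1, e.2, (q e).num.toNat, (q e).den, 0)

/-- The edges as a list. -/
def edgeList (I : ECSInstance) : List (I.Voter × I.Voter) :=
  ((List.finRange I.n).product (List.finRange I.n)).filter fun e => decide (e ∈ I.E)

/-- The score vectors as a list. -/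
def scoreRows (I : ECSInstance) : List (List ℕ) :=
  (List.finRange I.n).map fun v => (List.finRange (I.ℓ + 1)).map fun c => I.score v c

/-- The list form of an instance with a confidence parameter. -/
def rawInput (I : ECSInstance) (q : I.Voter × I.Voter → ℚ) (k : ℕ) : RawInput :=
  ((I.scoreRows, I.edgeList.map (rawEdge q), I.B, 0), List.replicate k 0)

/-- The final `0` in the tuple types `Edge` and `RawInput` is the end-of-list leaf, so these nested
pairs encode the lists of `encodeInput`. -/
theorem enc_rawInput (q : I.Voter × I.Voter → ℚ) (k : ℕ) :
    enc (I.rawInput q k) = I.encodeInput q k := by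
  have h1 : enc I.scoreRows = Val.ofList ((List.finRange I.n).map fun v =>
        Val.ofList ((List.finRange (I.ℓ + 1)).map fun c => Val.num (I.score v c))) := by
    simp [enc, scoreRows, Function.comp_def]
  have h2 : enc (I.edgeList.map (rawEdge q)) = Val.ofList ((((List.finRange I.n).product
      (List.finRange I.n)).filter fun e => decide (e ∈ I.E)).map fun e =>
        Val.ofList [Val.num e.1, Val.num e.2, Val.num (q e).num.toNat, Val.num (q e).den]) := by
    simp only [enc, List.map_map]
    rfl
  have h3 : enc (List.replicate k 0) = Val.ofList (List.replicate k (Val.num 0)) := by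
    simp [enc]
  change Val.pair (Val.pair (enc I.scoreRows) (Val.pair (enc (I.edgeList.map (rawEdge q)))
    (Val.pair (Val.num I.B) (Val.num 0)))) (enc (List.replicate k 0)) = _
  rw [h1, h2, h3]
  rfl

theorem length_scoreRows (I : ECSInstance) : I.scoreRows.length = I.n := by
  simp [scoreRows]

theorem getD_scoreRows (v : I.Voter) :
    I.scoreRows.getD v [] = (List.finRange (I.ℓ + 1)).map fun c => I.score v c := by
  simp [scoreRows, List.getD_eq_getElem?_getD]

theorem getD_scoreRow (v : I.Voter) :
    ((List.finRange (I.ℓ + 1)).map fun c => I.score v c).getD 0 0 = I.score v 0 := by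
  simp [List.finRange_succ]

theorem opposedVoters_scoreRows (I : ECSInstance) :
    opposedVoters I.scoreRows =
      ((List.finRange I.n).filter fun v => decide (v ∈ I.opposed)).map Fin.val := by
  rw [opposedVoters, length_scoreRows, ← List.map_coe_finRange_eq_range, List.filter_map]
  congr 1
  refine List.filter_congr fun v _ => ?_
  simp only [Function.comp_apply, getD_scoreRows, getD_scoreRow, List.any_map]
  rw [Bool.eq_iff_iff]
  simp [mem_opposed]

theorem listMax_spec (l : List ℕ) : (∀ x ∈ l, x ≤ listMax l) ∧ (listMax l = 0 ∨ listMax l ∈ l) := by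
  have key : ∀ (l : List ℕ) (c : ℕ),
      let r := l.foldl (fun c d => if decide (c < d) = true then d else c) c
      c ≤ r ∧ (∀ x ∈ l, x ≤ r) ∧ (r = c ∨ r ∈ l) := by
    intro l
    induction l with
    | nil => intro c; simp
    | cons d l ih =>
      intro c
      by_cases h : c < d
      · obtain ⟨h1, h2, h3⟩ := ih d
        simp only [List.foldl_cons, h, decide_true, if_true, List.mem_cons, forall_eq_or_imp]
        exact ⟨h.le.trans h1, ⟨h1, h2⟩, Or.inr h3⟩
      · obtain ⟨h1, h2, h3⟩ := ih c
        simp only [List.foldl_cons, h, decide_false, Bool.false_eq_true, if_false, List.mem_cons,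
          forall_eq_or_imp]
        exact ⟨h1, ⟨(not_lt.1 h).trans h1, h2⟩, h3.imp_right Or.inr⟩
  obtain ⟨-, h2, h3⟩ := key l 0
  exact ⟨h2, h3⟩

/-- Truncated subtraction turns negative excesses, and that of `c_0` itself, into `0`; this is
harmless because `δ > 0`. -/
theorem maxExcess_scoreRows (hδ : 0 < I.delta) : maxExcess I.scoreRows = I.delta.toNat := by
  have hmem : ∀ x, x ∈ (I.scoreRows.flatMap fun r => r.map fun s => s - r.getD 0 0) ↔
      ∃ v c, x = I.score v c - I.score v 0 := by
    intro x
    rw [scoreRows, List.flatMap_map, List.mem_flatMap]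
    simp only [getD_scoreRow, List.map_map, List.mem_map, List.mem_finRange, true_and,
      Function.comp_apply, eq_comm]
  obtain ⟨h1, h2⟩ := listMax_spec (I.scoreRows.flatMap fun r => r.map fun s => s - r.getD 0 0)
  have hge : I.delta.toNat ≤ maxExcess I.scoreRows := by
    obtain ⟨x, -, hx⟩ := Finset.exists_mem_eq_sup' I.pairs_nonempty
      fun x : I.Voter × I.Candidate => (I.score x.1 x.2 : ℤ) - (I.score x.1 0 : ℤ)
    have hx' : I.delta = (I.score x.1 x.2 : ℤ) - (I.score x.1 0 : ℤ) := hx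
    have := h1 _ ((hmem (I.score x.1 x.2 - I.score x.1 0)).2 ⟨x.1, x.2, rfl⟩)
    unfold maxExcess
    omega
  refine le_antisymm ?_ hge
  rcases h2 with h2 | h2
  · unfold maxExcess; omega
  · obtain ⟨v, c, hvc⟩ := (hmem _).1 h2
    change maxExcess I.scoreRows = _ at hvc
    rcases eq_or_ne c 0 with rfl | hc
    · omega
    · have := score_le_delta v hc
      omega

theorem mem_reach (q : I.Voter × I.Voter → ℚ) (Hl : List (I.Voter × I.Voter)) (S : List I.Voter)
    (v : I.Voter) :
    (v : ℕ) ∈ reach (List.range I.n) (Hl.map (rawEdge q)) (S.map Fin.val) ↔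
      ∃ s ∈ S.toFinset, Influenced Hl.toFinset s v := by
  let toFin : List ℕ → Finset I.Voter := fun R => Finset.univ.filter fun v => (v : ℕ) ∈ R
  have hstep : ∀ R, toFin (reachStep (List.range I.n) (Hl.map (rawEdge q)) R) =
      spread Hl.toFinset (toFin R) := by
    intro R
    ext v
    simp only [toFin, reachStep, mem_spread, Finset.mem_filter, Finset.mem_univ, true_and,
      List.mem_filter, List.mem_range, Fin.is_lt, Bool.or_eq_true, List.contains_iff_mem,
      List.any_eq_true, List.mem_map, Bool.and_eq_true, decide_eq_true_eq, List.mem_toFinset]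
    refine or_congr Iff.rfl ⟨?_, ?_⟩
    · rintro ⟨_, ⟨⟨u, w⟩, he, rfl⟩, hu, hw⟩
      obtain rfl : w = v := Fin.ext hw
      exact ⟨u, hu, he⟩
    · rintro ⟨u, hu, he⟩
      exact ⟨_, ⟨(u, v), he, rfl⟩, hu, rfl⟩
  have hiter : ∀ t R, toFin ((reachStep (List.range I.n) (Hl.map (rawEdge q)))^[t] R) =
      (spread Hl.toFinset)^[t] (toFin R) := by
    intro t R
    induction t with
    | zero => rfl
    | succ t ih => rw [Function.iterate_succ_apply', Function.iterate_succ_apply', hstep, ih]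
  have hS : toFin (S.map Fin.val) = S.toFinset := by
    ext v; simp [toFin, Fin.val_inj]
  rw [← mem_iterate_spread, ← hS, ← hiter, reach, List.foldl_const, List.length_range]
  simp [toFin]

theorem value_eq (q : I.Voter × I.Voter → ℚ) (Gs : List (List (I.Voter × I.Voter)))
    (S : List I.Voter) :
    value (List.range I.n) (opposedVoters I.scoreRows) (Gs.map fun H => H.map (rawEdge q))
      (S.map Fin.val) = (Gs.map fun H => (I.covered H.toFinset S.toFinset).card).sum := by
  rw [value, List.map_map]
  congr 1
  refine List.map_congr_left fun H _ => ?_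
  rw [Function.comp_apply, opposedVoters_scoreRows, List.filter_map, List.length_map,
    List.filter_filter, ← List.toFinset_card_of_nodup ((List.nodup_finRange _).filter _)]
  congr 1
  ext v
  simp [mem_covered, mem_reach, and_comm]

end ECSInstance

/-! ### Random numbers from random bits -/

/-- The number with the given binary digits, the most significant one first. -/
def bitsVal {m : ℕ} (x : Fin m → Bool) : ℕ :=
  (List.ofFn x).foldl (fun c b => 2 * c + b.toNat) 0

theorem bitsVal_lt {m : ℕ} (x : Fin m → Bool) : bitsVal x < 2 ^ m := by
  have key : ∀ l : List Bool, l.foldl (fun c b => 2 * c + b.toNat) 0 < 2 ^ l.length := by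
    intro l
    induction l using List.reverseRecOn with
    | nil => simp
    | append_singleton l b ih =>
      rw [List.foldl_append, List.length_append, List.length_singleton, pow_succ]
      have := Bool.toNat_le b
      simp only [List.foldl_cons, List.foldl_nil]
      omega
  simpa [bitsVal] using key (List.ofFn x)

theorem bitsVal_injective {m : ℕ} : Function.Injective (bitsVal (m := m)) := by
  have key : ∀ l l' : List Bool, l.length = l'.length →
      l.foldl (fun c b => 2 * c + b.toNat) 0 = l'.foldl (fun c b => 2 * c + b.toNat) 0 →
      l = l' := by
    intro l
    induction l using List.reverseRecOn with
    | nil => intro l' h _; exact (List.length_eq_zero_iff.1 h.symm).symm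
    | append_singleton l b ih =>
      intro l'
      induction l' using List.reverseRecOn with
      | nil => intro h; simp at h
      | append_singleton l' b' _ =>
        intro h1 h2
        simp only [List.foldl_append, List.foldl_cons, List.foldl_nil] at h2
        have hb := Bool.toNat_le b
        have hb' := Bool.toNat_le b'
        have hl := ih l' (by simpa using h1) (by omega)
        have hbb : b.toNat = b'.toNat := by omega
        rw [hl, show b = b' by revert hbb; cases b <;> cases b' <;> simp]
  intro x y h
  exact List.ofFn_injective (key _ _ (by simp) h)

/-- Binary digits are a bijection onto `0, …, 2^m - 1`, so `bitsVal` of uniform bits is uniform. -/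
theorem avg_bitsVal {m : ℕ} (f : ℕ → ℝ) :
    avg (fun x : Fin m → Bool => f (bitsVal x)) = (∑ j ∈ Finset.range (2 ^ m), f j) / 2 ^ m := by
  have hbij : Function.Bijective fun x : Fin m → Bool =>
      (⟨bitsVal x, bitsVal_lt x⟩ : Fin (2 ^ m)) := by
    rw [Fintype.bijective_iff_injective_and_card]
    exact ⟨fun x y h => bitsVal_injective (Fin.mk.inj h), by simp⟩
  have h := avg_equiv (Equiv.ofBijective _ hbij) fun j : Fin (2 ^ m) => f j
  rw [Finset.sum_range, ← show (avg fun j : Fin (2 ^ m) => f j) = (∑ j : Fin (2 ^ m), f j) / 2 ^ m by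
    simp [avg], ← h]
  rfl

theorem abs_avg_threshold_sub_le {m a b : ℕ} (hb : 0 < b) (hab : a ≤ b) :
    |(a : ℝ) / b - avg fun x : Fin m → Bool =>
      if decide (bitsVal x * b < a * 2 ^ m) = true then (1 : ℝ) else 0| ≤ 1 / 2 ^ m := by
  rw [avg_bitsVal fun j => if decide (j * b < a * 2 ^ m) = true then (1 : ℝ) else 0]
  -- `c = ⌈a 2^m / b⌉` is the number of values below the threshold, so the test succeeds with
  -- probability `c / 2^m`.
  obtain ⟨c, hc1, hc2⟩ : ∃ c, a * 2 ^ m ≤ c * b ∧ c * b < a * 2 ^ m + b := by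
    refine ⟨(a * 2 ^ m + (b - 1)) / b, ?_, ?_⟩
    · have h1 := Nat.div_add_mod (a * 2 ^ m + (b - 1)) b
      have h2 := Nat.mod_lt (a * 2 ^ m + (b - 1)) hb
      rw [mul_comm] at h1
      omega
    · have := Nat.div_mul_le_self (a * 2 ^ m + (b - 1)) b
      omega
  have hiff : ∀ j, j * b < a * 2 ^ m ↔ j < c := by
    intro j
    constructor
    · intro h
      exact lt_of_mul_lt_mul_right (h.trans_le hc1) (Nat.zero_le b)
    · intro h
      have : (j + 1) * b ≤ c * b := Nat.mul_le_mul_right b h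
      rw [Nat.succ_mul] at this
      omega
  have hcm : c ≤ 2 ^ m := by
    by_contra! hcon
    have h1 := (hiff (2 ^ m)).2 hcon
    have h2 : a * 2 ^ m ≤ b * 2 ^ m := Nat.mul_le_mul_right _ hab
    rw [mul_comm (2 ^ m) b] at h1
    omega
  have hsum : (∑ j ∈ Finset.range (2 ^ m),
      if decide (j * b < a * 2 ^ m) = true then (1 : ℝ) else 0) = c := by
    simp only [decide_eq_true_eq, hiff, Finset.sum_boole]
    congr 1
    rw [show (Finset.range (2 ^ m)).filter (fun j => j < c) = Finset.range c by
      ext j; simp only [Finset.mem_filter, Finset.mem_range]; omega, Finset.card_range]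
  rw [hsum]
  have hbR : (0 : ℝ) < b := by exact_mod_cast hb
  have h2 : (0 : ℝ) < 2 ^ m := by positivity
  have hc1' : (a : ℝ) * 2 ^ m ≤ c * b := by exact_mod_cast hc1
  have hc2' : (c : ℝ) * b ≤ a * 2 ^ m + b := by exact_mod_cast hc2.le
  rw [div_sub_div _ _ hbR.ne' h2.ne', abs_div, abs_of_pos (mul_pos hbR h2), div_le_div_iff₀
    (mul_pos hbR h2) h2]
  have : |(a : ℝ) * 2 ^ m - b * c| ≤ b := abs_le.2 ⟨by linarith, by linarith⟩
  nlinarith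

/-- The position of a bit in the list of random bits. -/
def coinIndex {N n m C : ℕ} (h : N * n * n * m ≤ C)
    (x : Fin N × ((Fin n × Fin n) × Fin m)) : Fin C :=
  ⟨((x.1 * n + x.2.1.1) * n + x.2.1.2) * m + x.2.2, by
    obtain ⟨i, ⟨u, v⟩, b⟩ := x
    refine lt_of_lt_of_le ?_ h
    have h1 : ∀ {a A c d : ℕ}, a < A → c < d → a * d + c < A * d := fun {a A c d} ha hc => by
      have := Nat.mul_le_mul_right d (Nat.succ_le_of_lt ha)
      rw [Nat.succ_mul] at this
      omega
    exact h1 (h1 (h1 i.2 u.2) v.2) b.2⟩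

/-- The index is a mixed-radix expansion, recovered digit by digit by division with remainder. -/
theorem coinIndex_injective {N n m C : ℕ} (h : N * n * n * m ≤ C) :
    Function.Injective (coinIndex h) := by
  have key : ∀ {a a' c c' d : ℕ}, c < d → c' < d → a * d + c = a' * d + c' → a = a' ∧ c = c' := by
    intro a a' c c' d hc hc' he
    have h1 : a = a' := by
      have e1 := congrArg (· / d) he
      simpa [Nat.add_div_of_dvd_right, Nat.mul_div_cancel _ (show 0 < d by omega),
        Nat.div_eq_of_lt hc, Nat.div_eq_of_lt hc'] using e1
    exact ⟨h1, by subst h1; omega⟩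
  rintro ⟨i, ⟨u, v⟩, b⟩ ⟨i', ⟨u', v'⟩, b'⟩ he
  have h0 := congrArg Fin.val he
  simp only [coinIndex] at h0
  obtain ⟨h1, hb⟩ := key b.2 b'.2 h0
  obtain ⟨h2, hv⟩ := key v.2 v'.2 h1
  obtain ⟨hi, hu⟩ := key u.2 u'.2 h2
  simp [Fin.ext_iff, hb, hv, hu, hi]

/-- The bits for the samples and edges. -/
def coinTable {N n m C : ℕ} (h : N * n * n * m ≤ C) (r : Fin C → Bool) (i : Fin N)
    (e : Fin n × Fin n) (b : Fin m) : Bool :=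
  r (coinIndex h (i, e, b))

/-- Distinct table entries read distinct bits, and surplus bits do not matter, so the table is
uniform. -/
theorem avg_coinTable {N n m C : ℕ} (h : N * n * n * m ≤ C)
    (f : (Fin N → Fin n × Fin n → Fin m → Bool) → ℝ) :
    avg (fun r : Fin C → Bool => f (coinTable h r)) = avg f := by
  let e₁ : (Fin N × ((Fin n × Fin n) × Fin m) → Bool) ≃ (Fin N → (Fin n × Fin n) × Fin m → Bool) :=
    Equiv.curry _ _ _
  let e₂ : (Fin N → (Fin n × Fin n) × Fin m → Bool) ≃ (Fin N → Fin n × Fin n → Fin m → Bool) :=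
    Equiv.arrowCongr (Equiv.refl _) (Equiv.curry _ _ _)
  have h1 := avg_comp_injective (Ω := Bool) (coinIndex_injective h) fun x => f (e₂ (e₁ x))
  rw [avg_equiv e₁ fun x => f (e₂ x), avg_equiv e₂ f] at h1
  exact h1

theorem draw_eq_bitsVal {C : ℕ} (r : Fin C → Bool) {m i : ℕ} (h : ∀ b < m, i * m + b < C) :
    GreedySampling.draw ((List.ofFn r).map Bool.toNat) m i =
      bitsVal fun b : Fin m => r ⟨i * m + b, h b b.2⟩ := by
  rw [GreedySampling.draw, bitsVal, ← List.map_coe_finRange_eq_range, List.foldl_map,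
    List.ofFn_eq_map (f := fun b : Fin m => r ⟨i * m + b, h b b.2⟩), List.foldl_map]
  congr 1
  funext c b
  have := h b b.2
  simp [List.getD_eq_getElem?_getD, this]

namespace ECSInstance

open GreedySampling

variable {I : ECSInstance}

/-! ### Sampled live graphs -/

/-- The edge `e` is live for the random digits `x`. -/
def liveTest (q : I.Voter × I.Voter → ℚ) {m : ℕ} (e : I.Voter × I.Voter) (x : Fin m → Bool) :
    Bool :=
  decide (bitsVal x * (q e).den < (q e).num.toNat * 2 ^ m)

/-- The live graph for the random digits `ω`. -/
def drawGraph (q : I.Voter × I.Voter → ℚ) {m : ℕ} (ω : I.Voter × I.Voter → Fin m → Bool) :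
    Finset (I.Voter × I.Voter) :=
  I.E.filter fun e => liveTest q e (ω e) = true

/-- The number of covered voters, summed over the samples. -/
noncomputable def sampleCover (q : I.Voter × I.Voter → ℚ) {N m : ℕ}
    (y : Fin N → I.Voter × I.Voter → Fin m → Bool) (T : Finset I.Voter) : ℕ :=
  ∑ i, (I.covered (drawGraph q (y i)) T).card

theorem isCoverage_sampleCover (q : I.Voter × I.Voter → ℚ) {N m : ℕ}
    (y : Fin N → I.Voter × I.Voter → Fin m → Bool) :
    IsCoverage fun T => (sampleCover q y T : ℝ) := by
  have h := IsCoverage.sum Finset.univ (fun _ : Fin N => (1 : ℝ)) (fun _ _ => zero_le_one)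
    (fun i T => ((I.covered (drawGraph q (y i)) T).card : ℝ)) fun i _ => isCoverage_card_covered _
  simpa [sampleCover] using h

theorem num_toNat_div_den {q : I.Voter × I.Voter → ℚ} (hq : ∀ e, I.p e = (q e : ℝ))
    (e : I.Voter × I.Voter) : ((q e).num.toNat : ℝ) / (q e).den = I.p e := by
  have h0 : 0 ≤ q e := by
    have := I.p_nonneg e
    rw [hq e] at this
    exact_mod_cast this
  have h1 : ((q e).num.toNat : ℤ) = (q e).num := Int.toNat_of_nonneg (Rat.num_nonneg.2 h0)
  have h2 : (((q e).num.toNat : ℤ) : ℝ) = ((q e).num : ℝ) := by rw [h1]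
  rw [hq e, Rat.cast_def, ← h2, Int.cast_natCast]

/-- The rounding respects the extremes: the test never accepts an edge of strength 0 and, as
`bitsVal x < 2^m`, never rejects one of strength 1. -/
theorem liveProb_drawGraph_pos {q : I.Voter × I.Voter → ℚ} (hq : ∀ e, I.p e = (q e : ℝ)) {m : ℕ}
    (ω : I.Voter × I.Voter → Fin m → Bool) : 0 < I.liveProb (drawGraph q ω) := by
  have hden : ∀ e, (0 : ℝ) < (q e).den := fun e => by exact_mod_cast (q e).den_pos
  refine mul_pos (Finset.prod_pos fun e he => ?_) (Finset.prod_pos fun e he => ?_)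
  · have h := (Finset.mem_filter.1 he).2
    simp only [liveTest, decide_eq_true_eq] at h
    have hpos : 0 < (q e).num.toNat := by
      rcases Nat.eq_zero_or_pos (q e).num.toNat with h0 | h0
      · rw [h0] at h; simp at h
      · exact h0
    rw [← num_toNat_div_den hq e]
    have : (0 : ℝ) < (q e).num.toNat := by exact_mod_cast hpos
    exact div_pos this (hden e)
  · obtain ⟨heE, hne⟩ := Finset.mem_sdiff.1 he
    have h : ¬ (bitsVal (ω e) * (q e).den < (q e).num.toNat * 2 ^ m) := fun hlt =>
      hne (Finset.mem_filter.2 ⟨heE, by simpa [liveTest] using hlt⟩)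
    have hlt : (q e).num.toNat < (q e).den := by
      have h1 := Nat.mul_lt_mul_of_pos_right (bitsVal_lt (ω e)) (q e).den_pos
      have h2 : (q e).num.toNat * 2 ^ m < (q e).den * 2 ^ m := by
        rw [mul_comm (q e).den]; omega
      exact lt_of_mul_lt_mul_right h2 (Nat.zero_le _)
    rw [sub_pos, ← num_toNat_div_den hq e, div_lt_one (hden e)]
    exact_mod_cast hlt

/-- Chains that strictly increase the sampled coverage are built greedily. -/
theorem greedyBuilt_of_strictChain (hδ : 0 < I.delta) {q : I.Voter × I.Voter → ℚ}
    (hq : ∀ e, I.p e = (q e : ℝ)) {N m : ℕ} {y : Fin N → I.Voter × I.Voter → Fin m → Bool}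
    {S : List I.Voter} (h : StrictChain (sampleCover q y) S) : I.GreedyBuilt (I.deltaPlan S) := by
  induction h with
  | nil => exact .nil
  | snoc S s hS hlt ih =>
    have happ : I.deltaPlan (S ++ [s]) = I.deltaPlan S ++ [(s, Pi.single 0 I.delta)] := by
      simp [deltaPlan]
    rw [happ]
    refine .snoc _ _ ih ⟨?_, Or.inr ?_⟩
    · rw [seeds_deltaPlan]
      have hn := (StrictChain.snoc S s hS hlt).nodup
      rw [List.nodup_append] at hn
      exact fun hmem => hn.2.2 s hmem s (List.mem_singleton_self s) rfl
    · rw [← happ, expVotes_deltaPlan hδ, expVotes_deltaPlan hδ, toFinset_append_singleton]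
      refine (add_lt_add_iff_left _).2 ?_
      -- Some sample gains strictly; its graph has positive probability, and no graph loses.
      obtain ⟨i, -, hi⟩ := Finset.exists_lt_of_sum_lt hlt
      refine Finset.sum_lt_sum (fun H _ => mul_le_mul_of_nonneg_left ?_ (liveProb_nonneg H))
        ⟨drawGraph q (y i), Finset.mem_powerset.2 (Finset.filter_subset _ _), ?_⟩
      · exact (isCoverage_card_covered H).mono (Finset.subset_insert _ _)
      · exact mul_lt_mul_of_pos_left (Nat.cast_lt.2 hi) (liveProb_drawGraph_pos hq (y i))

/-! ### Accuracy of the samples -/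

theorem expCover_eq_subsetExpect (T : Finset I.Voter) :
    I.expCover T = subsetExpect I.p I.E fun H => ((I.covered H T).card : ℝ) := rfl

/-- At most `n²` edges have rounded probabilities, each off by at most `2^{-m}`, and the coverage
lies in `[0, n]`. -/
theorem abs_avg_cover_sub_le {q : I.Voter × I.Voter → ℚ} (hq : ∀ e, I.p e = (q e : ℝ)) (m : ℕ)
    (T : Finset I.Voter) :
    |I.expCover T - avg fun ω : I.Voter × I.Voter → Fin m → Bool =>
      ((I.covered (drawGraph q ω) T).card : ℝ)| ≤ (I.n : ℝ) ^ 3 / 2 ^ m := by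
  have h1 := avg_filter (Ω := Fin m → Bool) I.E (fun e x => liveTest q e x)
    fun H => ((I.covered H T).card : ℝ)
  have h2 : (avg fun ω : I.Voter × I.Voter → Fin m → Bool =>
      ((I.covered (drawGraph q ω) T).card : ℝ)) = subsetExpect (fun e => avg fun x : Fin m → Bool =>
        if liveTest q e x = true then 1 else 0) I.E fun H => ((I.covered H T).card : ℝ) := h1
  rw [h2, expCover_eq_subsetExpect]
  refine (abs_subsetExpect_sub_le (M := I.n) (r := 1 / 2 ^ m)
    (fun e => ⟨I.p_nonneg e, I.p_le_one e⟩) (fun e => ⟨avg_nonneg fun x => ?_, ?_⟩) (fun e => ?_) I.E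
    (fun H => ⟨Nat.cast_nonneg _, by exact_mod_cast card_covered_le H T⟩)).trans ?_
  · split_ifs <;> norm_num
  · refine (avg_mono fun x => ?_).trans (avg_const (Ω := Fin m → Bool) 1).le
    split_ifs <;> norm_num
  · rw [← num_toNat_div_den hq e]
    refine abs_avg_threshold_sub_le (q e).den_pos ?_
    have hden : (0 : ℝ) < (q e).den := by exact_mod_cast (q e).den_pos
    have := I.p_le_one e
    rw [← num_toNat_div_den hq e, div_le_one hden] at this
    exact_mod_cast this
  · have hE : (I.E.card : ℝ) ≤ I.n ^ 2 := by
      have := Finset.card_le_univ I.E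
      rw [Fintype.card_prod, Fintype.card_fin] at this
      rw [sq]
      exact_mod_cast this
    calc (I.E.card : ℝ) * (I.n * (1 / 2 ^ m)) ≤ I.n ^ 2 * (I.n * (1 / 2 ^ m)) := by gcongr
      _ = _ := by ring

/-- The sampled coverage of every set is close to its expectation. -/
def Accurate (q : I.Voter × I.Voter → ℚ) {N m : ℕ}
    (y : Fin N → I.Voter × I.Voter → Fin m → Bool) : Prop :=
  ∀ T : Finset I.Voter, |(sampleCover q y T : ℝ) - N * I.expCover T| ≤ N / (18 * (I.n : ℝ) ^ 2)

theorem rounding_error_le {n : ℕ} (hn : 0 < n) :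
    (n : ℝ) ^ 3 / 2 ^ bitCount n ≤ 1 / (36 * (n : ℝ) ^ 2) := by
  have h1 : 36 * n ^ 5 ≤ 2 ^ bitCount n := by
    -- `11 n = 6 n + 5 n`: the first part pays for `36`, the second for `n^5`.
    calc 36 * n ^ 5 ≤ 2 ^ (6 * n) * (2 ^ n) ^ 5 := by
          refine Nat.mul_le_mul ?_ (Nat.pow_le_pow_left Nat.lt_two_pow_self.le 5)
          calc 36 ≤ 2 ^ 6 := by norm_num
            _ ≤ 2 ^ (6 * n) := Nat.pow_le_pow_right (by norm_num) (by omega)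
      _ = 2 ^ bitCount n := by rw [← pow_mul, ← pow_add, bitCount]; congr 1; ring
  have h2 : (36 : ℝ) * n ^ 5 ≤ 2 ^ bitCount n := by exact_mod_cast h1
  have hn' : (0 : ℝ) < n := by exact_mod_cast hn
  rw [div_le_div_iff₀ (by positivity) (by positivity)]
  calc (n : ℝ) ^ 3 * (36 * n ^ 2) = 36 * n ^ 5 := by ring
    _ ≤ _ := by linarith

open Classical in
theorem avg_not_accurate_le {q : I.Voter × I.Voter → ℚ} (hq : ∀ e, I.p e = (q e : ℝ)) (k : ℕ) :
    avg (fun y : Fin (sampleCount I.n k) → I.Voter × I.Voter → Fin (bitCount I.n) → Bool =>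
      if Accurate q y then (0 : ℝ) else 1) ≤ 1 / 2 ^ k := by
  have hn : (0 : ℝ) < I.n := by exact_mod_cast I.n_pos
  have hn1 : (1 : ℝ) ≤ I.n := by exact_mod_cast I.n_pos
  set N := sampleCount I.n k with hN
  set m := bitCount I.n with hm
  -- The coverage is scaled by `1/n` into `[0, 1]`; deviation `t` there is `1/(36n²)` in the mean
  -- coverage, half of the tolerance in `Accurate`. The rounding of the strengths takes the other
  -- half.
  set t : ℝ := 1 / (36 * (I.n : ℝ) ^ 3) with ht
  let f : Finset I.Voter → (I.Voter × I.Voter → Fin m → Bool) → ℝ := fun T ω =>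
    1 / I.n * ((I.covered (drawGraph q ω) T).card : ℝ)
  let bad : Finset I.Voter → (Fin N → I.Voter × I.Voter → Fin m → Bool) → Prop := fun T y =>
    Fintype.card (Fin N) * t < |∑ i, f T (y i) - Fintype.card (Fin N) * avg (f T)|
  have hf : ∀ T ω, f T ω ∈ Set.Icc (0 : ℝ) 1 := by
    intro T ω
    have h : ((I.covered (drawGraph q ω) T).card : ℝ) ≤ I.n := by
      exact_mod_cast card_covered_le _ T
    refine ⟨by positivity, ?_⟩
    simp only [f]
    rw [one_div, inv_mul_le_iff₀ hn]
    linarith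
  have ht0 : 0 ≤ t := by positivity
  have ht1 : t ≤ 1 := by
    rw [ht, div_le_one (by positivity)]
    have := one_le_pow₀ hn1 (n := 3)
    linarith
  have hbad : ∀ T, avg (fun y => if bad T y then (1 : ℝ) else 0) ≤
      2 * Real.exp (-((I.n + 1 + k : ℕ) : ℝ)) := by
    intro T
    refine (avg_sum_deviation_le (κ := Fin N) (hf T) ht0 ht1).trans (le_of_eq ?_)
    -- `5184 = 4 · 36²`, so `N t² / 4` is exactly `n + 1 + k`.
    congr 3
    rw [Fintype.card_fin, hN, sampleCount, ht]
    push_cast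
    field_simp
    norm_num
  have hacc : ∀ y, (∀ T, ¬ bad T y) → Accurate q y := by
    intro y hy T
    have h1 := not_lt.1 (hy T)
    have h2 := (abs_avg_cover_sub_le hq m T).trans (rounding_error_le I.n_pos)
    set μ := avg fun ω : I.Voter × I.Voter → Fin m → Bool =>
      ((I.covered (drawGraph q ω) T).card : ℝ) with hμ
    have h3 : ∑ i, f T (y i) - Fintype.card (Fin N) * avg (f T) =
        1 / I.n * (sampleCover q y T - N * μ) := by
      simp only [f, avg_mul_left, ← hμ, ← Finset.mul_sum, Fintype.card_fin, sampleCover]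
      push_cast
      ring
    rw [h3, abs_mul, abs_of_pos (by positivity : (0 : ℝ) < 1 / I.n), Fintype.card_fin, one_div,
      inv_mul_le_iff₀ hn] at h1
    have h4 : |(N : ℝ) * μ - N * I.expCover T| ≤ N * (1 / (36 * (I.n : ℝ) ^ 2)) := by
      rw [← mul_sub, abs_mul, abs_of_nonneg (Nat.cast_nonneg N), abs_sub_comm]
      gcongr
    have h5 : (I.n : ℝ) * (N * t) = N * (1 / (36 * (I.n : ℝ) ^ 2)) := by
      rw [ht]; field_simp
    calc |(sampleCover q y T : ℝ) - N * I.expCover T|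
        ≤ |(sampleCover q y T : ℝ) - N * μ| + |(N : ℝ) * μ - N * I.expCover T| :=
          abs_sub_le _ _ _
      _ ≤ N * (1 / (36 * (I.n : ℝ) ^ 2)) + N * (1 / (36 * (I.n : ℝ) ^ 2)) := by
          rw [← h5] at h4 ⊢
          exact add_le_add h1 h4
      _ = _ := by field_simp; ring
  have hpt : ∀ y : Fin N → I.Voter × I.Voter → Fin m → Bool,
      (if Accurate q y then (0 : ℝ) else 1) ≤ ∑ T, if bad T y then (1 : ℝ) else 0 := by
    intro y
    have hnn : ∀ T ∈ (Finset.univ : Finset (Finset I.Voter)),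
        (0 : ℝ) ≤ if bad T y then (1 : ℝ) else 0 := fun T _ => by split_ifs <;> norm_num
    split_ifs with h
    · exact Finset.sum_nonneg hnn
    · obtain ⟨T, hT⟩ : ∃ T, bad T y := by
        by_contra! hcon
        exact h (hacc y hcon)
      refine le_trans ?_ (Finset.single_le_sum hnn (Finset.mem_univ T))
      rw [if_pos hT]
  refine (avg_mono hpt).trans ?_
  rw [avg_sum]
  refine (Finset.sum_le_sum fun T _ => hbad T).trans ?_
  -- Of the exponent, `n` pays for the union bound over `2^n` sets, `1` for the two tails, and `k`
  -- is the confidence.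
  have hexp : Real.exp (-((I.n + 1 + k : ℕ) : ℝ)) ≤ 1 / 2 ^ (I.n + 1 + k) := by
    rw [Real.exp_neg, ← one_div]
    refine one_div_le_one_div_of_le (by positivity) ?_
    have h2 : (2 : ℝ) ≤ Real.exp 1 := by linarith [Real.add_one_le_exp (1 : ℝ)]
    calc (2 : ℝ) ^ (I.n + 1 + k) ≤ Real.exp 1 ^ (I.n + 1 + k) := by gcongr
      _ = _ := by rw [← Real.exp_nat_mul, mul_one]
  rw [Finset.sum_const, Finset.card_univ, Fintype.card_finset, Fintype.card_fin, nsmul_eq_mul]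
  calc (((2 ^ I.n : ℕ) : ℝ)) * (2 * Real.exp (-((I.n + 1 + k : ℕ) : ℝ)))
      ≤ (2 : ℝ) ^ I.n * (2 * (1 / 2 ^ (I.n + 1 + k))) := by
        push_cast at hexp ⊢
        gcongr
    _ = 1 / 2 ^ k := by
        rw [pow_add, pow_add]
        field_simp

/-- Greedy on accurate samples is a `ratio`-approximation. -/
theorem isApprox_of_accurate (hδ : 0 < I.delta) (hB : I.delta ≤ I.B) {q : I.Voter × I.Voter → ℚ}
    {N m : ℕ} (hN : 0 < N) {y : Fin N → I.Voter × I.Voter → Fin m → Bool} (hy : Accurate q y)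
    {S : List I.Voter} (hS : S.Nodup) (hlen : S.length ≤ I.seedCount)
    (hgap : ∀ T : Finset I.Voter, T.card ≤ I.maxSeeds →
      (1 - (1 - 1 / (I.maxSeeds : ℝ)) ^ I.seedCount) * sampleCover q y T ≤
        sampleCover q y S.toFinset) :
    I.IsApprox I.ratio (I.deltaPlan S) := by
  have hK := seedCount_pos hδ hB
  have hKD := I.seedCount_le_maxSeeds
  have hD : 0 < I.maxSeeds := hK.trans_le hKD
  have hN' : (0 : ℝ) < N := by exact_mod_cast hN
  have hn : (0 : ℝ) < I.n := by exact_mod_cast I.n_pos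
  have hD' : (1 : ℝ) ≤ I.maxSeeds := by exact_mod_cast hD
  have hDn : (I.maxSeeds : ℝ) ≤ I.n := by exact_mod_cast min_le_right _ _
  set c : ℝ := 1 - (1 - 1 / (I.maxSeeds : ℝ)) ^ I.seedCount with hc
  have hx1 : 1 / (I.maxSeeds : ℝ) ≤ 1 := by rw [div_le_one (by linarith)]; exact hD'
  have hx0 : 0 ≤ 1 / (I.maxSeeds : ℝ) := by positivity
  have hq0 : (0 : ℝ) ≤ (1 - 1 / (I.maxSeeds : ℝ)) ^ I.seedCount := pow_nonneg (by linarith) _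
  have hq1 : (1 - 1 / (I.maxSeeds : ℝ)) ^ I.seedCount ≤ 1 :=
    pow_le_one₀ (by linarith) (by linarith)
  have hc0 : 0 ≤ c := by rw [hc]; linarith
  have hc1 : c ≤ 1 := by rw [hc]; linarith
  set η : ℝ := 1 / (18 * (I.n : ℝ) ^ 2) with hη
  have hη0 : 0 ≤ η := by positivity
  -- Two sampling errors, at `T` and at `S`, fit into the slack of `greedy_ratio_ge`, as `D ≤ n`.
  have hηD : 2 * η ≤ 1 / (9 * (I.maxSeeds : ℝ) ^ 2) := by
    have : 2 * η = 1 / (9 * (I.n : ℝ) ^ 2) := by rw [hη]; field_simp; norm_num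
    rw [this]
    gcongr
  have hratio : 2 * I.ratio + 2 * η ≤ c := by
    have h1 := greedy_ratio_ge hK hKD
    have h2 := ratio_le hδ hB
    linarith
  have hclose : ∀ T : Finset I.Voter, |(sampleCover q y T : ℝ) - N * I.expCover T| ≤ N * η := by
    intro T
    have := hy T
    rwa [hη, mul_one_div]
  have hmain : ∀ T : Finset I.Voter, T.card ≤ I.maxSeeds →
      c * I.expCover T - 2 * η ≤ I.expCover S.toFinset := by
    intro T hT
    have h1 := (abs_le.1 (hclose T)).1
    have h2 := (abs_le.1 (hclose S.toFinset)).2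
    have h3 := hgap T hT
    have h4 : c * (N * I.expCover T - N * η) ≤ c * sampleCover q y T :=
      mul_le_mul_of_nonneg_left (by linarith) hc0
    have h5 : c * (N * η) ≤ N * η := mul_le_of_le_one_left (by positivity) hc1
    have h6 : N * (c * I.expCover T - 2 * η) ≤ N * I.expCover S.toFinset := by nlinarith
    exact le_of_mul_le_mul_left h6 hN'
  -- The additive error `2 η` becomes multiplicative once the coverage is at least 1.
  have hbig : ∀ T : Finset I.Voter, T.card ≤ I.maxSeeds → 1 ≤ I.expCover T →
      2 * I.ratio * I.expCover T ≤ I.expCover S.toFinset := by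
    intro T hT h1
    have h2 := hmain T hT
    have h3 : (2 * I.ratio + 2 * η) * I.expCover T ≤ c * I.expCover T := by gcongr
    nlinarith
  refine isApprox_deltaPlan hδ hB hS hlen fun T hT => ?_
  rcases le_or_gt 1 (I.expCover T) with h1 | h1
  · exact hbig T hT h1
  -- A set covering less than 1 is replaced by one voter that attains `δ > 0`: it is opposed and
  -- reaches itself, so its coverage is at least 1.
  · obtain ⟨x, hx, hxδ⟩ := Finset.exists_mem_eq_sup' I.pairs_nonempty
      fun x : I.Voter × I.Candidate => (I.score x.1 x.2 : ℤ) - (I.score x.1 0 : ℤ)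
    have hxδ' : I.delta = (I.score x.1 x.2 : ℤ) - (I.score x.1 0 : ℤ) := hxδ
    have hopp : x.1 ∈ I.opposed := mem_opposed.2 ⟨x.2, by omega⟩
    have hone : 1 ≤ I.expCover {x.1} := by
      rw [← I.expect_const 1]
      refine expect_mono fun H => ?_
      have : 0 < (I.covered H {x.1}).card := Finset.card_pos.2
        ⟨x.1, mem_covered.2 ⟨hopp, x.1, Finset.mem_singleton_self _, influenced_self H x.1⟩⟩
      exact_mod_cast this
    refine le_trans ?_ (hbig {x.1} (by rw [Finset.card_singleton]; omega) hone)
    have := ratio_nonneg hδ hB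
    gcongr
    linarith

/-! ### The algorithm on an instance -/

theorem sampleValue_rawInput (q : I.Voter × I.Voter → ℚ) (k : ℕ) {C : ℕ}
    (h : sampleCount I.n k * I.n * I.n * bitCount I.n ≤ C) (r : Fin C → Bool)
    (S : List I.Voter) :
    sampleValue (I.rawInput q k, (List.ofFn r).map Bool.toNat) (S.map Fin.val) =
      sampleCover q (coinTable h r) S.toFinset := by
  have hlive : ∀ (i : Fin (sampleCount I.n k)) (e : I.Voter × I.Voter),
      isLive ((List.ofFn r).map Bool.toNat) (bitCount I.n) I.n i (rawEdge q e) =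
        liveTest q e (coinTable h r i e) := by
    intro i e
    rw [isLive, rawEdge, draw_eq_bitsVal r fun b hb => (coinIndex h (i, e, ⟨b, hb⟩)).2]
    rfl
  have hgraphs : sampleGraphs ((List.ofFn r).map Bool.toNat) (bitCount I.n) I.n
      (sampleCount I.n k) (I.edgeList.map (rawEdge q)) =
      ((List.finRange (sampleCount I.n k)).map fun i =>
        I.edgeList.filter fun e => liveTest q e (coinTable h r i e)).map
          fun H => H.map (rawEdge q) := by
    rw [sampleGraphs, ← List.map_coe_finRange_eq_range, List.map_map, List.map_map]
    refine List.map_congr_left fun i _ => ?_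
    simp only [Function.comp_apply, List.filter_map]
    congr 1
    exact List.filter_congr fun e _ => hlive i e
  have hset : ∀ i, (I.edgeList.filter fun e => liveTest q e (coinTable h r i e)).toFinset =
      drawGraph q (coinTable h r i) := by
    intro i
    ext e
    have : e ∈ (List.finRange I.n).product (List.finRange I.n) := by
      rw [← Prod.mk.eta (p := e)]
      exact List.mem_product.2 ⟨List.mem_finRange _, List.mem_finRange _⟩
    simp [edgeList, drawGraph, this, and_comm]
  simp only [sampleValue, rawInput, length_scoreRows, List.length_replicate]
  rw [hgraphs, value_eq, List.map_map, sampleCover, ← List.sum_ofFn, List.ofFn_eq_map]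
  congr 1
  refine List.map_congr_left fun i _ => ?_
  rw [Function.comp_apply, hset]

theorem enc_algorithm {x : RawInput × List ℕ} {S : List I.Voter} (hδ : 0 < I.delta)
    (hrows : x.1.1.1 = I.scoreRows) (hS : selectedSeeds x = S.map Fin.val) :
    enc (algorithm x) = encodePlan (I.deltaPlan S) := by
  have hlen : (I.scoreRows.getD 0 []).length = I.ℓ + 1 := by
    rw [show (0 : ℕ) = ((⟨0, I.n_pos⟩ : I.Voter) : ℕ) from rfl, getD_scoreRows]
    simp
  have hmsg : enc (message I.delta.toNat (I.ℓ + 1)) = Val.ofList ((List.finRange (I.ℓ + 1)).map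
      fun c => Val.pair (Val.num ((Pi.single 0 I.delta : I.Message) c).toNat)
        (Val.num (-(Pi.single 0 I.delta : I.Message) c).toNat)) := by
    rw [message, ← List.map_coe_finRange_eq_range, List.map_map]
    simp only [enc, List.map_map]
    congr 1
    refine List.map_congr_left fun c _ => ?_
    rcases eq_or_ne c 0 with rfl | hc
    · simp
      omega
    · have : (c : ℕ) ≠ 0 := fun h => hc (Fin.ext h)
      simp [hc, this]
  rw [algorithm, hS, hrows, maxExcess_scoreRows hδ, hlen, encodePlan, deltaPlan]
  change Val.ofList (List.map enc _) = _
  rw [List.map_map, List.map_map, List.map_map]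
  congr 1
  refine List.map_congr_left fun s _ => ?_
  simp only [Function.comp_apply, ← hmsg]
  rfl

theorem sampleCount_pos (I : ECSInstance) (k : ℕ) : 0 < sampleCount I.n k := by
  have := I.n_pos
  unfold sampleCount
  positivity

theorem exists_selectedSeeds (hδ : 0 < I.delta) (hB : I.delta ≤ I.B) {q : I.Voter × I.Voter → ℚ}
    (hq : ∀ e, I.p e = (q e : ℝ)) (k : ℕ) {C : ℕ}
    (h : sampleCount I.n k * I.n * I.n * bitCount I.n ≤ C) (r : Fin C → Bool) :
    ∃ L : I.Plan,
      enc (algorithm (I.rawInput q k, (List.ofFn r).map Bool.toNat)) = encodePlan L ∧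
      I.Feasible L ∧ I.GreedyBuilt L ∧
      (Accurate q (coinTable h r) → I.IsApprox I.ratio L) := by
  obtain ⟨S, h1, h2, h3, h4⟩ := greedySeeds_spec I.n_pos (sampleValue_rawInput q k h r)
    (isCoverage_sampleCover q (coinTable h r)) (show 0 < I.delta.toNat by omega) I.B
  have hsel : selectedSeeds (I.rawInput q k, (List.ofFn r).map Bool.toNat) = S.map Fin.val := by
    rw [← h1, selectedSeeds]
    simp only [rawInput, length_scoreRows, maxExcess_scoreRows hδ]
  have hD : 0 < I.maxSeeds := (seedCount_pos hδ hB).trans_le I.seedCount_le_maxSeeds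
  exact ⟨I.deltaPlan S, enc_algorithm hδ rfl hsel,
    feasible_deltaPlan hδ h2.nodup ((Nat.mul_le_mul_right _ h3).trans I.seedCount_mul_le),
    greedyBuilt_of_strictChain hδ hq h2,
    fun hacc => isApprox_of_accurate hδ hB (sampleCount_pos I k) hacc h2.nodup h3
      fun T hT => h4 I.maxSeeds T hD hT⟩

/-- A bound on the number of random bits in terms of the input length. -/
noncomputable def coinPoly : Polynomial ℕ :=
  5184 * Polynomial.X ^ 6 * (Polynomial.X + 1 + Polynomial.X) * Polynomial.X * Polynomial.X *
    (11 * Polynomial.X)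

theorem le_coinPoly (q : I.Voter × I.Voter → ℚ) (k : ℕ) :
    sampleCount I.n k * I.n * I.n * bitCount I.n ≤ coinPoly.eval (sz (I.rawInput q k)) := by
  have h0 : sz (I.rawInput q k) = 1 + (1 + sz I.scoreRows +
      sz (I.edgeList.map (rawEdge q), I.B, 0)) + sz (List.replicate k 0) := rfl
  have h1 := length_lt_sz I.scoreRows
  have h2 := length_lt_sz (List.replicate k 0)
  rw [length_scoreRows] at h1
  rw [List.length_replicate] at h2
  -- Each voter contributes a row of scores, and `k` is given in unary, so both are below the input
  -- length.
  have hn : I.n ≤ sz (I.rawInput q k) := by omega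
  have hk : k ≤ sz (I.rawInput q k) := by omega
  simp only [coinPoly, sampleCount, bitCount, Polynomial.eval_mul, Polynomial.eval_pow,
    Polynomial.eval_add, Polynomial.eval_X, Polynomial.eval_ofNat, Polynomial.eval_one]
  gcongr

end ECSInstance

theorem theorem2 :
    -- the greedy algorithm with exact expectations
    (∀ I : ECSInstance, 0 < I.delta → I.delta ≤ I.B →
      ∀ S : List I.Voter, I.GreedySeeds S → S.length = min (I.B / I.delta.toNat) I.n →
        I.IsApprox I.ratio (I.deltaPlan S)) ∧
    -- a randomized polynomial-time greedy algorithm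
    (∃ (P : Prog) (coins steps : Polynomial ℕ),
      ∀ (I : ECSInstance) (q : I.Voter × I.Voter → ℚ), (∀ e, I.p e = (q e : ℝ)) →
        0 < I.delta → I.delta ≤ I.B →
        ∀ k : ℕ, ∃ sol : (Fin (coins.eval (I.encodeInput q k).size) → Bool) → I.Plan,
          (∀ r, P.time (I.encodeInput q k) r ≤ steps.eval (I.encodeInput q k).size ∧
            P.output (I.encodeInput q k) r = ECSInstance.encodePlan (sol r) ∧
            I.Feasible (sol r) ∧ I.GreedyBuilt (sol r)) ∧
          1 - 1 / 2 ^ k ≤ coinProb {r | I.IsApprox I.ratio (sol r)}) := by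
  classical
  refine ⟨fun I hδ hB S hS hlen => hS.isApprox hδ hB hlen, ?_⟩
  obtain ⟨P, steps, hP⟩ := PolyTime.algorithm.exists_prog ECSInstance.coinPoly
  refine ⟨P, ECSInstance.coinPoly, steps, fun I q hq hδ hB k => ?_⟩
  rw [← ECSInstance.enc_rawInput q k]
  have hC := ECSInstance.le_coinPoly (I := I) q k
  choose sol h1 h2 h3 h4 using fun r : Fin (ECSInstance.coinPoly.eval (sz (I.rawInput q k))) → Bool =>
    ECSInstance.exists_selectedSeeds hδ hB hq k hC r
  refine ⟨sol, fun r => ⟨(hP (I.rawInput q k) r).1, (hP (I.rawInput q k) r).2.trans (h1 r),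
    h2 r, h3 r⟩, ?_⟩
  have hacc := ECSInstance.avg_not_accurate_le hq k
  rw [← avg_coinTable hC] at hacc
  -- Inaccurate samples are the only possible cause of failure, so the success probability is at
  -- least 1 minus their probability.
  have hsub : 1 - (avg fun r : Fin (ECSInstance.coinPoly.eval (sz (I.rawInput q k))) → Bool =>
      if ECSInstance.Accurate q (coinTable hC r) then (0 : ℝ) else 1) ≤
      coinProb {r | I.IsApprox I.ratio (sol r)} := by
    have hone := avg_const (Ω := Fin (ECSInstance.coinPoly.eval (sz (I.rawInput q k))) → Bool) 1
    rw [coinProb_eq_avg]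
    refine (congrArg (· - _) hone).ge.trans ?_
    rw [← avg_sub]
    refine avg_mono fun r => ?_
    by_cases hr : ECSInstance.Accurate q (coinTable hC r)
    · have : r ∈ {r | I.IsApprox I.ratio (sol r)} := h4 r hr
      rw [if_pos hr, if_pos this, sub_zero]
    · rw [if_neg hr, sub_self]
      split_ifs <;> norm_num
  exact le_trans (by linarith) hsub
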